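/- Let $\rho\in(0,1)$. For $\gamma_1<-1/2$ close to $-1/2$ put $\gamma_2=(\gamma_1+1/2)/\rho-1/2$, so that $\gamma_1,\gamma_2\in(-1,-1/2)$, $\gamma_1\ge\gamma_2$ and $\gamma_1+\gamma_2>-3/2$. Let $B=(B_x)_{x\in\mathbb R}$ be a standard Brownian motion on the real line and let $$Z_{\gamma_1,\gamma_2}=A(\gamma_1,\gamma_2)\int_{\mathbb R^2}\Big(\int_0^1(s-x_1)_+^{\gamma_1}(s-x_2)_+^{\gamma_2}\,ds\Big)\,dB_{x_1}dB_{x_2},$$ where the outer integral is the double Wiener–Itô integral (the $L^2$-extension of the integral of finite linear combinations of indicators of off-diagonal rectangles, $\mathbf 1_{(l_1,r_1]\times(l_2,r_2]}\mapsto(B_{r_1}-B_{l_1})(B_{r_2}-B_{l_2})$ for disjoint intervals) and $$A(\gamma_1,\gamma_2)=\frac{\big[(\gamma_1+\gamma_2+2)(2(\gamma_1+\gamma_2)+3)\big]^{1/2}}{\big[\mathrm B(\gamma_1+1,-\gamma_1-\gamma_2-1)\mathrm B(\gamma_2+1,-\gamma_1-\gamma_2-1)+\mathrm B(\gamma_1+1,-2\gamma_1-1)\mathrm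 B(\gamma_2+1,-2\gamma_2-1)\big]^{1/2}}$$ is the constant that gives $Z_{\gamma_1,\gamma_2}$ unit variance, $\mathrm B$ being the Euler Beta function. Let $$Y_\rho=\frac{a_\rho}{\sqrt2}(N_1^2-1)+\frac{b_\rho}{\sqrt2}(N_2^2-1),\qquad a_\rho,b_\rho=\frac{(\rho+1)^{-1}\pm(2\sqrt\rho)^{-1}}{\sqrt{2(\rho+1)^{-2}+(2\rho)^{-1}}}$$ ($+$ for $a_\rho$, $-$ for $b_\rho$), with $N_1,N_2$ independent standard normal random variables. Write $\kappa_m(X)$ for the $m$-th cumulant of $X$, i.e. the $m$-th derivative at $0$ of $t\mapsto\log\mathbb E[e^{tX}]$, and $W_2$ for the Wasserstein distance of order $2$ between laws on $\mathbb R$. Then: 1. for every $m\ge3$, as $\gamma_1\to-1/2$ from below, $$\kappa_m(Z_{\gamma_1,\gamma_2})=\kappa_m(Y_\rho)+O\big(-\gamma_1-\tfrac12\big),$$ where the constant in $O(\cdot)$ depends only on $m$ and $\rho$; 2. there is a constant $C_\rho>0$, depending only on $\rho$, such that for all $\gamma_1<-1/2$ sufficiently close to $-1/2$, $$W_2(Z_{\gamma_1,\gamma_2},Y_\rho)\le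 C_\rho\sqrt{-\gamma_1-\tfrac12}.$$ -/

import Mathlib

open MeasureTheory ProbabilityTheory Filter Topology Set
open scoped ENNReal NNReal

noncomputable section

namespace BaiTaqqu

/-! ### Cumulants and Wasserstein distances -/

/-- The `m`-th cumulant of a real random variable `X` under `P`: the `m`-th derivative at `0` of the
cumulant generating function `t ↦ log E[exp (t X)]` (used here for random variables which have
exponential moments near `0`, as is the case for all elements of the second Wiener chaos). -/
def cumulant {Ω : Type*} [MeasurableSpace Ω] (m : ℕ) (X : Ω → ℝ) (P : Measure Ω) : ℝ :=
  iteratedDeriv m (cgf X P) 0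

/-- The Wasserstein distance of order `p` between two laws on `ℝ`, as an infimum over couplings. -/
def wasserstein (p : ℝ) (μ ν : Measure ℝ) : ℝ≥0∞ :=
  ⨅ (π : Measure (ℝ × ℝ)) (_ : π.map Prod.fst = μ) (_ : π.map Prod.snd = ν),
    (∫⁻ z, ‖z.1 - z.2‖ₑ ^ p ∂π) ^ (1 / p)

/-! ### Brownian motion on the real line and the double Wiener–Itô integral -/

/-- `B` is a standard Brownian motion indexed by the whole real line. -/
structure IsTwoSidedBrownian {Ω : Type*} [MeasurableSpace Ω] (B : ℝ → Ω → ℝ) (P : Measure Ω) :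
    Prop where
  zero : ∀ᵐ ω ∂P, B 0 ω = 0
  indep : HasIndepIncrements B P
  law : ∀ s t : ℝ, s ≤ t → HasLaw (fun ω ↦ B t ω - B s ω) (gaussianReal 0 (t - s).toNNReal) P
  cont : ∀ᵐ ω ∂P, Continuous fun t ↦ B t ω

/-- A rectangle `(l₁, r₁] × (l₂, r₂]` whose two sides are disjoint intervals, i.e. a rectangle that
does not meet the diagonal of `ℝ²`. -/
structure OffDiagRect where
  l₁ : ℝ
  r₁ : ℝ
  l₂ : ℝ
  r₂ : ℝ
  le₁ : l₁ ≤ r₁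
  le₂ : l₂ ≤ r₂
  disj : r₁ ≤ l₂ ∨ r₂ ≤ l₁

/-- An elementary function: a finite linear combination of indicators of off-diagonal rectangles,
recorded by its coefficients. -/
abbrev Elementary := OffDiagRect →₀ ℝ

/-- The function on `ℝ²` given by an elementary function. -/
def Elementary.eval (g : Elementary) (x : ℝ × ℝ) : ℝ :=
  g.sum fun R c ↦ c * (Ioc R.l₁ R.r₁ ×ˢ Ioc R.l₂ R.r₂).indicator (fun _ ↦ (1 : ℝ)) x

/-- The double integral of an elementary function against `dB_{x₁} dB_{x₂}`: the rectangle
`(l₁, r₁] × (l₂, r₂]` is sent to `(B_{r₁} - B_{l₁}) (B_{r₂} - B_{l₂})`. -/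
def Elementary.integral {Ω : Type*} (B : ℝ → Ω → ℝ) (g : Elementary) (ω : Ω) : ℝ :=
  g.sum fun R c ↦ c * ((B R.r₁ ω - B R.l₁ ω) * (B R.r₂ ω - B R.l₂ ω))

/-- `Z` is a version of the double Wiener–Itô integral of `f ∈ L²(ℝ²)` with respect to `B`: it is
the limit in `L²(P)` of the integrals of elementary functions converging to `f` in `L²(ℝ²)`. (By
the Itô isometry such a `Z` exists, is a.s. unique, and does not depend on the sequence.) -/
def IsDoubleWienerIto {Ω : Type*} [MeasurableSpace Ω] (B : ℝ → Ω → ℝ) (P : Measure Ω)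
    (f : ℝ × ℝ → ℝ) (Z : Ω → ℝ) : Prop :=
  MemLp f 2 (volume : Measure (ℝ × ℝ)) ∧ MemLp Z 2 P ∧
    ∃ g : ℕ → Elementary,
      Tendsto (fun n ↦ eLpNorm (fun x ↦ f x - (g n).eval x) 2 (volume : Measure (ℝ × ℝ)))
        atTop (𝓝 0) ∧
      Tendsto (fun n ↦ eLpNorm (fun ω ↦ Z ω - (g n).integral B ω) 2 P) atTop (𝓝 0)

open Classical in
/-- (A version of) the double Wiener–Itô integral of `f` with respect to `B`; by convention `0`
if `f` has no such integral. -/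
def doubleWienerIto {Ω : Type*} [MeasurableSpace Ω] (B : ℝ → Ω → ℝ) (P : Measure Ω)
    (f : ℝ × ℝ → ℝ) : Ω → ℝ :=
  if h : ∃ Z, IsDoubleWienerIto B P f Z then h.choose else 0

/-! ### The random variables -/

/-- The kernel `(x₁, x₂) ↦ ∫₀¹ (s - x₁)₊^γ₁ (s - x₂)₊^γ₂ ds`. For `γ₁, γ₂ > -1` the integral
converges off the diagonal; the diagonal is a null set. -/
def kernel (γ₁ γ₂ : ℝ) (x : ℝ × ℝ) : ℝ :=
  ∫ s in (0 : ℝ)..1, max (s - x.1) 0 ^ γ₁ * max (s - x.2) 0 ^ γ₂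

/-- The constant `A(γ₁, γ₂)` that normalizes the double integral to unit variance. -/
def normConst (γ₁ γ₂ : ℝ) : ℝ :=
  √((γ₁ + γ₂ + 2) * (2 * (γ₁ + γ₂) + 3)) /
    √(beta (γ₁ + 1) (-γ₁ - γ₂ - 1) * beta (γ₂ + 1) (-γ₁ - γ₂ - 1) +
      beta (γ₁ + 1) (-2 * γ₁ - 1) * beta (γ₂ + 1) (-2 * γ₂ - 1))

/-- The random variable `Z_{γ₁,γ₂}`, driven by the Brownian motion `B`. -/
def Zvar {Ω : Type*} [MeasurableSpace Ω] (B : ℝ → Ω → ℝ) (P : Measure Ω) (γ₁ γ₂ : ℝ) (ω : Ω) : ℝ :=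
  normConst γ₁ γ₂ * doubleWienerIto B P (kernel γ₁ γ₂) ω

/-- The coefficient `a_ρ`. -/
def aCoef (ρ : ℝ) : ℝ :=
  ((ρ + 1)⁻¹ + (2 * √ρ)⁻¹) / √(2 * ((ρ + 1) ^ 2)⁻¹ + (2 * ρ)⁻¹)

/-- The coefficient `b_ρ`. -/
def bCoef (ρ : ℝ) : ℝ :=
  ((ρ + 1)⁻¹ - (2 * √ρ)⁻¹) / √(2 * ((ρ + 1) ^ 2)⁻¹ + (2 * ρ)⁻¹)

/-- The law of a pair of independent standard normal random variables. -/
abbrev gaussPair : Measure (ℝ × ℝ) := (gaussianReal 0 1).prod (gaussianReal 0 1)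

/-- The limit `Y_ρ`, as a random variable on `ℝ²` with the measure `gaussPair`. -/
def Yvar (ρ : ℝ) (z : ℝ × ℝ) : ℝ :=
  aCoef ρ / √2 * (z.1 ^ 2 - 1) + bCoef ρ / √2 * (z.2 ^ 2 - 1)

/-- The exponent `γ₂` as a function of `γ₁` and `ρ`. -/
def gammaTwo (ρ γ₁ : ℝ) : ℝ := (γ₁ + 1 / 2) / ρ - 1 / 2

end BaiTaqqu

end

open scoped RealInnerProductSpace

namespace BaiTaqqu

/-! ### Isonormal Gaussian processes -/

/-! Put δ = -γ₁ - 1/2, so that γ₁ = -1/2 - δ and γ₂ = -1/2 - δ/ρ. As δ → 0 the L² mass of the kernel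
escapes to -∞. For x₁, x₂ < -1 the kernel is close to (-x₁)^γ₁ (-x₂)^γ₂, a tensor product t₁ ⊗ t₂ of
two tails with ‖t₁‖² = 1/(2δ) and ‖t₂‖² = ρ/(2δ). The constant A is of order δ, by the pole of the
Beta function at 0 (`exists_abs_normConst_mul_sub_one_le`), so A I₂(t₁ ⊗ t₂) has order one. The
normalized tails have inner product 2√ρ/(1+ρ), whatever δ is. Diagonalizing their symmetrized tensor
product (`wick_eq_rotate`) shows that A I₂(t₁ ⊗ t₂) is a copy Y of Y_ρ on an orthonormal pair e, up
to a factor 1 + O(δ) (`normConst_smul_wick`).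

The rest of the kernel is dominated by products in which at most one factor is a singular tail, so
its norm is O(δ^(-1/2)) (`norm_remainder_le`). Hence Z = Y + R with ‖R‖ = O(√δ), and the joint law
of (Z, Y) is a coupling that proves the Wasserstein bound.

The cumulant bound asks for the order of ‖R‖². Expand E[(Y+R)^k] around Y. The quadratic remainder
is O(δ), because in the second chaos all moments are controlled by the L² norm
(`integral_abs_pow_le`). In the linear term E[Y^(k-1) R] the power of Y is a function of two
Gaussian coordinates, so it sees only the components of R along the e i ⊗ e j
(`inner_chaos_eq_sum`). The remainder of the kernel has bounded inner products with these
(`abs_inner_smul_remainder_le`), and the factor A supplies δ. The moment-cumulant recursion passes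
the bound on to cumulants (`exists_abs_sub_le_of_recursion`).

The double integral is handled through the isonormal process W of B, as the bounded map `chaos` that
sends h ⊗ k to W(h)W(k) - ⟨h, k⟩. On off-diagonal rectangles it agrees with the elementary integral.
-/

theorem hasDerivAt_mul_exp_sq {p : ℝ → ℝ} {p' v t : ℝ} (hp : HasDerivAt p p' t) :
    HasDerivAt (fun t ↦ p t * Real.exp (v * t ^ 2 / 2))
      ((p' + p t * (v * t)) * Real.exp (v * t ^ 2 / 2)) t := by
  have h1 : HasDerivAt (fun t : ℝ ↦ v * t ^ 2 / 2) (v * t) t :=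
    (((hasDerivAt_pow 2 t).const_mul v).div_const 2).congr_deriv (by norm_num; ring)
  exact (hp.mul h1.exp).congr_deriv (by ring)

/-- The moment is the fourth derivative at 0 of exp(v t²/2); each derivative is again a polynomial
times this exponential. -/
theorem integral_pow_four_gaussianReal (v : ℝ≥0) : ∫ x, x ^ 4 ∂(gaussianReal 0 v) = 3 * (v : ℝ) ^ 2 := by
  have h := iteratedDeriv_mgf_zero (X := id) (μ := gaussianReal 0 v)
    (by simp [integrableExpSet_id_gaussianReal]) 4
  have h' : ∫ x, x ^ 4 ∂(gaussianReal 0 v) = iteratedDeriv 4 (mgf id (gaussianReal 0 v)) 0 := by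
    rw [h]; simp
  have h0 : mgf id (gaussianReal 0 v) = fun t : ℝ ↦ 1 * Real.exp ((v : ℝ) * t ^ 2 / 2) := by
    rw [mgf_id_gaussianReal]; ext t; simp
  have h1 : deriv (fun t : ℝ ↦ 1 * Real.exp ((v : ℝ) * t ^ 2 / 2)) =
      fun t ↦ ((v : ℝ) * t) * Real.exp ((v : ℝ) * t ^ 2 / 2) := by
    ext t
    rw [(hasDerivAt_mul_exp_sq (p := fun _ ↦ 1) (v := v) (hasDerivAt_const t (1 : ℝ))).deriv]
    ring
  have h2 : deriv (fun t : ℝ ↦ ((v : ℝ) * t) * Real.exp ((v : ℝ) * t ^ 2 / 2)) =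
      fun t ↦ ((v : ℝ) + (v : ℝ) ^ 2 * t ^ 2) * Real.exp ((v : ℝ) * t ^ 2 / 2) := by
    ext t
    rw [(hasDerivAt_mul_exp_sq (p := fun t ↦ (v : ℝ) * t) (v := v)
      ((hasDerivAt_id' t).const_mul (v : ℝ))).deriv]
    ring
  have h3 : deriv (fun t : ℝ ↦ ((v : ℝ) + (v : ℝ) ^ 2 * t ^ 2) * Real.exp ((v : ℝ) * t ^ 2 / 2)) =
      fun t ↦ (3 * (v : ℝ) ^ 2 * t + (v : ℝ) ^ 3 * t ^ 3) * Real.exp ((v : ℝ) * t ^ 2 / 2) := by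
    ext t
    rw [(hasDerivAt_mul_exp_sq (p := fun t ↦ (v : ℝ) + (v : ℝ) ^ 2 * t ^ 2) (v := v)
      (((hasDerivAt_pow 2 t).const_mul ((v : ℝ) ^ 2)).const_add (v : ℝ))).deriv]
    norm_num
    ring
  have h4 : deriv (fun t : ℝ ↦ (3 * (v : ℝ) ^ 2 * t + (v : ℝ) ^ 3 * t ^ 3) *
      Real.exp ((v : ℝ) * t ^ 2 / 2)) 0 = 3 * (v : ℝ) ^ 2 := by
    rw [(hasDerivAt_mul_exp_sq (p := fun t ↦ 3 * (v : ℝ) ^ 2 * t + (v : ℝ) ^ 3 * t ^ 3) (v := v)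
      (((hasDerivAt_id' (0 : ℝ)).const_mul (3 * (v : ℝ) ^ 2)).add
      ((hasDerivAt_pow 3 (0 : ℝ)).const_mul ((v : ℝ) ^ 3)))).deriv]
    simp
  rw [h', h0, iteratedDeriv_succ, iteratedDeriv_succ, iteratedDeriv_succ, iteratedDeriv_one, h1, h2,
    h3, h4]

variable {Ω : Type*} [MeasurableSpace Ω] {P : Measure Ω}
  {H : Type*} [NormedAddCommGroup H] [InnerProductSpace ℝ H]

/-- A linear isometry of a Hilbert space into `L²(P)` all of whose values are centred Gaussian. -/
structure IsIsonormal (W : H →ₗᵢ[ℝ] Lp ℝ 2 P) : Prop where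
  map_eq : ∀ h, P.map (W h) = gaussianReal 0 (‖h‖₊ ^ 2)

namespace IsIsonormal

variable {W : H →ₗᵢ[ℝ] Lp ℝ 2 P}

theorem aemeasurable (W : H →ₗᵢ[ℝ] Lp ℝ 2 P) (h : H) : AEMeasurable (W h) P :=
  (Lp.aestronglyMeasurable _).aemeasurable

theorem hasGaussianLaw (hW : IsIsonormal W) (h : H) : HasGaussianLaw (W h) P :=
  ⟨by rw [hW.map_eq]; infer_instance⟩

theorem memLp (hW : IsIsonormal W) (h : H) {p : ℝ≥0∞} (hp : p ≠ ∞) : MemLp (W h) p P :=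
  (hW.hasGaussianLaw h).memLp hp

theorem integral_comp (hW : IsIsonormal W) (h : H) {f : ℝ → ℝ} (hf : Continuous f) :
    ∫ ω, f (W h ω) ∂P = ∫ x, f x ∂(gaussianReal 0 (‖h‖₊ ^ 2)) := by
  rw [← hW.map_eq, integral_map (aemeasurable W h) hf.aestronglyMeasurable]

theorem integral_eq_zero (hW : IsIsonormal W) (h : H) : ∫ ω, W h ω ∂P = 0 := by
  rw [hW.integral_comp h (f := fun x ↦ x) continuous_id, integral_id_gaussianReal]

theorem integral_pow_four (hW : IsIsonormal W) (h : H) : ∫ ω, W h ω ^ 4 ∂P = 3 * (‖h‖ ^ 2) ^ 2 := by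
  rw [hW.integral_comp h (f := fun x ↦ x ^ 4) (by fun_prop), integral_pow_four_gaussianReal]
  simp

theorem integral_mul (W : H →ₗᵢ[ℝ] Lp ℝ 2 P) (h k : H) : ∫ ω, W h ω * W k ω ∂P = ⟪h, k⟫ := by
  rw [← W.inner_map_map, L2.inner_def]
  simp [mul_comm]

theorem coe_sum_smul {ι : Type*} (W : H →ₗᵢ[ℝ] Lp ℝ 2 P) (s : Finset ι) (c : ι → ℝ) (h : ι → H) :
    (W (∑ i ∈ s, c i • h i) : Ω → ℝ) =ᵐ[P] fun ω ↦ ∑ i ∈ s, c i * W (h i) ω := by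
  classical
  induction s using Finset.induction_on with
  | empty =>
    simp only [Finset.sum_empty, map_zero]
    exact Lp.coeFn_zero _ _ _
  | insert i s hi ih =>
    rw [Finset.sum_insert hi, map_add, map_smul]
    filter_upwards [Lp.coeFn_add (c i • W (h i)) (W (∑ i ∈ s, c i • h i)),
      Lp.coeFn_smul (c i) (W (h i)), ih] with ω h1 h2 h3
    rw [Finset.sum_insert hi, h1, Pi.add_apply, h2, h3]
    simp

theorem memLp_mul (hW : IsIsonormal W) (h k : H) {p : ℝ≥0∞} (hp : p ≠ ∞) :
    MemLp (fun ω ↦ W h ω * W k ω) p P :=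
  (hW.memLp k (p := 2 * p) (by finiteness)).mul' (hW.memLp h (p := 2 * p) (by finiteness))
    (hpqr := ⟨by
      rw [ENNReal.mul_inv (by simp) (by simp), ← add_mul, ENNReal.inv_two_add_inv_two, one_mul]⟩)

/-- Isserlis' formula. By linearity of `W` it follows from the fourth moment of a single Gaussian,
by polarization, without joint laws. -/
theorem integral_mul_mul_mul (hW : IsIsonormal W) (a b c d : H) :
    ∫ ω, (W a ω * W b ω) * (W c ω * W d ω) ∂P =
      ⟪a, b⟫ * ⟪c, d⟫ + ⟪a, c⟫ * ⟪b, d⟫ + ⟪a, d⟫ * ⟪b, c⟫ := by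
  have key : ∀ x y z : ℝ, ∫ ω, (W a ω + x * W b ω + y * W c ω + z * W d ω) ^ 4 ∂P =
      3 * (⟪a, a⟫ + x ^ 2 * ⟪b, b⟫ + y ^ 2 * ⟪c, c⟫ + z ^ 2 * ⟪d, d⟫ + 2 * x * ⟪a, b⟫ + 2 * y * ⟪a, c⟫
        + 2 * z * ⟪a, d⟫ + 2 * x * y * ⟪b, c⟫ + 2 * x * z * ⟪b, d⟫ + 2 * y * z * ⟪c, d⟫) ^ 2 := by
    intro x y z
    have e := coe_sum_smul W Finset.univ ![1, x, y, z] ![a, b, c, d]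
    have e' := hW.integral_pow_four (∑ i, (![1, x, y, z] i : ℝ) • (![a, b, c, d] i : H))
    rw [integral_congr_ae (g := fun ω ↦ (W a ω + x * W b ω + y * W c ω + z * W d ω) ^ 4)
      (by filter_upwards [e] with ω hω; rw [hω]; simp [Fin.sum_univ_four])] at e'
    rw [e', ← real_inner_self_eq_norm_sq]
    congr 2
    simp only [Fin.sum_univ_four, Matrix.cons_val, inner_add_left, inner_add_right,
      real_inner_smul_left, real_inner_smul_right, one_smul]
    rw [real_inner_comm a b, real_inner_comm a c, real_inner_comm a d, real_inner_comm b c,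
      real_inner_comm b d, real_inner_comm c d]
    ring
  have hint : ∀ x y z : ℝ,
      Integrable (fun ω ↦ (W a ω + x * W b ω + y * W c ω + z * W d ω) ^ 4) P := by
    intro x y z
    have : MemLp (fun ω ↦ W a ω + x * W b ω + y * W c ω + z * W d ω) 4 P :=
      (((hW.memLp a (by simp)).add ((hW.memLp b (by simp)).const_mul x)).add
        ((hW.memLp c (by simp)).const_mul y)).add ((hW.memLp d (by simp)).const_mul z)
    have := this.integrable_norm_pow (p := 4) (by norm_num)
    refine this.congr (ae_of_all _ fun ω ↦ ?_)
    simp only [Real.norm_eq_abs]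
    exact Even.pow_abs (by decide) _
  -- Each of the eight signed fourth powers contributes 4! copies of the mixed monomial, and 192 = 8
  -- · 4!.
  have hpol : (fun ω ↦ (W a ω * W b ω) * (W c ω * W d ω)) = fun ω ↦ (1 / 192 : ℝ) *
      ((W a ω + 1 * W b ω + 1 * W c ω + 1 * W d ω) ^ 4
      - (W a ω + (-1) * W b ω + 1 * W c ω + 1 * W d ω) ^ 4
      - (W a ω + 1 * W b ω + (-1) * W c ω + 1 * W d ω) ^ 4
      - (W a ω + 1 * W b ω + 1 * W c ω + (-1) * W d ω) ^ 4
      + (W a ω + (-1) * W b ω + (-1) * W c ω + 1 * W d ω) ^ 4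
      + (W a ω + (-1) * W b ω + 1 * W c ω + (-1) * W d ω) ^ 4
      + (W a ω + 1 * W b ω + (-1) * W c ω + (-1) * W d ω) ^ 4
      - (W a ω + (-1) * W b ω + (-1) * W c ω + (-1) * W d ω) ^ 4) := by
    ext ω; ring
  rw [hpol, integral_const_mul, integral_sub (by fun_prop (disch := exact hint _ _ _)) (hint _ _ _),
    integral_add (by fun_prop) (hint _ _ _), integral_add (by fun_prop) (hint _ _ _),
    integral_add (by fun_prop) (hint _ _ _), integral_sub (by fun_prop) (hint _ _ _),
    integral_sub (by fun_prop) (hint _ _ _), integral_sub (hint _ _ _) (hint _ _ _)]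
  simp only [key]
  ring

end IsIsonormal

end BaiTaqqu

namespace BaiTaqqu

variable {Ω : Type*} [MeasurableSpace Ω] {P : Measure Ω}
  {H : Type*} [NormedAddCommGroup H] [InnerProductSpace ℝ H]

namespace IsIsonormal

variable {W : H →ₗᵢ[ℝ] Lp ℝ 2 P}

/-! ### Joint Gaussian laws, covariance and independence. -/

theorem hasGaussianLaw_linear (hW : IsIsonormal W) {E ι : Type*} [Fintype ι] [NormedAddCommGroup E]
    [NormedSpace ℝ E] [MeasurableSpace E] [BorelSpace E] {X : Ω → E} (hX : AEMeasurable X P)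
    (k : ι → H) (a : (E →L[ℝ] ℝ) → ι → ℝ)
    (h : ∀ L : E →L[ℝ] ℝ, ∀ ω, L (X ω) = ∑ i, a L i * W (k i) ω) : HasGaussianLaw X P := by
  refine ⟨isGaussian_of_isGaussian_map fun L ↦ ?_⟩
  rw [AEMeasurable.map_map_of_aemeasurable (by fun_prop) hX]
  have := (hW.hasGaussianLaw (∑ i, a L i • k i)).congr (coe_sum_smul W Finset.univ (a L) k)
  convert! this.isGaussian_map using 2
  ext ω
  exact h L ω

theorem hasGaussianLaw_pi (hW : IsIsonormal W) {ι : Type*} [Fintype ι] (h : ι → H) :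
    HasGaussianLaw (fun ω i ↦ W (h i) ω) P := by
  classical
  refine hW.hasGaussianLaw_linear (aemeasurable_pi_lambda _ fun i ↦ aemeasurable W (h i)) h
    (fun L i ↦ L (Pi.single i 1)) fun L ω ↦ ?_
  conv_lhs => rw [pi_eq_sum_univ' (fun i ↦ W (h i) ω)]
  rw [map_sum]
  refine Finset.sum_congr rfl fun i _ ↦ ?_
  rw [map_smul, smul_eq_mul, mul_comm]

theorem hasGaussianLaw_pi_prod (hW : IsIsonormal W) {ι κ : Type*} [Fintype ι] [Fintype κ]
    (h : ι → H) (k : κ → H) :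
    HasGaussianLaw (fun ω ↦ ((fun i ↦ W (h i) ω), (fun j ↦ W (k j) ω))) P := by
  have := hW.hasGaussianLaw_pi (Sum.elim h k)
  have := this.map_fun
    ((ContinuousLinearMap.pi fun i : ι ↦ ContinuousLinearMap.proj (R := ℝ) (Sum.inl i : ι ⊕ κ)).prod
      (ContinuousLinearMap.pi fun j : κ ↦ ContinuousLinearMap.proj (R := ℝ) (Sum.inr j : ι ⊕ κ)))
  exact this

theorem covariance_eq (hW : IsIsonormal W) (h k : H) : cov[W h, W k; P] = ⟪h, k⟫ := by
  have := (hW.hasGaussianLaw h).isProbabilityMeasure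
  rw [covariance_eq_sub ((hW.hasGaussianLaw h).memLp_two) ((hW.hasGaussianLaw k).memLp_two),
    hW.integral_eq_zero h, zero_mul, sub_zero]
  exact integral_mul W h k

theorem iIndepFun_of_orthonormal (hW : IsIsonormal W) {ι : Type*} [Fintype ι] {e : ι → H}
    (he : Orthonormal ℝ e) : iIndepFun (fun i ↦ (W (e i) : Ω → ℝ)) P :=
  (hW.hasGaussianLaw_pi e).iIndepFun_of_covariance_eq_zero fun i j hij ↦ by
    rw [hW.covariance_eq, he.inner_eq_zero hij]

theorem indepFun_of_orthogonal (hW : IsIsonormal W) {ι κ : Type*} [Fintype ι] [Fintype κ]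
    {h : ι → H} {k : κ → H} (hk : ∀ i j, ⟪h i, k j⟫ = 0) :
    IndepFun (fun ω i ↦ W (h i) ω) (fun ω j ↦ W (k j) ω) P :=
  (hW.hasGaussianLaw_pi_prod h k).indepFun_of_covariance_eval fun i j ↦ by
    rw [hW.covariance_eq, hk]

/-! ### Centred products -/

/-- The centred product `W h * W k - ⟪h, k⟫`, as an element of `L²(P)`. -/
noncomputable def wick (hW : IsIsonormal W) (h k : H) : Lp ℝ 2 P :=
  have := (hW.hasGaussianLaw h).isProbabilityMeasure
  ((hW.memLp_mul h k (p := 2) (by simp)).sub (memLp_const ⟪h, k⟫)).toLp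

theorem coe_wick (hW : IsIsonormal W) (h k : H) :
    hW.wick h k =ᵐ[P] fun ω ↦ W h ω * W k ω - ⟪h, k⟫ :=
  have := (hW.hasGaussianLaw h).isProbabilityMeasure
  MemLp.coeFn_toLp ((hW.memLp_mul h k (p := 2) (by simp)).sub (memLp_const ⟪h, k⟫))

theorem wick_comm (hW : IsIsonormal W) (h k : H) : hW.wick h k = hW.wick k h := by
  apply Lp.ext
  filter_upwards [hW.coe_wick h k, hW.coe_wick k h] with ω h1 h2
  rw [h1, h2, real_inner_comm, mul_comm]

theorem wick_add_left (hW : IsIsonormal W) (h h' k : H) :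
    hW.wick (h + h') k = hW.wick h k + hW.wick h' k := by
  apply Lp.ext
  have h4 := Lp.coeFn_add (W h) (W h')
  rw [← map_add] at h4
  filter_upwards [hW.coe_wick h k, hW.coe_wick h' k, hW.coe_wick (h + h') k, h4,
    Lp.coeFn_add (hW.wick h k) (hW.wick h' k)] with ω h1 h2 h3 h4 h5
  rw [h5, Pi.add_apply, h1, h2, h3, h4, Pi.add_apply, inner_add_left]
  ring

theorem wick_smul_left (hW : IsIsonormal W) (c : ℝ) (h k : H) :
    hW.wick (c • h) k = c • hW.wick h k := by
  apply Lp.ext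
  have h4 := Lp.coeFn_smul c (W h)
  rw [← map_smul] at h4
  filter_upwards [hW.coe_wick h k, hW.coe_wick (c • h) k, h4,
    Lp.coeFn_smul c (hW.wick h k)] with ω h1 h2 h3 h4
  rw [h4, Pi.smul_apply, h1, h2, h3, Pi.smul_apply, real_inner_smul_left]
  simp only [smul_eq_mul]
  ring

/-- The centred product as a bilinear map. -/
noncomputable def wickₗ (hW : IsIsonormal W) : H →ₗ[ℝ] H →ₗ[ℝ] Lp ℝ 2 P :=
  LinearMap.mk₂ ℝ hW.wick hW.wick_add_left hW.wick_smul_left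
    (fun h k k' ↦ by rw [hW.wick_comm, hW.wick_add_left, hW.wick_comm k, hW.wick_comm k'])
    (fun c h k ↦ by rw [hW.wick_comm, hW.wick_smul_left, hW.wick_comm k])

theorem wickₗ_apply (hW : IsIsonormal W) (h k : H) : hW.wickₗ h k = hW.wick h k := rfl

/-- Of the three pairings in Isserlis' formula, centring removes the one that pairs within each
product. -/
theorem inner_wick_wick (hW : IsIsonormal W) (a b c d : H) :
    ⟪hW.wick a b, hW.wick c d⟫ = ⟪a, c⟫ * ⟪b, d⟫ + ⟪a, d⟫ * ⟪b, c⟫ := by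
  have := (hW.hasGaussianLaw a).isProbabilityMeasure
  rw [L2.inner_def]
  have e : (fun ω ↦ ⟪hW.wick a b ω, hW.wick c d ω⟫) =ᵐ[P] fun ω ↦
      (W a ω * W b ω) * (W c ω * W d ω) - ⟪c, d⟫ * (W a ω * W b ω)
        - (⟪a, b⟫ * (W c ω * W d ω) - ⟪a, b⟫ * ⟪c, d⟫) := by
    filter_upwards [hW.coe_wick a b, hW.coe_wick c d] with ω h1 h2
    rw [h1, h2]
    simp only [RCLike.inner_apply, conj_trivial]
    ring
  have i1 : ∀ h k : H, Integrable (fun ω ↦ W h ω * W k ω) P := fun h k ↦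
    (hW.memLp_mul h k (p := 1) (by simp)).integrable le_rfl
  have i2 : Integrable (fun ω ↦ (W a ω * W b ω) * (W c ω * W d ω)) P :=
    (hW.memLp_mul a b (p := 2) (by simp)).integrable_mul (hW.memLp_mul c d (p := 2) (by simp))
  have i3 : ∀ (x : ℝ) (h k : H), Integrable (fun ω ↦ x * (W h ω * W k ω)) P :=
    fun x h k ↦ (i1 h k).const_mul x
  have i4 : Integrable (fun ω ↦ (W a ω * W b ω) * (W c ω * W d ω) - ⟪c, d⟫ * (W a ω * W b ω)) P :=
    i2.sub (i3 _ _ _)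
  have i5 : Integrable (fun ω ↦ ⟪a, b⟫ * (W c ω * W d ω) - ⟪a, b⟫ * ⟪c, d⟫) P :=
    (i3 _ _ _).sub (integrable_const _)
  rw [integral_congr_ae e, integral_sub i4 i5, integral_sub i2 (i3 _ _ _),
    integral_sub (i3 _ _ _) (integrable_const _), integral_const_mul, integral_const_mul,
    integral_mul, integral_mul, hW.integral_mul_mul_mul]
  simp
  ring

theorem integral_wick (hW : IsIsonormal W) (h k : H) : ∫ ω, hW.wick h k ω ∂P = 0 := by
  have := (hW.hasGaussianLaw h).isProbabilityMeasure
  rw [integral_congr_ae (hW.coe_wick h k), integral_sub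
    ((hW.memLp_mul h k (p := 1) (by simp)).integrable le_rfl) (integrable_const _), integral_mul]
  simp

/-- Linear combinations of centred products. -/
noncomputable def wickSum (hW : IsIsonormal W) : (H × H →₀ ℝ) →ₗ[ℝ] Lp ℝ 2 P :=
  Finsupp.linearCombination ℝ fun p ↦ hW.wick p.1 p.2

theorem wickSum_single (hW : IsIsonormal W) (h k : H) :
    hW.wickSum (Finsupp.single (h, k) 1) = hW.wick h k := by
  simp [wickSum]

end IsIsonormal

/-! ### The second chaos as a bounded image of a tensor square. -/

theorem inner_linearCombination {ι E : Type*} [NormedAddCommGroup E] [InnerProductSpace ℝ E]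
    (u v : ι → E) (c d : ι →₀ ℝ) :
    ⟪Finsupp.linearCombination ℝ u c, Finsupp.linearCombination ℝ v d⟫ =
      c.sum fun i a ↦ d.sum fun j b ↦ a * b * ⟪u i, v j⟫ := by
  simp only [Finsupp.linearCombination_apply, Finsupp.sum, sum_inner, inner_sum,
    real_inner_smul_left, real_inner_smul_right]
  rw [Finset.sum_comm]
  exact Finset.sum_congr rfl fun i _ ↦ Finset.sum_congr rfl fun j _ ↦ by ring

/-- A pairing `H × H → H₂` with the inner products of an elementary tensor product and dense span. -/
structure IsTensor {H₂ : Type*} [NormedAddCommGroup H₂] [InnerProductSpace ℝ H₂]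
    (T : H → H → H₂) : Prop where
  inner_eq : ∀ a b c d, ⟪T a b, T c d⟫ = ⟪a, c⟫ * ⟪b, d⟫
  dense : DenseRange (Finsupp.linearCombination ℝ fun p : H × H ↦ T p.1 p.2)

namespace IsIsonormal

variable {W : H →ₗᵢ[ℝ] Lp ℝ 2 P}
variable {H₂ : Type*} [NormedAddCommGroup H₂] [InnerProductSpace ℝ H₂] {T : H → H → H₂}

/-- The squared norm on the left is ‖x‖² + ⟪x, y⟫, where `y` is the transpose of the tensor `x`.
Transposition preserves the norm, so √2 would do as a constant; 2 is enough to extend the map by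
density. -/
theorem norm_wickSum_le (hW : IsIsonormal W) (hT : IsTensor T) (c : H × H →₀ ℝ) :
    ‖hW.wickSum c‖ ≤ 2 * ‖Finsupp.linearCombination ℝ (fun p : H × H ↦ T p.1 p.2) c‖ := by
  set x := Finsupp.linearCombination ℝ (fun p : H × H ↦ T p.1 p.2) c with hx
  set y := Finsupp.linearCombination ℝ (fun p : H × H ↦ T p.2 p.1) c with hy
  have h1 : ‖hW.wickSum c‖ ^ 2 = ⟪x, x⟫ + ⟪x, y⟫ := by
    rw [← real_inner_self_eq_norm_sq, wickSum, hx, hy, inner_linearCombination,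
      inner_linearCombination, inner_linearCombination]
    simp only [Finsupp.sum, ← Finset.sum_add_distrib]
    refine Finset.sum_congr rfl fun p _ ↦ Finset.sum_congr rfl fun q _ ↦ ?_
    rw [hW.inner_wick_wick, hT.inner_eq, hT.inner_eq]
    ring
  have h2 : ‖y‖ = ‖x‖ := by
    have : ‖y‖ ^ 2 = ‖x‖ ^ 2 := by
      rw [← real_inner_self_eq_norm_sq, ← real_inner_self_eq_norm_sq, hx, hy,
        inner_linearCombination, inner_linearCombination]
      simp only [hT.inner_eq, mul_comm]
    exact (sq_eq_sq₀ (norm_nonneg _) (norm_nonneg _)).1 this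
  have h3 := real_inner_le_norm x y
  rw [h2] at h3
  rw [real_inner_self_eq_norm_sq] at h1
  nlinarith [norm_nonneg (hW.wickSum c), norm_nonneg x]

/-- The continuous linear map which sends a tensor `T h k` to `W h * W k - ⟪h, k⟫`. -/
noncomputable def chaos (hW : IsIsonormal W) (T : H → H → H₂) : H₂ →L[ℝ] Lp ℝ 2 P :=
  hW.wickSum.extendOfNorm (Finsupp.linearCombination ℝ fun p : H × H ↦ T p.1 p.2)

theorem chaos_linearCombination (hW : IsIsonormal W) (hT : IsTensor T) (c : H × H →₀ ℝ) :
    hW.chaos T (Finsupp.linearCombination ℝ (fun p : H × H ↦ T p.1 p.2) c) = hW.wickSum c :=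
  LinearMap.extendOfNorm_eq hT.dense ⟨2, hW.norm_wickSum_le hT⟩ c

theorem chaos_apply (hW : IsIsonormal W) (hT : IsTensor T) (h k : H) :
    hW.chaos T (T h k) = hW.wick h k := by
  rw [← hW.wickSum_single, ← hW.chaos_linearCombination hT]
  simp

theorem norm_chaos_le (hW : IsIsonormal W) (hT : IsTensor T) (x : H₂) :
    ‖hW.chaos T x‖ ≤ 2 * ‖x‖ :=
  LinearMap.norm_extendOfNorm_apply_le hT.dense 2 (hW.norm_wickSum_le hT) x

/-- Exponential moments are estimated for finite sums of centred products and then carried to this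
closure. -/
theorem chaos_mem_closure (hW : IsIsonormal W) (hT : IsTensor T) (x : H₂) :
    hW.chaos T x ∈ closure (range hW.wickSum) := by
  refine hT.dense.induction_on (p := fun x ↦ hW.chaos T x ∈ closure (range hW.wickSum)) x ?_ ?_
  · exact isClosed_closure.preimage (hW.chaos T).continuous
  · intro c
    rw [hW.chaos_linearCombination hT]
    exact subset_closure ⟨c, rfl⟩

end IsIsonormal

end BaiTaqqu

namespace BaiTaqqu

/-! ### Exponential moments in the second chaos -/

/-- No condition on `x` is needed: if 1 - 2x ≤ 0, both sides are 0 by the conventions for divergent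
integrals, division by 0 and square roots. -/
theorem integral_exp_mul_sq_sub_one_gaussianReal (x : ℝ) :
    ∫ y, Real.exp (x * (y ^ 2 - 1)) ∂(gaussianReal 0 1) = Real.exp (-x) * √(1 / (1 - 2 * x)) := by
  rw [integral_gaussianReal_eq_integral_smul one_ne_zero]
  have : ∀ y : ℝ, gaussianPDFReal 0 1 y • Real.exp (x * (y ^ 2 - 1)) =
      ((√(2 * Real.pi))⁻¹ * Real.exp (-x)) * Real.exp (-(1 / 2 - x) * y ^ 2) := by
    intro y
    rw [gaussianPDFReal, smul_eq_mul, NNReal.coe_one, mul_one, mul_assoc, mul_assoc, ← Real.exp_add,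
      ← Real.exp_add]
    congr 2
    ring
  simp_rw [this]
  rw [integral_const_mul, integral_gaussian]
  have e : Real.pi / (1 / 2 - x) = (2 * Real.pi) * (1 / (1 - 2 * x)) := by
    by_cases h : 1 - 2 * x = 0
    · rw [h, show 1 / 2 - x = 0 by linarith]; simp
    · have : 1 / 2 - x ≠ 0 := fun h' ↦ h (by linarith)
      field_simp
  rw [e, Real.sqrt_mul (x := 2 * Real.pi) (by positivity) (1 / (1 - 2 * x))]
  have := mul_inv_cancel₀ (show √(2 * Real.pi) ≠ 0 by positivity)
  linear_combination (Real.exp (-x) * √(1 / (1 - 2 * x))) * this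

theorem exp_neg_mul_sqrt_le {x : ℝ} (hx : |x| ≤ 1 / 4) :
    Real.exp (-x) * √(1 / (1 - 2 * x)) ≤ Real.exp (4 * x ^ 2) := by
  obtain ⟨h1, h2⟩ := abs_le.1 hx
  have h3 : 0 < 1 - 2 * x := by linarith
  have h4 : -(2 * x + 8 * x ^ 2) ≤ Real.log (1 - 2 * x) := by
    refine le_trans ?_ (Real.one_sub_inv_le_log_of_pos h3)
    -- After clearing the denominator this is 4x²(1 - 4x) ≥ 0.
    have : (1 - 2 * x)⁻¹ ≤ 1 + 2 * x + 8 * x ^ 2 := by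
      rw [inv_le_iff_one_le_mul₀ h3]
      nlinarith [mul_nonneg (sq_nonneg x) (by linarith : (0 : ℝ) ≤ 1 - 4 * x)]
    linarith
  have h5 : √(1 / (1 - 2 * x)) ≤ Real.exp (x + 4 * x ^ 2) := by
    refine Real.sqrt_le_iff.2 ⟨(Real.exp_pos _).le, ?_⟩
    rw [← Real.exp_nat_mul, one_div, ← Real.exp_log h3, ← Real.exp_neg]
    refine Real.exp_le_exp.2 ?_
    push_cast
    linarith
  calc _ ≤ Real.exp (-x) * Real.exp (x + 4 * x ^ 2) := by gcongr
    _ = _ := by rw [← Real.exp_add]; congr 1; ring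

variable {Ω : Type*} [MeasurableSpace Ω] {P : Measure Ω}
  {H : Type*} [NormedAddCommGroup H] [InnerProductSpace ℝ H]

namespace IsIsonormal

variable {W : H →ₗᵢ[ℝ] Lp ℝ 2 P}

theorem mgf_sq_sub_one (hW : IsIsonormal W) {e : H} (he : ‖e‖ = 1) (a t : ℝ) :
    mgf (fun ω ↦ a * (W e ω ^ 2 - 1)) P t =
      Real.exp (-(t * a)) * √(1 / (1 - 2 * (t * a))) := by
  rw [← integral_exp_mul_sq_sub_one_gaussianReal, mgf]
  have := hW.integral_comp e (f := fun y ↦ Real.exp (t * a * (y ^ 2 - 1))) (by fun_prop)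
  rw [show ‖e‖₊ = 1 from NNReal.eq (by simpa using he), one_pow] at this
  rw [← this]
  simp only [mul_assoc]

/-- The summands are independent, so the exponential moment is an explicit product. Since ‖X‖² = 2 ∑
aᵢ², it is at most exp(2 t² ‖X‖²), whatever the number of summands. -/
theorem lintegral_exp_le_of_orthonormal (hW : IsIsonormal W) {n : ℕ} {e : Fin n → H}
    (he : Orthonormal ℝ e) (a : Fin n → ℝ) {X : Lp ℝ 2 P}
    (hX : X = ∑ i, a i • hW.wick (e i) (e i)) {t : ℝ} (ht : |t| * ‖X‖ ≤ 1 / 4) :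
    ∫⁻ ω, ENNReal.ofReal (Real.exp (t * X ω)) ∂P ≤ 2 := by
  have hprob := (hW.hasGaussianLaw 0).isProbabilityMeasure
  have hnorm : ‖X‖ ^ 2 = 2 * ∑ i, a i ^ 2 := by
    rw [← real_inner_self_eq_norm_sq, hX]
    simp only [sum_inner, inner_sum, real_inner_smul_left, real_inner_smul_right,
      hW.inner_wick_wick, orthonormal_iff_ite.1 he]
    rw [Finset.mul_sum]
    refine Finset.sum_congr rfl fun i _ ↦ ?_
    rw [Finset.sum_eq_single i (by intro j _ hj; simp [hj]) (by simp)]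
    simp
    ring
  have hle : ∀ i, |t * a i| ≤ 1 / 4 := by
    intro i
    rw [abs_mul]
    refine le_trans (mul_le_mul_of_nonneg_left ?_ (abs_nonneg t)) ht
    refine abs_le_of_sq_le_sq (le_trans ?_ hnorm.ge) (norm_nonneg _)
    have : a i ^ 2 ≤ ∑ i, a i ^ 2 :=
      Finset.single_le_sum (fun i _ ↦ sq_nonneg (a i)) (Finset.mem_univ i)
    have h0 := sq_nonneg (a i)
    linarith
  have hXae : X =ᵐ[P] ∑ i, fun ω ↦ a i * (W (e i) ω ^ 2 - 1) := by
    have h1 : ∀ s : Finset (Fin n), ((∑ i ∈ s, a i • hW.wick (e i) (e i) : Lp ℝ 2 P) : Ω → ℝ) =ᵐ[P]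
        ∑ i ∈ s, fun ω ↦ a i * (W (e i) ω ^ 2 - 1) := by
      intro s
      induction s using Finset.induction_on with
      | empty => simpa using Lp.coeFn_zero ℝ 2 P
      | insert i s hi ih =>
        rw [Finset.sum_insert hi, Finset.sum_insert hi]
        filter_upwards [Lp.coeFn_add (a i • hW.wick (e i) (e i))
          (∑ i ∈ s, a i • hW.wick (e i) (e i)), ih, Lp.coeFn_smul (a i) (hW.wick (e i) (e i)),
          hW.coe_wick (e i) (e i)] with ω g1 g2 g3 g4
        rw [g1, Pi.add_apply, Pi.add_apply, g2, g3, Pi.smul_apply, g4,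
          real_inner_self_eq_norm_sq, he.norm_eq_one, smul_eq_mul]
        ring
    rw [hX]
    exact h1 _
  have hind : iIndepFun (fun i ω ↦ a i * (W (e i) ω ^ 2 - 1)) P :=
    (hW.iIndepFun_of_orthonormal he).comp (fun i x ↦ a i * (x ^ 2 - 1)) (by fun_prop)
  have hmgf := hind.mgf_sum₀ (t := t) (fun i ↦ by
    have := aemeasurable W (e i)
    fun_prop) Finset.univ
  rw [← mgf_congr hXae] at hmgf
  simp only [hW.mgf_sq_sub_one (he.norm_eq_one _)] at hmgf
  have hpos : 0 < mgf X P t := by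
    rw [hmgf]
    refine Finset.prod_pos fun i _ ↦ mul_pos (Real.exp_pos _) (Real.sqrt_pos.2 ?_)
    have := abs_le.1 (hle i)
    exact one_div_pos.2 (by linarith)
  -- The integral of a non-integrable function is 0, so the positive value of the product formula
  -- forces integrability.
  have hint : Integrable (fun ω ↦ Real.exp (t * X ω)) P := by
    by_contra h
    exact hpos.ne' (integral_undef h)
  have hbd : mgf X P t ≤ 2 := by
    calc mgf X P t ≤ ∏ i, Real.exp (4 * (t * a i) ^ 2) := by
          rw [hmgf]
          exact Finset.prod_le_prod (fun i _ ↦ by positivity) fun i _ ↦ exp_neg_mul_sqrt_le (hle i)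
      _ = Real.exp (2 * (|t| * ‖X‖) ^ 2) := by
          rw [← Real.exp_sum, mul_pow, hnorm, sq_abs]
          congr 1
          simp only [mul_pow, Finset.mul_sum]
          exact Finset.sum_congr rfl fun i _ ↦ by ring
      _ ≤ Real.exp (1 / 8) := by
          refine Real.exp_le_exp.2 ?_
          have : 0 ≤ |t| * ‖X‖ := by positivity
          nlinarith
      _ ≤ 2 := by
          have := Real.exp_bound_div_one_sub_of_interval (x := 1 / 8) (by norm_num) (by norm_num)
          linarith
  rw [← ofReal_integral_eq_lintegral_ofReal hint (ae_of_all _ fun _ ↦ (Real.exp_pos _).le)]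
  exact ENNReal.ofReal_le_of_le_toReal (by simpa [mgf] using hbd)

/-- All vectors involved lie in a finite-dimensional space, where the spectral theorem diagonalizes
the quadratic form. -/
theorem wickSum_eq_sum_eigenvalues (hW : IsIsonormal W) (c : H × H →₀ ℝ) :
    ∃ (n : ℕ) (e : Fin n → H) (a : Fin n → ℝ), Orthonormal ℝ e ∧
      hW.wickSum c = ∑ i, a i • hW.wick (e i) (e i) := by
  classical
  let V : Submodule ℝ H :=
    Submodule.span ℝ (c.support.image Prod.fst ∪ c.support.image Prod.snd : Finset H)
  have hV1 : ∀ p ∈ c.support, p.1 ∈ V := fun p hp ↦ Submodule.subset_span (by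
    simp only [Finset.coe_union, Finset.coe_image]
    exact Or.inl ⟨p, hp, rfl⟩)
  have hV2 : ∀ p ∈ c.support, p.2 ∈ V := fun p hp ↦ Submodule.subset_span (by
    simp only [Finset.coe_union, Finset.coe_image]
    exact Or.inr ⟨p, hp, rfl⟩)
  -- The operator of the symmetrized tensor. Symmetrizing loses nothing because `wick` is symmetric.
  let S : V →ₗ[ℝ] V := ∑ p ∈ c.support, (c p / 2) •
    ((innerₛₗ ℝ (V.orthogonalProjectionOnto p.1)).smulRight (V.orthogonalProjectionOnto p.2) +
      (innerₛₗ ℝ (V.orthogonalProjectionOnto p.2)).smulRight (V.orthogonalProjectionOnto p.1))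
  have hS : ∀ v w : V, ⟪S v, w⟫ = ∑ p ∈ c.support, c p / 2 *
      (⟪p.1, (v : H)⟫ * ⟪p.2, (w : H)⟫ + ⟪p.2, (v : H)⟫ * ⟪p.1, (w : H)⟫) := by
    intro v w
    simp only [S, LinearMap.sum_apply, LinearMap.smul_apply, LinearMap.add_apply,
      LinearMap.smulRight_apply, innerₛₗ_apply_apply, sum_inner, real_inner_smul_left, inner_add_left]
    refine Finset.sum_congr rfl fun p _ ↦ ?_
    simp only [Submodule.inner_orthogonalProjectionOnto_eq_of_mem_right]
  have hsymm : S.IsSymmetric := by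
    intro v w
    rw [real_inner_comm (S w) v, hS, hS]
    exact Finset.sum_congr rfl fun p _ ↦ by ring
  obtain ⟨n, hn⟩ : ∃ n, Module.finrank ℝ V = n := ⟨_, rfl⟩
  let b := hsymm.eigenvectorBasis hn
  let e : Fin n → H := fun i ↦ (b i : H)
  have hexp : ∀ h ∈ V, h = ∑ i, ⟪e i, h⟫ • e i := by
    intro h hh
    have := b.sum_repr' ⟨h, hh⟩
    have := congrArg (fun v : V ↦ (v : H)) this
    simp only [Submodule.coe_sum, Submodule.coe_smul, Submodule.coe_inner] at this
    exact this.symm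
  have horth : Orthonormal ℝ e := b.orthonormal.comp_linearIsometry V.subtypeₗᵢ
  have hdiag : ∀ i j, ∑ p ∈ c.support, c p / 2 *
      (⟪e i, p.1⟫ * ⟪e j, p.2⟫ + ⟪e j, p.1⟫ * ⟪e i, p.2⟫) =
      if i = j then hsymm.eigenvalues hn i else 0 := by
    intro i j
    have := hS (b i) (b j)
    rw [hsymm.apply_eigenvectorBasis, real_inner_smul_left,
      orthonormal_iff_ite.1 b.orthonormal] at this
    simp only [RCLike.ofReal_real_eq_id, id, mul_ite, mul_one, mul_zero] at this
    rw [this]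
    refine Finset.sum_congr rfl fun p _ ↦ ?_
    rw [real_inner_comm (e i) p.1, real_inner_comm (e j) p.1, real_inner_comm (e i) p.2,
      real_inner_comm (e j) p.2]
    simp only [e]
    ring
  refine ⟨n, e, hsymm.eigenvalues hn, horth, ?_⟩
  have h1 : hW.wickSum c = ∑ i, ∑ j, (∑ p ∈ c.support, c p * (⟪e i, p.1⟫ * ⟪e j, p.2⟫)) •
      hW.wick (e i) (e j) := by
    rw [wickSum, Finsupp.linearCombination_apply, Finsupp.sum]
    have : ∀ p ∈ c.support, c p • hW.wick p.1 p.2 = ∑ i, ∑ j, (c p * (⟪e i, p.1⟫ * ⟪e j, p.2⟫)) •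
        hW.wick (e i) (e j) := by
      intro p hp
      rw [← wickₗ_apply]
      conv_lhs => rw [hexp _ (hV1 p hp), hexp _ (hV2 p hp)]
      simp only [map_sum, map_smul, LinearMap.sum_apply, LinearMap.smul_apply, Finset.smul_sum,
        wickₗ_apply, smul_smul]
      rw [Finset.sum_comm]
      exact Finset.sum_congr rfl fun i _ ↦ Finset.sum_congr rfl fun j _ ↦ by
        rw [mul_comm ⟪e j, p.2⟫]
    rw [Finset.sum_congr rfl this, Finset.sum_comm]
    refine Finset.sum_congr rfl fun i _ ↦ ?_
    rw [Finset.sum_comm]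
    exact Finset.sum_congr rfl fun j _ ↦ by rw [Finset.sum_smul]
  have h2 : hW.wickSum c = ∑ i, ∑ j, (∑ p ∈ c.support, c p * (⟪e j, p.1⟫ * ⟪e i, p.2⟫)) •
      hW.wick (e i) (e j) := by
    rw [h1, Finset.sum_comm]
    refine Finset.sum_congr rfl fun i _ ↦ Finset.sum_congr rfl fun j _ ↦ ?_
    rw [hW.wick_comm]
  -- Averaging `h1` and `h2` produces the symmetrized coefficients, which `hdiag` evaluates.
  have h3 : hW.wickSum c = (1 / 2 : ℝ) • (hW.wickSum c + hW.wickSum c) := by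
    rw [← two_smul ℝ, smul_smul]; norm_num
  rw [h3]
  nth_rw 1 [h1]
  rw [h2, ← Finset.sum_add_distrib, Finset.smul_sum]
  refine Finset.sum_congr rfl fun i _ ↦ ?_
  rw [← Finset.sum_add_distrib, Finset.smul_sum, Finset.sum_eq_single i]
  · rw [← add_smul, smul_smul, ← Finset.sum_add_distrib, Finset.mul_sum]
    congr 1
    have := hdiag i i
    rw [if_pos rfl] at this
    rw [← this]
    exact Finset.sum_congr rfl fun p _ ↦ by ring
  · intro j _ hj
    rw [← add_smul, smul_smul, ← Finset.sum_add_distrib, Finset.mul_sum]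
    have := hdiag i j
    rw [if_neg hj.symm] at this
    convert zero_smul ℝ _
    rw [← this]
    exact Finset.sum_congr rfl fun p _ ↦ by ring
  · simp

theorem lintegral_exp_wickSum_le (hW : IsIsonormal W) (c : H × H →₀ ℝ) {t : ℝ}
    (ht : |t| * ‖hW.wickSum c‖ ≤ 1 / 4) :
    ∫⁻ ω, ENNReal.ofReal (Real.exp (t * hW.wickSum c ω)) ∂P ≤ 2 := by
  obtain ⟨n, e, a, he, h⟩ := hW.wickSum_eq_sum_eigenvalues c
  exact hW.lintegral_exp_le_of_orthonormal he a h ht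

/-- Fatou's lemma along an a.e. convergent subsequence. The threshold 1/8 leaves room for the
approximants to meet the threshold 1/4. -/
theorem lintegral_exp_le (hW : IsIsonormal W) {X : Lp ℝ 2 P} (hX : X ∈ closure (range hW.wickSum))
    {t : ℝ} (ht : |t| * ‖X‖ ≤ 1 / 8) :
    ∫⁻ ω, ENNReal.ofReal (Real.exp (t * X ω)) ∂P ≤ 2 := by
  obtain ⟨x, hx, hlim⟩ := mem_closure_iff_seq_limit.1 hX
  have hev : ∀ᶠ n in atTop, |t| * ‖x n‖ ≤ 1 / 4 :=
    ((hlim.norm.const_mul |t|).eventually_lt_const (by linarith : |t| * ‖X‖ < 1 / 4)).mono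
      fun _ h ↦ h.le
  obtain ⟨φ, hφ, hae⟩ := (tendstoInMeasure_of_tendsto_Lp hlim).exists_seq_tendsto_ae
  have hφ' := hφ.tendsto_atTop.eventually hev
  calc ∫⁻ ω, ENNReal.ofReal (Real.exp (t * X ω)) ∂P
      = ∫⁻ ω, liminf (fun n ↦ ENNReal.ofReal (Real.exp (t * x (φ n) ω))) atTop ∂P := by
        refine lintegral_congr_ae ?_
        filter_upwards [hae] with ω hω
        refine (Tendsto.liminf_eq ?_).symm
        exact ENNReal.tendsto_ofReal ((Real.continuous_exp.tendsto _).comp (hω.const_mul t))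
    _ ≤ liminf (fun n ↦ ∫⁻ ω, ENNReal.ofReal (Real.exp (t * x (φ n) ω)) ∂P) atTop :=
        lintegral_liminf_le' fun n ↦ by
          have := (Lp.aestronglyMeasurable (x (φ n))).aemeasurable
          fun_prop
    _ ≤ 2 := by
        refine liminf_le_of_frequently_le' (hφ'.mono fun n hn ↦ ?_).frequently
        obtain ⟨c, hc⟩ := hx (φ n)
        rw [← hc] at hn ⊢
        exact hW.lintegral_exp_wickSum_le c hn

theorem integrable_exp_mul (hW : IsIsonormal W) {X : Lp ℝ 2 P}
    (hX : X ∈ closure (range hW.wickSum)) {t : ℝ} (ht : |t| * ‖X‖ ≤ 1 / 8) :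
    Integrable (fun ω ↦ Real.exp (t * X ω)) P := by
  have := (Lp.aestronglyMeasurable X).aemeasurable
  refine ⟨(by fun_prop : AEMeasurable _ P).aestronglyMeasurable, ?_⟩
  rw [hasFiniteIntegral_iff_ofReal (ae_of_all _ fun _ ↦ (Real.exp_pos _).le)]
  exact (hW.lintegral_exp_le hX ht).trans_lt (by simp)

theorem integral_exp_mul_le (hW : IsIsonormal W) {X : Lp ℝ 2 P}
    (hX : X ∈ closure (range hW.wickSum)) {t : ℝ} (ht : |t| * ‖X‖ ≤ 1 / 8) :
    ∫ ω, Real.exp (t * X ω) ∂P ≤ 2 := by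
  have h := hW.lintegral_exp_le hX ht
  rw [← ofReal_integral_eq_lintegral_ofReal (hW.integrable_exp_mul hX ht)
    (ae_of_all _ fun _ ↦ (Real.exp_pos _).le)] at h
  exact (ENNReal.ofReal_le_ofReal_iff (by norm_num)).1 (by simpa using h)

theorem zero_mem_interior_integrableExpSet (hW : IsIsonormal W) {X : Lp ℝ 2 P}
    (hX : X ∈ closure (range hW.wickSum)) : 0 ∈ interior (integrableExpSet X P) := by
  rw [mem_interior_iff_mem_nhds]
  have : Tendsto (fun t : ℝ ↦ |t| * ‖X‖) (𝓝 0) (𝓝 0) := by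
    have : Continuous fun t : ℝ ↦ |t| * ‖X‖ := by fun_prop
    simpa using this.tendsto 0
  filter_upwards [this.eventually_lt_const (by norm_num : (0 : ℝ) < 1 / 8)] with t ht
  exact hW.integrable_exp_mul hX ht.le

theorem integrable_abs_pow (hW : IsIsonormal W) {X : Lp ℝ 2 P}
    (hX : X ∈ closure (range hW.wickSum)) (n : ℕ) : Integrable (fun ω ↦ |X ω| ^ n) P :=
  integrable_pow_abs_of_mem_interior_integrableExpSet (hW.zero_mem_interior_integrableExpSet hX) n

/-- Apply uⁿ/n! ≤ eᵘ to u = |X|/(8s), the scale at which exponential moments are at most 2 for each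
sign of the exponent. If s = 0 then X = 0, and this case is treated apart. -/
theorem integral_abs_pow_le (hW : IsIsonormal W) {X : Lp ℝ 2 P}
    (hX : X ∈ closure (range hW.wickSum)) {s : ℝ} (hs : ‖X‖ ≤ s) (n : ℕ) :
    ∫ ω, |X ω| ^ n ∂P ≤ 4 * n.factorial * (8 * s) ^ n := by
  rcases eq_or_lt_of_le ((norm_nonneg X).trans hs) with h0 | h0
  · have hX0 : X = 0 := norm_le_zero_iff.1 (h0 ▸ hs)
    have hprob := (hW.hasGaussianLaw 0).isProbabilityMeasure
    rw [← h0, hX0]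
    rw [integral_congr_ae (g := fun _ ↦ |(0 : ℝ)| ^ n)
      (by filter_upwards [Lp.coeFn_zero ℝ 2 P] with ω hω; rw [hω, Pi.zero_apply])]
    rcases Nat.eq_zero_or_pos n with rfl | hn
    · simp
    · simp [hn.ne']
  · have ht : |1 / (8 * s)| * ‖X‖ ≤ 1 / 8 := by
      rw [abs_of_pos (by positivity), div_mul_eq_mul_div, div_le_div_iff₀ (by positivity) (by norm_num)]
      linarith
    have ht' : |-(1 / (8 * s))| * ‖X‖ ≤ 1 / 8 := by rwa [abs_neg]
    have hpt : ∀ x : ℝ, |x| ^ n ≤ n.factorial * (8 * s) ^ n *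
        (Real.exp (1 / (8 * s) * x) + Real.exp (-(1 / (8 * s)) * x)) := by
      intro x
      have h1 := Real.pow_div_factorial_le_exp (|x| / (8 * s)) (by positivity) n
      have h2 : Real.exp (|x| / (8 * s)) ≤
          Real.exp (1 / (8 * s) * x) + Real.exp (-(1 / (8 * s)) * x) := by
        rcases abs_cases x with ⟨h, -⟩ | ⟨h, -⟩
        · rw [h, show x / (8 * s) = 1 / (8 * s) * x by ring]
          linarith [Real.exp_pos (-(1 / (8 * s)) * x)]
        · rw [h, show -x / (8 * s) = -(1 / (8 * s)) * x by ring]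
          linarith [Real.exp_pos (1 / (8 * s) * x)]
      rw [div_pow, div_div, div_le_iff₀ (by positivity)] at h1
      calc |x| ^ n ≤ _ := h1
        _ ≤ (Real.exp (1 / (8 * s) * x) + Real.exp (-(1 / (8 * s)) * x)) *
            ((8 * s) ^ n * n.factorial) := by gcongr
        _ = _ := by ring
    have i1 := hW.integrable_exp_mul hX ht
    have i2 := hW.integrable_exp_mul hX ht'
    calc ∫ ω, |X ω| ^ n ∂P ≤ ∫ ω, n.factorial * (8 * s) ^ n *
          (Real.exp (1 / (8 * s) * X ω) + Real.exp (-(1 / (8 * s)) * X ω)) ∂P :=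
          integral_mono (hW.integrable_abs_pow hX n) ((i1.add i2).const_mul _) fun ω ↦ hpt _
      _ = n.factorial * (8 * s) ^ n * (∫ ω, Real.exp (1 / (8 * s) * X ω) ∂P +
          ∫ ω, Real.exp (-(1 / (8 * s)) * X ω) ∂P) := by
          rw [integral_const_mul, integral_add i1 i2]
      _ ≤ n.factorial * (8 * s) ^ n * (2 + 2) := by
          gcongr
          · exact hW.integral_exp_mul_le hX ht
          · exact hW.integral_exp_mul_le hX ht'
      _ = _ := by ring

end IsIsonormal

end BaiTaqqu

namespace BaiTaqqu

/-! ### Cumulants and moments -/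

/-- Differentiate `mgf' = cgf' * mgf` n times by Leibniz at 0 and isolate the top term, whose moment
factor is 1. -/
theorem iteratedDeriv_succ_cgf_zero {Ω : Type*} [MeasurableSpace Ω] {P : Measure Ω}
    [IsProbabilityMeasure P] {X : Ω → ℝ} (hX : 0 ∈ interior (integrableExpSet X P)) (n : ℕ) :
    iteratedDeriv (n + 1) (cgf X P) 0 = ∫ ω, X ω ^ (n + 1) ∂P -
      ∑ k ∈ Finset.range n, n.choose k * iteratedDeriv (k + 1) (cgf X P) 0 *
        ∫ ω, X ω ^ (n - k) ∂P := by
  have hmom : ∀ k, iteratedDeriv k (mgf X P) 0 = ∫ ω, X ω ^ k ∂P := fun k ↦ by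
    rw [iteratedDeriv_mgf_zero hX]
    rfl
  have hev : deriv (mgf X P) =ᶠ[𝓝 0] deriv (cgf X P) * mgf X P := by
    filter_upwards [isOpen_interior.mem_nhds hX] with t ht
    have hpos : mgf X P t ≠ 0 := (mgf_pos (interior_subset (s := integrableExpSet X P) ht)).ne'
    rw [Pi.mul_apply, deriv_cgf ht, deriv_mgf ht, div_mul_cancel₀ _ hpos]
  have h1 : iteratedDeriv (n + 1) (mgf X P) 0 =
      iteratedDeriv n (deriv (cgf X P) * mgf X P) 0 := by
    rw [iteratedDeriv_succ', hev.iteratedDeriv_eq]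
  rw [iteratedDeriv_mul (analyticAt_cgf hX).deriv.contDiffAt (analyticAt_mgf hX).contDiffAt,
    Finset.sum_range_succ, hmom] at h1
  simp only [← iteratedDeriv_succ', hmom, Nat.choose_self, Nat.sub_self, pow_zero] at h1
  simp only [integral_const, probReal_univ, smul_eq_mul, mul_one, Nat.cast_one, one_mul] at h1
  rw [h1]
  ring

/-- Each `K n` is a fixed polynomial in the `μ k`, hence Lipschitz on bounded sets. The size bound
is carried along because differences of products need it. -/
theorem exists_abs_sub_le_of_recursion (M : ℝ) (n : ℕ) : ∃ C : ℝ, 0 ≤ C ∧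
    ∀ (K K' μ μ' : ℕ → ℝ) (ε : ℝ), 0 ≤ ε →
      (∀ n, K n = μ (n + 1) - ∑ k ∈ Finset.range n, n.choose k * K k * μ (n - k)) →
      (∀ n, K' n = μ' (n + 1) - ∑ k ∈ Finset.range n, n.choose k * K' k * μ' (n - k)) →
      (∀ k ≤ n + 1, |μ k| ≤ M) → (∀ k ≤ n + 1, |μ' k| ≤ M) → (∀ k ≤ n + 1, |μ k - μ' k| ≤ ε) →
      ∀ k ≤ n, |K k| ≤ C ∧ |K k - K' k| ≤ C * ε := by
  induction n with
  | zero =>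
    refine ⟨max M 1, by positivity, fun K K' μ μ' ε hε hK hK' h1 h2 h3 k hk ↦ ?_⟩
    obtain rfl : k = 0 := by omega
    rw [hK, hK']
    simp only [Finset.range_zero, Finset.sum_empty, sub_zero, zero_add]
    refine ⟨(h1 1 le_rfl).trans (le_max_left _ _), (h3 1 le_rfl).trans ?_⟩
    exact le_mul_of_one_le_left hε (le_max_right _ _)
  | succ n ih =>
    obtain ⟨C, hC, ih⟩ := ih
    set S : ℝ := ∑ k ∈ Finset.range (n + 1), ((n + 1).choose k : ℝ) with hS
    have hS0 : 0 ≤ S := by positivity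
    refine ⟨max C (max (M + S * (C * |M|)) (1 + S * (C * |M| + C))), le_max_of_le_left hC,
      fun K K' μ μ' ε hε hK hK' h1 h2 h3 k hk ↦ ?_⟩
    have ih' := ih K K' μ μ' ε hε hK hK' (fun k hk ↦ h1 k (by omega)) (fun k hk ↦ h2 k (by omega))
      (fun k hk ↦ h3 k (by omega))
    rcases Nat.lt_or_ge n k with hlt | hle
    · obtain rfl : k = n + 1 := by omega
      have hM := le_abs_self M
      constructor
      · refine le_trans ?_ ((le_max_left _ _).trans (le_max_right _ _))
        rw [hK]
        refine (abs_sub _ _).trans (add_le_add (h1 _ le_rfl) ?_)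
        refine (Finset.abs_sum_le_sum_abs _ _).trans ?_
        rw [hS, Finset.sum_mul]
        refine Finset.sum_le_sum fun i hi ↦ ?_
        have hi' := Finset.mem_range.1 hi
        rw [abs_mul, abs_mul, Nat.abs_cast, mul_assoc]
        exact mul_le_mul_of_nonneg_left (mul_le_mul (ih' i (by omega)).1
          ((h1 _ (by omega)).trans hM) (abs_nonneg _) hC) (Nat.cast_nonneg _)
      · refine le_trans ?_ (mul_le_mul_of_nonneg_right
          ((le_max_right _ _).trans (le_max_right _ _)) hε)
        rw [hK, hK', sub_sub_sub_comm, ← Finset.sum_sub_distrib, add_mul, one_mul]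
        refine (abs_sub _ _).trans (add_le_add (h3 _ le_rfl) ?_)
        refine (Finset.abs_sum_le_sum_abs _ _).trans ?_
        rw [hS, Finset.sum_mul, Finset.sum_mul]
        refine Finset.sum_le_sum fun i hi ↦ ?_
        have hi' := Finset.mem_range.1 hi
        have e : ((n + 1).choose i : ℝ) * K i * μ (n + 1 - i) - (n + 1).choose i * K' i * μ' (n + 1 - i)
            = (n + 1).choose i * ((K i - K' i) * μ' (n + 1 - i) +
              K i * (μ (n + 1 - i) - μ' (n + 1 - i))) := by ring
        rw [e, abs_mul, Nat.abs_cast, mul_assoc]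
        gcongr
        refine (abs_add_le _ _).trans ?_
        rw [abs_mul, abs_mul, add_mul]
        have g1 := (ih' i (by omega)).1
        have g2 := (ih' i (by omega)).2
        have g3 := (h2 (n + 1 - i) (by omega)).trans hM
        have g4 := h3 (n + 1 - i) (by omega)
        refine add_le_add ?_ (mul_le_mul g1 g4 (abs_nonneg _) hC)
        calc |K i - K' i| * |μ' (n + 1 - i)| ≤ (C * ε) * |M| := by gcongr
          _ = _ := by ring
    · exact ⟨(ih' k hle).1.trans (le_max_left _ _),
        (ih' k hle).2.trans (mul_le_mul_of_nonneg_right (le_max_left _ _) hε)⟩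

theorem exists_abs_cumulant_sub_le (M : ℝ) (m : ℕ) : ∃ C : ℝ, 0 ≤ C ∧
    ∀ {Ω : Type*} [MeasurableSpace Ω] {P : Measure Ω} [IsProbabilityMeasure P] {X Y : Ω → ℝ} {ε : ℝ},
      0 ≤ ε → 0 ∈ interior (integrableExpSet X P) → 0 ∈ interior (integrableExpSet Y P) →
      (∀ k ≤ m + 1, |∫ ω, X ω ^ k ∂P| ≤ M) → (∀ k ≤ m + 1, |∫ ω, Y ω ^ k ∂P| ≤ M) →
      (∀ k ≤ m + 1, |∫ ω, X ω ^ k ∂P - ∫ ω, Y ω ^ k ∂P| ≤ ε) →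
      |cumulant (m + 1) X P - cumulant (m + 1) Y P| ≤ C * ε := by
  obtain ⟨C, hC, h⟩ := exists_abs_sub_le_of_recursion M m
  refine ⟨C, hC, fun {Ω} _ {P} _ {X} {Y} {ε} hε hX hY h1 h2 h3 ↦ ?_⟩
  exact (h (fun n ↦ iteratedDeriv (n + 1) (cgf X P) 0) (fun n ↦ iteratedDeriv (n + 1) (cgf Y P) 0)
    (fun k ↦ ∫ ω, X ω ^ k ∂P) (fun k ↦ ∫ ω, Y ω ^ k ∂P) ε hε (iteratedDeriv_succ_cgf_zero hX)
    (iteratedDeriv_succ_cgf_zero hY) h1 h2 h3 m le_rfl).2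

/-! ### Moments of a small perturbation inside the second chaos. -/

theorem abs_add_pow_sub_le (y r : ℝ) (k : ℕ) :
    |(y + r) ^ (k + 2) - y ^ (k + 2) - (k + 2) * y ^ (k + 1) * r| ≤
      (k + 2) ^ 2 * (r ^ 2 * (|y| + |r|) ^ k) := by
  induction k with
  | zero =>
    have : (y + r) ^ (0 + 2) - y ^ (0 + 2) - ((0 : ℕ) + 2) * y ^ (0 + 1) * r = r ^ 2 := by
      push_cast; ring
    rw [this, abs_of_nonneg (sq_nonneg r)]
    norm_num
    nlinarith [sq_nonneg r]
  | succ k ih =>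
    have e : (y + r) ^ (k + 1 + 2) - y ^ (k + 1 + 2) - ((k + 1 : ℕ) + 2) * y ^ (k + 1 + 1) * r =
        (y + r) * ((y + r) ^ (k + 2) - y ^ (k + 2) - (k + 2) * y ^ (k + 1) * r) +
          (k + 2) * (r ^ 2 * y ^ (k + 1)) := by
      push_cast; ring
    rw [e]
    refine (abs_add_le _ _).trans ?_
    rw [abs_mul, abs_mul (k + 2 : ℝ), abs_mul (r ^ 2), abs_of_nonneg (sq_nonneg r), abs_pow,
      abs_of_nonneg (by positivity : (0 : ℝ) ≤ k + 2)]
    have h1 : |y + r| ≤ |y| + |r| := abs_add_le _ _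
    have h2 : |y| ^ (k + 1) ≤ (|y| + |r|) ^ (k + 1) := by
      gcongr
      linarith [abs_nonneg r]
    calc _ ≤ (|y| + |r|) * ((k + 2) ^ 2 * (r ^ 2 * (|y| + |r|) ^ k)) +
          (k + 2) * (r ^ 2 * (|y| + |r|) ^ (k + 1)) := by gcongr
      _ = ((k + 2 : ℝ) ^ 2 + (k + 2)) * (r ^ 2 * (|y| + |r|) ^ (k + 1)) := by ring
      _ ≤ _ := by
        gcongr
        push_cast
        nlinarith [(Nat.cast_nonneg k : (0 : ℝ) ≤ k)]

variable {H : Type*} [NormedAddCommGroup H] [InnerProductSpace ℝ H]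

/-- The linear term of the expansion is kept as a hypothesis: Cauchy–Schwarz would only give √ε for
it. -/
theorem IsIsonormal.exists_abs_integral_pow_sub_le (M : ℝ) (k : ℕ) : ∃ C : ℝ, 0 ≤ C ∧
    ∀ {Ω : Type*} [MeasurableSpace Ω] {P : Measure Ω} {W : H →ₗᵢ[ℝ] Lp ℝ 2 P} (hW : IsIsonormal W)
      {X Y R : Lp ℝ 2 P} {ε : ℝ}, 0 < ε → X = Y + R →
      Y ∈ closure (range hW.wickSum) → R ∈ closure (range hW.wickSum) →
      ‖Y‖ ≤ M → ‖R‖ ≤ M → ‖R‖ ^ 2 ≤ ε → |∫ ω, Y ω ^ (k + 1) * R ω ∂P| ≤ ε →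
      |∫ ω, X ω ^ (k + 2) ∂P - ∫ ω, Y ω ^ (k + 2) ∂P| ≤ C * ε := by
  set D : ℝ := 4 * (2 * k).factorial * (8 * |M|) ^ (2 * k) with hD
  refine ⟨(k + 2) + (k + 2) ^ 2 * (4 * Nat.factorial 4 * 8 ^ 4 + 2 ^ (2 * k) * (D + D)),
    by positivity, fun {Ω} _ {P} {W} hW {X} {Y} {R} {ε} hε hX hY hR hYM hRM hRε hYR ↦ ?_⟩
  have iY : ∀ n, Integrable (fun ω ↦ Y ω ^ n) P := fun n ↦
    integrable_pow_of_mem_interior_integrableExpSet (hW.zero_mem_interior_integrableExpSet hY) n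
  have hR4 : ∫ ω, |R ω| ^ 4 ∂P ≤ 4 * Nat.factorial 4 * 8 ^ 4 * ε ^ 2 := by
    refine (hW.integral_abs_pow_le hR le_rfl 4).trans ?_
    rw [mul_pow, ← mul_assoc, show ‖R‖ ^ 4 = (‖R‖ ^ 2) ^ 2 by ring]
    gcongr
  have hYk : ∫ ω, |Y ω| ^ (2 * k) ∂P ≤ D :=
    hW.integral_abs_pow_le hY (hYM.trans (le_abs_self M)) _
  have hRk : ∫ ω, |R ω| ^ (2 * k) ∂P ≤ D :=
    hW.integral_abs_pow_le hR (hRM.trans (le_abs_self M)) _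
  have hXae : X =ᵐ[P] fun ω ↦ Y ω + R ω := by rw [hX]; exact Lp.coeFn_add Y R
  have mY := Lp.aestronglyMeasurable Y
  have mR := Lp.aestronglyMeasurable R
  have iS : Integrable (fun ω ↦ ε * (2 ^ (2 * k) * (|Y ω| ^ (2 * k) + |R ω| ^ (2 * k)))) P :=
    (((hW.integrable_abs_pow hY _).add (hW.integrable_abs_pow hR _)).const_mul _).const_mul _
  have iB : Integrable (fun ω ↦ ε⁻¹ * |R ω| ^ 4 + ε * (2 ^ (2 * k) *
      (|Y ω| ^ (2 * k) + |R ω| ^ (2 * k)))) P :=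
    ((hW.integrable_abs_pow hR 4).const_mul _).add iS
  -- Weighted arithmetic-geometric mean inequality. As E[R⁴] = O(ε²), the weights ε⁻¹ and ε make
  -- both terms O(ε) after integration.
  have hpt : ∀ ω, R ω ^ 2 * (|Y ω| + |R ω|) ^ k ≤
      ε⁻¹ * |R ω| ^ 4 + ε * (2 ^ (2 * k) * (|Y ω| ^ (2 * k) + |R ω| ^ (2 * k))) := by
    intro ω
    have h1 : ((|Y ω| + |R ω|) ^ k) ^ 2 ≤ 2 ^ (2 * k) * (|Y ω| ^ (2 * k) + |R ω| ^ (2 * k)) := by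
      rw [← pow_mul, mul_comm k 2]
      calc (|Y ω| + |R ω|) ^ (2 * k) ≤ (2 * max |Y ω| |R ω|) ^ (2 * k) := by
            gcongr
            linarith [le_max_left |Y ω| |R ω|, le_max_right |Y ω| |R ω|]
        _ = 2 ^ (2 * k) * (max |Y ω| |R ω|) ^ (2 * k) := by rw [mul_pow]
        _ ≤ _ := by
            gcongr
            rcases max_choice |Y ω| |R ω| with h | h <;> rw [h]
            · linarith [pow_nonneg (abs_nonneg (R ω)) (2 * k)]
            · linarith [pow_nonneg (abs_nonneg (Y ω)) (2 * k)]
    have h2 : |R ω| ^ 4 = (R ω ^ 2) ^ 2 := by rw [← sq_abs (R ω)]; ring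
    set s := (|Y ω| + |R ω|) ^ k
    rw [h2]
    have h3 : R ω ^ 2 * s ≤ ε⁻¹ * (R ω ^ 2) ^ 2 + ε * s ^ 2 := by
      have h4 := sq_nonneg (R ω ^ 2 - ε * s)
      have h5 : ε⁻¹ * (R ω ^ 2) ^ 2 + ε * s ^ 2 - 2 * (R ω ^ 2 * s) =
          ε⁻¹ * (R ω ^ 2 - ε * s) ^ 2 := by field_simp; ring
      have h6 : 0 ≤ ε⁻¹ * (R ω ^ 2 - ε * s) ^ 2 := by positivity
      have h7 : 0 ≤ R ω ^ 2 * s := by positivity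
      linarith
    exact h3.trans (by gcongr)
  have iQ : Integrable (fun ω ↦ (Y ω + R ω) ^ (k + 2) - Y ω ^ (k + 2) -
      (k + 2) * Y ω ^ (k + 1) * R ω) P := by
    refine (iB.const_mul ((k + 2 : ℝ) ^ 2)).mono' (by fun_prop) (ae_of_all _ fun ω ↦ ?_)
    rw [Real.norm_eq_abs]
    exact (abs_add_pow_sub_le _ _ k).trans (by gcongr; exact hpt ω)
  have iYR : Integrable (fun ω ↦ Y ω ^ (k + 1) * R ω) P := by
    have h1 : MemLp (fun ω ↦ Y ω ^ (k + 1)) 2 P := by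
      rw [memLp_two_iff_integrable_sq (by fun_prop)]
      simpa [← pow_mul] using iY ((k + 1) * 2)
    exact h1.integrable_mul (Lp.memLp R)
  have e : ∫ ω, X ω ^ (k + 2) ∂P - ∫ ω, Y ω ^ (k + 2) ∂P =
      (∫ ω, ((Y ω + R ω) ^ (k + 2) - Y ω ^ (k + 2) - (k + 2) * Y ω ^ (k + 1) * R ω) ∂P) +
        (k + 2) * ∫ ω, Y ω ^ (k + 1) * R ω ∂P := by
    have h1 : ∫ ω, X ω ^ (k + 2) ∂P = ∫ ω, (((Y ω + R ω) ^ (k + 2) - Y ω ^ (k + 2) -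
        (k + 2) * Y ω ^ (k + 1) * R ω) + Y ω ^ (k + 2) + (k + 2) * (Y ω ^ (k + 1) * R ω)) ∂P := by
      refine integral_congr_ae ?_
      filter_upwards [hXae] with ω hω
      rw [hω]; ring
    rw [h1, integral_add (by exact iQ.add (iY _)) (iYR.const_mul _), integral_add iQ (iY _),
      integral_const_mul]
    ring
  rw [e]
  refine (abs_add_le _ _).trans ?_
  rw [abs_mul, abs_of_nonneg (by positivity : (0 : ℝ) ≤ k + 2), add_mul (k + 2 : ℝ) _ ε]
  refine (add_comm _ _).trans_le ?_
  refine add_le_add (mul_le_mul_of_nonneg_left hYR (by positivity)) ?_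
  calc |∫ ω, ((Y ω + R ω) ^ (k + 2) - Y ω ^ (k + 2) - (k + 2) * Y ω ^ (k + 1) * R ω) ∂P|
      ≤ ∫ ω, |(Y ω + R ω) ^ (k + 2) - Y ω ^ (k + 2) - (k + 2) * Y ω ^ (k + 1) * R ω| ∂P :=
        abs_integral_le_integral_abs
    _ ≤ ∫ ω, (k + 2) ^ 2 * (ε⁻¹ * |R ω| ^ 4 + ε * (2 ^ (2 * k) *
          (|Y ω| ^ (2 * k) + |R ω| ^ (2 * k)))) ∂P :=
        integral_mono iQ.abs (iB.const_mul _) fun ω ↦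
          (abs_add_pow_sub_le _ _ k).trans (by gcongr; exact hpt ω)
    _ = (k + 2) ^ 2 * (ε⁻¹ * (∫ ω, |R ω| ^ 4 ∂P) + ε * (2 ^ (2 * k) *
          (∫ ω, |Y ω| ^ (2 * k) ∂P + ∫ ω, |R ω| ^ (2 * k) ∂P))) := by
        rw [integral_const_mul, integral_add ((hW.integrable_abs_pow hR 4).const_mul _) iS,
          integral_const_mul, integral_const_mul, integral_const_mul,
          integral_add (hW.integrable_abs_pow hY _) (hW.integrable_abs_pow hR _)]
    _ ≤ (k + 2) ^ 2 * (ε⁻¹ * (4 * Nat.factorial 4 * 8 ^ 4 * ε ^ 2) +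
          ε * (2 ^ (2 * k) * (D + D))) := by gcongr
    _ = _ := by
        have : ε⁻¹ * ε = 1 := inv_mul_cancel₀ hε.ne'
        linear_combination ((k + 2 : ℝ) ^ 2 * (4 * Nat.factorial 4 * 8 ^ 4) * ε) * this

end BaiTaqqu

namespace BaiTaqqu

variable {Ω : Type*} [MeasurableSpace Ω] {P : Measure Ω}
  {H : Type*} [NormedAddCommGroup H] [InnerProductSpace ℝ H]
  {H₂ : Type*} [NormedAddCommGroup H₂] [InnerProductSpace ℝ H₂] {T : H → H → H₂}

namespace IsIsonormal

variable {W : H →ₗᵢ[ℝ] Lp ℝ 2 P}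

/-! ### Projection onto the second chaos of a functional of finitely many coordinates -/

/-- By orthogonality `V` is independent of the pair (W h, W k), and the centred product has mean 0.
-/
theorem inner_wick_eq_zero_of_orthogonal (hW : IsIsonormal W) {ι : Type*} [Fintype ι] {e : ι → H}
    {v : (ι → ℝ) → ℝ} (hv : Measurable v) {V : Lp ℝ 2 P} (hV : V =ᵐ[P] fun ω ↦ v fun i ↦ W (e i) ω)
    {h k : H} (hh : ∀ i, ⟪e i, h⟫ = 0) (hk : ∀ i, ⟪e i, k⟫ = 0) : ⟪V, hW.wick h k⟫ = 0 := by
  have hprob := (hW.hasGaussianLaw 0).isProbabilityMeasure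
  have hind := (hW.indepFun_of_orthogonal (h := e) (k := ![h, k]) (by
    intro i j; fin_cases j <;> simp [hh, hk])).comp hv
    (show Measurable fun y : Fin 2 → ℝ ↦ y 0 * y 1 - ⟪h, k⟫ by fun_prop)
  have m1 : ∀ x : H, AEMeasurable (W x) P := aemeasurable W
  rw [L2.inner_def, integral_congr_ae (g := fun ω ↦ (v fun i ↦ W (e i) ω) *
    (W h ω * W k ω - ⟪h, k⟫)) (by
      filter_upwards [hV, hW.coe_wick h k] with ω h1 h2
      rw [h1, h2]
      simp [mul_comm])]
  have := hind.integral_fun_mul_eq_mul_integral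
    (hv.comp_aemeasurable (aemeasurable_pi_lambda _ fun i ↦ m1 (e i))).aestronglyMeasurable
    ((show Measurable fun y : Fin 2 → ℝ ↦ y 0 * y 1 - ⟪h, k⟫ by fun_prop).comp_aemeasurable
      (aemeasurable_pi_lambda _ fun j ↦ m1 (![h, k] j))).aestronglyMeasurable
  simp only [Function.comp_apply, Matrix.cons_val_zero, Matrix.cons_val_one] at this
  rw [this, ← integral_congr_ae (hW.coe_wick h k), hW.integral_wick, mul_zero]

/-- Here V · W(e j) is independent of the centred variable W k, and no centring term occurs. -/
theorem inner_wick_eq_zero_of_orthogonal_right (hW : IsIsonormal W) {ι : Type*} [Fintype ι]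
    {e : ι → H} {v : (ι → ℝ) → ℝ} (hv : Measurable v) {V : Lp ℝ 2 P}
    (hV : V =ᵐ[P] fun ω ↦ v fun i ↦ W (e i) ω) (j : ι)
    {k : H} (hk : ∀ i, ⟪e i, k⟫ = 0) : ⟪V, hW.wick (e j) k⟫ = 0 := by
  have hprob := (hW.hasGaussianLaw 0).isProbabilityMeasure
  have mv : Measurable fun y : ι → ℝ ↦ v y * y j := by fun_prop
  have mk : Measurable fun y : Fin 1 → ℝ ↦ y 0 := by fun_prop
  have hind := (hW.indepFun_of_orthogonal (h := e) (k := ![k]) (by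
    intro i j; fin_cases j; simp [hk])).comp mv mk
  have m1 : ∀ x : H, AEMeasurable (W x) P := aemeasurable W
  rw [L2.inner_def, integral_congr_ae (g := fun ω ↦ ((v fun i ↦ W (e i) ω) * W (e j) ω) *
    W k ω) (by
      filter_upwards [hV, hW.coe_wick (e j) k] with ω h1 h2
      rw [h1, h2, hk]
      simp
      ring)]
  have := hind.integral_fun_mul_eq_mul_integral
    (mv.comp_aemeasurable (aemeasurable_pi_lambda _ fun i ↦ m1 (e i))).aestronglyMeasurable
    (mk.comp_aemeasurable (aemeasurable_pi_lambda _ fun j ↦ m1 (![k] j))).aestronglyMeasurable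
  simp only [Function.comp_apply, Matrix.cons_val_zero] at this
  rw [this, hW.integral_eq_zero, mul_zero]

theorem inner_wick_eq_sum (hW : IsIsonormal W) {ι : Type*} [Fintype ι] {e : ι → H}
    (he : Orthonormal ℝ e) {v : (ι → ℝ) → ℝ} (hv : Measurable v) {V : Lp ℝ 2 P}
    (hV : V =ᵐ[P] fun ω ↦ v fun i ↦ W (e i) ω) (h k : H) :
    ⟪V, hW.wick h k⟫ = ∑ i, ∑ j, ⟪V, hW.wick (e i) (e j)⟫ * (⟪e i, h⟫ * ⟪e j, k⟫) := by
  classical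
  have hdec : ∀ h : H, ∃ h', h = (∑ i, ⟪e i, h⟫ • e i) + h' ∧ ∀ i, ⟪e i, h'⟫ = 0 := by
    intro h
    refine ⟨h - ∑ i, ⟪e i, h⟫ • e i, by abel, fun i ↦ ?_⟩
    rw [inner_sub_right, he.inner_right_fintype, sub_self]
  obtain ⟨h', hh, hh0⟩ := hdec h
  obtain ⟨k', hk, hk0⟩ := hdec k
  have z1 := fun i ↦ hW.inner_wick_eq_zero_of_orthogonal_right hv hV i hh0
  have z2 := fun i ↦ hW.inner_wick_eq_zero_of_orthogonal_right hv hV i hk0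
  have z3 := hW.inner_wick_eq_zero_of_orthogonal hv hV hh0 hk0
  have z1' : ∀ i, ⟪V, hW.wick h' (e i)⟫ = 0 := fun i ↦ by rw [hW.wick_comm, z1]
  rw [← wickₗ_apply]
  conv_lhs => rw [hh, hk]
  simp only [map_add, map_sum, map_smul, LinearMap.add_apply, LinearMap.sum_apply,
    LinearMap.smul_apply, wickₗ_apply, inner_add_right, inner_sum, real_inner_smul_right, z1', z2, z3,
    mul_zero, Finset.sum_const_zero, add_zero]
  rw [Finset.sum_comm]
  refine Finset.sum_congr rfl fun i _ ↦ ?_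
  rw [Finset.mul_sum]
  refine Finset.sum_congr rfl fun j _ ↦ ?_
  ring

/-- A functional of finitely many coordinates sees only finitely many coefficients of a chaos
element. Both sides are continuous in `x`, so elementary tensors suffice, and there the parts of `h`
and `k` orthogonal to `e` drop out. -/
theorem inner_chaos_eq_sum (hW : IsIsonormal W) (hT : IsTensor T) {ι : Type*} [Fintype ι]
    {e : ι → H} (he : Orthonormal ℝ e) {v : (ι → ℝ) → ℝ} (hv : Measurable v) {V : Lp ℝ 2 P}
    (hV : V =ᵐ[P] fun ω ↦ v fun i ↦ W (e i) ω) (x : H₂) :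
    ⟪V, hW.chaos T x⟫ = ∑ i, ∑ j, ⟪V, hW.wick (e i) (e j)⟫ * ⟪T (e i) (e j), x⟫ := by
  refine hT.dense.induction_on (p := fun x ↦ ⟪V, hW.chaos T x⟫ =
    ∑ i, ∑ j, ⟪V, hW.wick (e i) (e j)⟫ * ⟪T (e i) (e j), x⟫) x ?_ ?_
  · exact isClosed_eq (by fun_prop) (by fun_prop)
  · intro c
    induction c using Finsupp.induction_linear with
    | zero => simp
    | add f g hf hg =>
      simp only [map_add, inner_add_right, mul_add, Finset.sum_add_distrib] at hf hg ⊢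
      rw [hf, hg]
    | single p a =>
      rw [Finsupp.linearCombination_single, map_smul, hW.chaos_apply hT, real_inner_smul_right,
        hW.inner_wick_eq_sum he hv hV, Finset.mul_sum]
      refine Finset.sum_congr rfl fun i _ ↦ ?_
      rw [Finset.mul_sum]
      refine Finset.sum_congr rfl fun j _ ↦ ?_
      rw [real_inner_smul_right, hT.inner_eq]
      ring

theorem abs_inner_chaos_le (hW : IsIsonormal W) (hT : IsTensor T) {ι : Type*} [Fintype ι]
    {e : ι → H} (he : Orthonormal ℝ e) {v : (ι → ℝ) → ℝ} (hv : Measurable v) {V : Lp ℝ 2 P}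
    (hV : V =ᵐ[P] fun ω ↦ v fun i ↦ W (e i) ω) {x : H₂} {ε : ℝ}
    (hx : ∀ i j, |⟪T (e i) (e j), x⟫| ≤ ε) :
    |⟪V, hW.chaos T x⟫| ≤ 2 * Fintype.card ι ^ 2 * ‖V‖ * ε := by
  have hw : ∀ i j, ‖hW.wick (e i) (e j)‖ ≤ 2 := by
    intro i j
    have h1 : ‖hW.wick (e i) (e j)‖ ^ 2 ≤ 2 ^ 2 := by
      rw [← real_inner_self_eq_norm_sq, hW.inner_wick_wick, real_inner_self_eq_norm_sq,
        real_inner_self_eq_norm_sq, he.norm_eq_one, he.norm_eq_one, real_inner_comm]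
      have h2 := abs_real_inner_le_norm (e i) (e j)
      rw [he.norm_eq_one, he.norm_eq_one] at h2
      nlinarith [abs_le.1 h2, real_inner_comm (e i) (e j)]
    exact (sq_le_sq₀ (norm_nonneg _) (by norm_num)).1 h1
  rw [hW.inner_chaos_eq_sum hT he hv hV]
  calc _ ≤ ∑ i : ι, ∑ j : ι, (‖V‖ * 2) * ε := by
        refine (Finset.abs_sum_le_sum_abs _ _).trans (Finset.sum_le_sum fun i _ ↦ ?_)
        refine (Finset.abs_sum_le_sum_abs _ _).trans (Finset.sum_le_sum fun j _ ↦ ?_)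
        rw [abs_mul]
        refine mul_le_mul ((abs_real_inner_le_norm _ _).trans ?_) (hx i j) (abs_nonneg _)
          (by positivity)
        gcongr
        exact hw i j
    _ = _ := by
        simp
        ring

end IsIsonormal

end BaiTaqqu

namespace BaiTaqqu

/-! ### Density of step functions -/

/-- Dynkin's argument on each `B n`, where `f` is integrable because the measure is finite there. -/
theorem ae_eq_zero_of_forall_setIntegral_piSystem {α : Type*} [m : MeasurableSpace α]
    {μ : Measure α} {C : Set (Set α)} (hgen : m = MeasurableSpace.generateFrom C)
    (hpi : IsPiSystem C) {B : ℕ → Set α} (hB : ∀ n, B n ∈ C) (hcov : ⋃ n, B n = univ)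
    (hfin : ∀ n, μ (B n) ≠ ∞) {f : α → ℝ} (hf : MemLp f 2 μ)
    (h0 : ∀ s ∈ C, ∫ x in s, f x ∂μ = 0) : f =ᵐ[μ] 0 := by
  have hCm : ∀ s ∈ C, MeasurableSet s := fun s hs ↦ by
    rw [hgen]; exact MeasurableSpace.measurableSet_generateFrom hs
  have key : ∀ n, f =ᵐ[μ.restrict (B n)] 0 := by
    intro n
    have : IsFiniteMeasure (μ.restrict (B n)) := ⟨by simpa using (hfin n).lt_top⟩
    have hint : Integrable f (μ.restrict (B n)) := (hf.restrict (B n)).integrable (by norm_num)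
    refine hint.ae_eq_zero_of_forall_setIntegral_eq_zero fun s hs _ ↦ ?_
    induction s, hs using MeasurableSpace.induction_on_inter hgen hpi with
    | empty => simp
    | basic t ht =>
      rw [Measure.restrict_restrict (hCm t ht)]
      -- A π-system is only required to contain the nonempty intersections.
      rcases (t ∩ B n).eq_empty_or_nonempty with h | h
      · simp [h]
      · exact h0 _ (hpi t ht _ (hB n) h)
    | compl t ht ih =>
      rw [setIntegral_compl ht hint, ih (measure_lt_top _ _), h0 _ (hB n), sub_zero]
    | iUnion g hd hg ih =>
      rw [integral_iUnion hg hd hint.integrableOn]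
      simp [ih _ (measure_lt_top _ _)]
  have := (ae_restrict_iUnion_iff B fun x ↦ f x = 0).2 key
  rw [hcov, Measure.restrict_univ] at this
  exact this

theorem iUnion_Ioc_neg_nat : ⋃ n : ℕ, Ioc (-((n : ℝ) + 1)) ((n : ℝ) + 1) = univ := by
  refine eq_univ_of_forall fun x ↦ ?_
  obtain ⟨n, hn⟩ := exists_nat_gt |x|
  have := abs_lt.1 hn
  exact mem_iUnion.2 ⟨n, by linarith, by linarith⟩

theorem ae_eq_zero_of_forall_setIntegral_Ioc {f : ℝ → ℝ} (hf : MemLp f 2 volume)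
    (h0 : ∀ a b, a < b → ∫ x in Ioc a b, f x = 0) : f =ᵐ[volume] 0 := by
  refine ae_eq_zero_of_forall_setIntegral_piSystem
    (C := {S | ∃ i j : ℝ, i < j ∧ Ioc i j = S}) (B := fun n : ℕ ↦ Ioc (-((n : ℝ) + 1)) (n + 1))
    ?_ (isPiSystem_Ioc (fun x : ℝ ↦ x) (fun x : ℝ ↦ x)) (fun n ↦ ⟨_, _, by
      linarith [(Nat.cast_nonneg n : (0 : ℝ) ≤ n)], rfl⟩) iUnion_Ioc_neg_nat
    (fun n ↦ measure_Ioc_lt_top.ne) hf ?_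
  · rw [BorelSpace.measurable_eq (α := ℝ), borel_eq_generateFrom_Ioc]
  · rintro s ⟨a, b, hab, rfl⟩
    exact h0 a b hab

theorem ae_eq_zero_of_forall_setIntegral_Ioc_prod {f : ℝ × ℝ → ℝ} (hf : MemLp f 2 volume)
    (h0 : ∀ a b c d, a < b → c < d → ∫ x in Ioc a b ×ˢ Ioc c d, f x = 0) : f =ᵐ[volume] 0 := by
  have hlt : ∀ n : ℕ, -((n : ℝ) + 1) < n + 1 := fun n ↦ by
    linarith [(Nat.cast_nonneg n : (0 : ℝ) ≤ n)]
  have hg : (inferInstance : MeasurableSpace ℝ) =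
      MeasurableSpace.generateFrom {S | ∃ i j : ℝ, i < j ∧ Ioc i j = S} := by
    rw [BorelSpace.measurable_eq (α := ℝ), borel_eq_generateFrom_Ioc]
  have hs : IsCountablySpanning {S | ∃ i j : ℝ, i < j ∧ Ioc i j = S} :=
    ⟨fun n : ℕ ↦ Ioc (-((n : ℝ) + 1)) (n + 1), fun n ↦ ⟨_, _, hlt n, rfl⟩, iUnion_Ioc_neg_nat⟩
  refine ae_eq_zero_of_forall_setIntegral_piSystem
    (C := image2 (· ×ˢ ·) {S | ∃ i j : ℝ, i < j ∧ Ioc i j = S} {S | ∃ i j : ℝ, i < j ∧ Ioc i j = S})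
    (B := fun n : ℕ ↦ Ioc (-((n : ℝ) + 1)) (n + 1) ×ˢ Ioc (-((n : ℝ) + 1)) (n + 1))
    (generateFrom_eq_prod hg.symm hg.symm hs hs).symm
    ((isPiSystem_Ioc (fun x : ℝ ↦ x) (fun x : ℝ ↦ x)).prod
      (isPiSystem_Ioc (fun x : ℝ ↦ x) (fun x : ℝ ↦ x)))
    (fun n ↦ ⟨_, ⟨_, _, hlt n, rfl⟩, _, ⟨_, _, hlt n, rfl⟩, rfl⟩) ?_ (fun n ↦ ?_) hf ?_
  · refine eq_univ_of_forall fun x ↦ ?_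
    obtain ⟨n, hn⟩ := exists_nat_gt (max |x.1| |x.2|)
    have h1 := abs_lt.1 ((le_max_left _ _).trans_lt hn)
    have h2 := abs_lt.1 ((le_max_right _ _).trans_lt hn)
    exact mem_iUnion.2 ⟨n, ⟨by linarith, by linarith⟩, by linarith, by linarith⟩
  · rw [Measure.volume_eq_prod, Measure.prod_prod]
    exact ENNReal.mul_ne_top measure_Ioc_lt_top.ne measure_Ioc_lt_top.ne
  · rintro s ⟨_, ⟨a, b, hab, rfl⟩, _, ⟨c, d, hcd, rfl⟩, rfl⟩
    exact h0 a b c d hab hcd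

/-- The diagonal is null, and its complement is a countable union of quadrants with rational corners
on the diagonal. A rectangle cut by such a quadrant is off-diagonal. -/
theorem ae_eq_zero_of_forall_offDiag {f : ℝ × ℝ → ℝ} (hf : MemLp f 2 volume)
    (h0 : ∀ R : OffDiagRect, ∫ x in Ioc R.l₁ R.r₁ ×ˢ Ioc R.l₂ R.r₂, f x = 0) : f =ᵐ[volume] 0 := by
  have h1 : ∀ q : ℚ, (Iic (q : ℝ) ×ˢ Ioi (q : ℝ)).indicator f =ᵐ[volume] 0 := by
    intro q
    have hm : MeasurableSet (Iic (q : ℝ) ×ˢ Ioi (q : ℝ)) := measurableSet_Iic.prod measurableSet_Ioi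
    refine ae_eq_zero_of_forall_setIntegral_Ioc_prod (hf.indicator hm) fun a b c d hab hcd ↦ ?_
    rw [setIntegral_indicator hm, prod_inter_prod, Ioc_inter_Iic, Ioc_inter_Ioi]
    rcases le_or_gt (min b q) a with h | h
    · simp [Ioc_eq_empty_of_le h]
    rcases le_or_gt d (max c q) with h' | h'
    · simp [Ioc_eq_empty_of_le h']
    exact h0 ⟨a, min b q, max c q, d, h.le, h'.le,
      Or.inl ((min_le_right _ _).trans (le_max_right _ _))⟩
  have h2 : ∀ q : ℚ, (Ioi (q : ℝ) ×ˢ Iic (q : ℝ)).indicator f =ᵐ[volume] 0 := by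
    intro q
    have hm : MeasurableSet (Ioi (q : ℝ) ×ˢ Iic (q : ℝ)) := measurableSet_Ioi.prod measurableSet_Iic
    refine ae_eq_zero_of_forall_setIntegral_Ioc_prod (hf.indicator hm) fun a b c d hab hcd ↦ ?_
    rw [setIntegral_indicator hm, prod_inter_prod, Ioc_inter_Iic, Ioc_inter_Ioi]
    rcases le_or_gt b (max a q) with h | h
    · simp [Ioc_eq_empty_of_le h]
    rcases le_or_gt (min d q) c with h' | h'
    · simp [Ioc_eq_empty_of_le h']
    exact h0 ⟨max a q, b, c, min d q, h.le, h'.le,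
      Or.inr ((min_le_right _ _).trans (le_max_right _ _))⟩
  have h3 : ∀ᵐ x : ℝ × ℝ, x.1 ≠ x.2 := by
    rw [Measure.volume_eq_prod, Measure.ae_prod_iff_ae_ae]
    · refine ae_of_all _ fun x ↦ ?_
      have : ∀ᵐ y : ℝ, y ≠ x := by simp [ae_iff]
      filter_upwards [this] with y hy using hy.symm
    · exact (measurableSet_eq_fun measurable_fst measurable_snd).compl
  filter_upwards [ae_all_iff.2 h1, ae_all_iff.2 h2, h3] with x g1 g2 g3
  rcases lt_or_gt_of_ne g3 with h | h
  · obtain ⟨q, hq1, hq2⟩ := exists_rat_btwn h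
    have := g1 q
    rwa [indicator_of_mem (show x ∈ Iic (q : ℝ) ×ˢ Ioi (q : ℝ) from ⟨hq1.le, hq2⟩)] at this
  · obtain ⟨q, hq1, hq2⟩ := exists_rat_btwn h
    have := g2 q
    rwa [indicator_of_mem (show x ∈ Ioi (q : ℝ) ×ˢ Iic (q : ℝ) from ⟨hq2, hq1.le⟩)] at this

/-! ### Dense families in `L²` and indicators of intervals. -/

theorem denseRange_of_inner_eq_zero {E F : Type*} [AddCommGroup F] [Module ℝ F]
    [NormedAddCommGroup E] [InnerProductSpace ℝ E] [CompleteSpace E] (L : F →ₗ[ℝ] E)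
    (h : ∀ x : E, (∀ y, ⟪L y, x⟫ = 0) → x = 0) : DenseRange L := by
  have h1 : (LinearMap.range L)ᗮ = ⊥ := by
    rw [Submodule.eq_bot_iff]
    intro x hx
    exact h x fun y ↦ (Submodule.mem_orthogonal _ _).1 hx _ ⟨y, rfl⟩
  have h2 := Submodule.topologicalClosure_eq_top_iff.2 h1
  have h3 := congrArg (fun S : Submodule ℝ E ↦ (S : Set E)) h2
  simp only [Submodule.topologicalClosure_coe, LinearMap.coe_range, Submodule.top_coe] at h3
  exact dense_iff_closure_eq.2 h3

/-- The indicator of `(l, r]` as an element of `L²(ℝ)`. -/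
noncomputable def iocLp (l r : ℝ) : Lp ℝ 2 (volume : Measure ℝ) :=
  indicatorConstLp 2 (measurableSet_Ioc (a := l) (b := r)) measure_Ioc_lt_top.ne 1

theorem coe_iocLp (l r : ℝ) : iocLp l r =ᵐ[volume] (Ioc l r).indicator fun _ ↦ 1 :=
  indicatorConstLp_coeFn

theorem inner_iocLp (l r : ℝ) (f : Lp ℝ 2 (volume : Measure ℝ)) :
    ⟪iocLp l r, f⟫ = ∫ x in Ioc l r, f x :=
  L2.inner_indicatorConstLp_one _ _ f

theorem iocLp_add (a b c : ℝ) (hab : a ≤ b) (hbc : b ≤ c) :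
    iocLp a b + iocLp b c = iocLp a c := by
  apply Lp.ext
  filter_upwards [Lp.coeFn_add (iocLp a b) (iocLp b c), coe_iocLp a b, coe_iocLp b c,
    coe_iocLp a c] with x h1 h2 h3 h4
  rw [h1, Pi.add_apply, h2, h3, h4]
  simp only [indicator, mem_Ioc]
  split_ifs <;> first | (exfalso; grind) | norm_num

theorem norm_iocLp_sq {l r : ℝ} (h : l ≤ r) : ‖iocLp l r‖ ^ 2 = r - l := by
  rw [← real_inner_self_eq_norm_sq, inner_iocLp, setIntegral_congr_ae measurableSet_Ioc
    (g := fun _ ↦ (1 : ℝ)) (by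
      filter_upwards [coe_iocLp l r] with x hx hm
      rw [hx, indicator_of_mem hm])]
  simp [h]

/-- The indicator of the oriented interval from `0` to `t`. -/
noncomputable def signedLp (t : ℝ) : Lp ℝ 2 (volume : Measure ℝ) := iocLp 0 t - iocLp t 0

theorem iocLp_eq_zero {l r : ℝ} (h : r ≤ l) : iocLp l r = 0 := by
  simp [iocLp, Ioc_eq_empty_of_le h]

theorem signedLp_sub {l r : ℝ} (h : l ≤ r) : signedLp r - signedLp l = iocLp l r := by
  unfold signedLp
  rcases le_total 0 l with hl | hl
  · rw [iocLp_eq_zero (hl.trans h), iocLp_eq_zero hl, ← iocLp_add 0 l r hl h]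
    abel
  · rcases le_total 0 r with hr | hr
    · rw [iocLp_eq_zero hr, iocLp_eq_zero hl, ← iocLp_add l 0 r hl hr]
      abel
    · rw [iocLp_eq_zero hr, iocLp_eq_zero hl, ← iocLp_add l r 0 h hr]
      abel

theorem signedLp_zero : signedLp 0 = 0 := by simp [signedLp]

theorem norm_signedLp_sub_sq (s t : ℝ) : ‖signedLp s - signedLp t‖ ^ 2 = |s - t| := by
  rcases le_total s t with h | h
  · rw [norm_sub_rev, signedLp_sub h, norm_iocLp_sq h, abs_of_nonpos (by linarith)]
    ring
  · rw [signedLp_sub h, norm_iocLp_sq h, abs_of_nonneg (by linarith)]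

theorem denseRange_signedLp : DenseRange (Finsupp.linearCombination ℝ signedLp) := by
  refine denseRange_of_inner_eq_zero _ fun x hx ↦ ?_
  have h1 : ∀ t, ⟪signedLp t, x⟫ = 0 := fun t ↦ by simpa using hx (Finsupp.single t 1)
  refine (Lp.eq_zero_iff_ae_eq_zero).2 (ae_eq_zero_of_forall_setIntegral_Ioc (Lp.memLp x)
    fun a b hab ↦ ?_)
  rw [← inner_iocLp, ← signedLp_sub hab.le, inner_sub_left, h1, h1, sub_zero]

/-! ### The isonormal process of a Brownian motion -/

variable {Ω : Type*} [MeasurableSpace Ω] {P : Measure Ω}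

/-- Distances to a family containing 0 determine its Gram matrix. It serves indicators and Brownian
increments alike, both with squared distance |s - t|. -/
theorem inner_eq_of_norm_sub {ι E : Type*} [NormedAddCommGroup E] [InnerProductSpace ℝ E]
    {u : ι → E} {o : ι} (ho : u o = 0) (i j : ι) :
    ⟪u i, u j⟫ = (‖u i - u o‖ ^ 2 + ‖u j - u o‖ ^ 2 - ‖u i - u j‖ ^ 2) / 2 := by
  rw [ho, sub_zero, sub_zero, norm_sub_sq_real]
  ring

theorem norm_linearCombination_eq {ι E F : Type*} [NormedAddCommGroup E] [InnerProductSpace ℝ E]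
    [NormedAddCommGroup F] [InnerProductSpace ℝ F] {u : ι → E} {v : ι → F}
    (h : ∀ i j, ⟪u i, u j⟫ = ⟪v i, v j⟫) (c : ι →₀ ℝ) :
    ‖Finsupp.linearCombination ℝ u c‖ = ‖Finsupp.linearCombination ℝ v c‖ := by
  refine (sq_eq_sq₀ (norm_nonneg _) (norm_nonneg _)).1 ?_
  rw [← real_inner_self_eq_norm_sq, ← real_inner_self_eq_norm_sq, inner_linearCombination,
    inner_linearCombination]
  simp only [h]

/-- Two families with the same Gram matrix are related by a linear isometry. -/
theorem exists_linearIsometry {ι E F : Type*} [NormedAddCommGroup E] [InnerProductSpace ℝ E]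
    [NormedAddCommGroup F] [InnerProductSpace ℝ F] [CompleteSpace F] {u : ι → E} {v : ι → F}
    (hu : DenseRange (Finsupp.linearCombination ℝ u)) (h : ∀ i j, ⟪u i, u j⟫ = ⟪v i, v j⟫) :
    ∃ W : E →ₗᵢ[ℝ] F, ∀ i, W (u i) = v i := by
  have hn := norm_linearCombination_eq h
  let L := (Finsupp.linearCombination ℝ v).extendOfNorm (Finsupp.linearCombination ℝ u)
  have hL : ∀ c, L (Finsupp.linearCombination ℝ u c) = Finsupp.linearCombination ℝ v c :=
    LinearMap.extendOfNorm_eq hu ⟨1, fun c ↦ by rw [hn, one_mul]⟩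
  refine ⟨⟨L.toLinearMap, fun x ↦ ?_⟩, fun i ↦ ?_⟩
  · refine hu.induction_on (p := fun x ↦ ‖L x‖ = ‖x‖) x (isClosed_eq (by fun_prop) (by fun_prop)) ?_
    intro c
    rw [hL, hn]
  · simpa using hL (Finsupp.single i 1)

theorem norm_exp_I_sub_le (a b : ℝ) :
    ‖Complex.exp (a * Complex.I) - Complex.exp (b * Complex.I)‖ ≤ |a - b| := by
  have e : Complex.exp (a * Complex.I) - Complex.exp (b * Complex.I) =
      Complex.exp (b * Complex.I) * (Complex.exp (Complex.I * (a - b : ℝ)) - 1) := by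
    rw [mul_sub, ← Complex.exp_add, mul_one]
    congr 2
    push_cast
    ring
  rw [e, norm_mul, Complex.norm_exp_ofReal_mul_I, one_mul]
  exact Real.norm_exp_I_mul_ofReal_sub_one_le

/-- The integrand is |s|-Lipschitz in the value of `X`, and the L¹ norm is at most the L² norm. So
centred Gaussian laws survive L² limits. -/
theorem continuous_integral_exp_Lp [IsProbabilityMeasure P] (s : ℝ) :
    Continuous fun X : Lp ℝ 2 P ↦ ∫ ω, Complex.exp ((s * X ω : ℝ) * Complex.I) ∂P := by
  have hint : ∀ X : Lp ℝ 2 P, Integrable (fun ω ↦ Complex.exp ((s * X ω : ℝ) * Complex.I)) P := by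
    intro X
    have := (Lp.aestronglyMeasurable X).aemeasurable
    refine Integrable.of_bound (C := 1) (by
      refine AEMeasurable.aestronglyMeasurable ?_
      fun_prop) (ae_of_all _ fun ω ↦ ?_)
    rw [Complex.norm_exp_ofReal_mul_I]
  refine (LipschitzWith.of_dist_le_mul (K := ‖s‖₊) fun X Y ↦ ?_).continuous
  rw [dist_eq_norm, dist_eq_norm, ← integral_sub (hint X) (hint Y)]
  have hXY := Lp.memLp (X - Y)
  have i1 : Integrable (fun ω ↦ |(X - Y : Lp ℝ 2 P) ω|) P := (hXY.integrable (by norm_num)).abs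
  calc _ ≤ ∫ ω, |s| * |(X - Y : Lp ℝ 2 P) ω| ∂P := by
        refine norm_integral_le_of_norm_le (i1.const_mul _) ?_
        filter_upwards [Lp.coeFn_sub X Y] with ω hω
        refine (norm_exp_I_sub_le _ _).trans ?_
        rw [hω, Pi.sub_apply, ← abs_mul, mul_sub]
    _ = |s| * ∫ ω, ‖(X - Y : Lp ℝ 2 P) ω‖ ∂P := by rw [integral_const_mul]; rfl
    _ ≤ _ := by
        rw [coe_nnnorm, Real.norm_eq_abs s]
        refine mul_le_mul_of_nonneg_left ?_ (abs_nonneg s)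
        rw [← lpNorm_one_eq_integral_norm hXY.1, ← toReal_eLpNorm hXY.1, Lp.norm_def]
        exact ENNReal.toReal_mono hXY.2.ne
          (eLpNorm_le_eLpNorm_of_exponent_le (by norm_num) hXY.1)

theorem map_eq_gaussianReal_iff [IsProbabilityMeasure P] (X : Lp ℝ 2 P) (v : ℝ≥0) :
    P.map X = gaussianReal 0 v ↔
      ∀ s : ℝ, ∫ ω, Complex.exp ((s * X ω : ℝ) * Complex.I) ∂P =
        Complex.exp (-(v * s ^ 2 / 2 : ℝ)) := by
  have hX := (Lp.aestronglyMeasurable X).aemeasurable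
  have := Measure.isProbabilityMeasure_map (μ := P) hX
  have h1 : ∀ s : ℝ, charFun (P.map X) s = ∫ ω, Complex.exp ((s * X ω : ℝ) * Complex.I) ∂P := by
    intro s
    rw [charFun_apply_real, integral_map hX (by fun_prop)]
    push_cast
    rfl
  have h2 : ∀ s : ℝ, charFun (gaussianReal 0 v) s = Complex.exp (-(v * s ^ 2 / 2 : ℝ)) := by
    intro s
    rw [charFun_gaussianReal]
    congr 1
    push_cast
    ring
  constructor
  · intro h s
    rw [← h1, h, h2]
  · intro h
    refine Measure.ext_of_charFun (funext fun s ↦ ?_)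
    rw [h1, h2, h]

theorem map_eq_gaussianReal_of_hasGaussianLaw [IsProbabilityMeasure P] {X : Lp ℝ 2 P}
    (hX : HasGaussianLaw X P) (h0 : ∫ ω, X ω ∂P = 0) : P.map X = gaussianReal 0 (‖X‖₊ ^ 2) := by
  rw [hX.map_eq_gaussianReal, h0, variance_of_integral_eq_zero hX.aemeasurable h0]
  congr 1
  have : ∫ ω, X ω ^ 2 ∂P = ‖X‖ ^ 2 := by
    rw [← real_inner_self_eq_norm_sq, L2.inner_def]
    simp [sq]
  rw [this]
  exact NNReal.eq (by simp)

/-- A linear isometry is isonormal as soon as it sends a family with dense span to a family whose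
linear combinations are centred Gaussian. -/
theorem isIsonormal_of_denseRange [IsProbabilityMeasure P] {ι H : Type*} [NormedAddCommGroup H]
    [InnerProductSpace ℝ H] {u : ι → H} (hu : DenseRange (Finsupp.linearCombination ℝ u))
    {v : ι → Lp ℝ 2 P} (W : H →ₗᵢ[ℝ] Lp ℝ 2 P) (hW : ∀ i, W (u i) = v i)
    (hv : ∀ c, HasGaussianLaw (Finsupp.linearCombination ℝ v c) P)
    (hv0 : ∀ c, ∫ ω, Finsupp.linearCombination ℝ v c ω ∂P = 0) : IsIsonormal W := by
  have hWc : ∀ c, W (Finsupp.linearCombination ℝ u c) = Finsupp.linearCombination ℝ v c := by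
    intro c
    rw [Finsupp.linearCombination_apply, Finsupp.linearCombination_apply, Finsupp.sum, Finsupp.sum,
      map_sum]
    simp only [map_smul, hW]
  refine ⟨fun h ↦ (map_eq_gaussianReal_iff _ _).2 fun s ↦ ?_⟩
  -- The identity between characteristic functions is a closed condition on `h`, so it need only
  -- hold on the dense span.
  refine hu.induction_on (p := fun h ↦ ∫ ω, Complex.exp ((s * W h ω : ℝ) * Complex.I) ∂P =
        Complex.exp (-((‖h‖₊ ^ 2 : ℝ≥0) * s ^ 2 / 2 : ℝ))) h (isClosed_eq ?_ (by fun_prop)) ?_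
  · exact (continuous_integral_exp_Lp s).comp W.continuous
  · intro c
    refine (map_eq_gaussianReal_iff _ _).1 ?_ s
    rw [← W.nnnorm_map, hWc]
    exact map_eq_gaussianReal_of_hasGaussianLaw (hv c) (hv0 c)

namespace IsTwoSidedBrownian

variable {B : ℝ → Ω → ℝ}

theorem hasGaussianLaw_sub (hB : IsTwoSidedBrownian B P) (s t : ℝ) :
    HasGaussianLaw (fun ω ↦ B t ω - B s ω) P := by
  rcases le_total s t with h | h
  · exact (hB.law s t h).hasGaussianLaw
  · simpa using (hB.law t s h).hasGaussianLaw.fun_neg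

theorem integral_sub_eq_zero (hB : IsTwoSidedBrownian B P) (s t : ℝ) :
    ∫ ω, (B t ω - B s ω) ∂P = 0 := by
  have key : ∀ s t, s ≤ t → ∫ ω, (B t ω - B s ω) ∂P = 0 := by
    intro s t h
    rw [(hB.law s t h).integral_eq, integral_id_gaussianReal]
  rcases le_total s t with h | h
  · exact key s t h
  · have := key t s h
    rw [← neg_eq_zero, ← integral_neg]
    simpa using this

theorem integral_sub_sq (hB : IsTwoSidedBrownian B P) (s t : ℝ) :
    ∫ ω, (B t ω - B s ω) ^ 2 ∂P = |s - t| := by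
  have key : ∀ s t, s ≤ t → ∫ ω, (B t ω - B s ω) ^ 2 ∂P = |s - t| := by
    intro s t h
    have h1 := (hB.law s t h).variance_eq
    rw [variance_id_gaussianReal, variance_of_integral_eq_zero
      (hB.hasGaussianLaw_sub s t).aemeasurable (hB.integral_sub_eq_zero s t)] at h1
    rw [h1, Real.coe_toNNReal _ (by linarith), abs_of_nonpos (by linarith)]
    ring
  rcases le_total s t with h | h
  · exact key s t h
  · rw [abs_sub_comm, ← key t s h]
    congr 1 with ω
    ring

/-- Restricted to [a, ∞) and recentred at `a`, the process starts at 0 and has independent Gaussian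
increments. -/
theorem isGaussianProcess (hB : IsTwoSidedBrownian B P) (a : ℝ) :
    IsGaussianProcess (fun (t : Ici a) ω ↦ B t ω - B a ω) P := by
  refine HasIndepIncrements.isGaussianProcess (fun t ↦ hB.hasGaussianLaw_sub a t) ?_ ?_
  · exact ae_of_all _ fun ω ↦ sub_self _
  · intro n t ht
    simpa using hB.indep n (fun i ↦ (t i : ℝ)) fun i j hij ↦ ht hij

theorem hasGaussianLaw_sum (hB : IsTwoSidedBrownian B P) (c : ℝ →₀ ℝ) :
    HasGaussianLaw (fun ω ↦ ∑ t ∈ c.support, c t * (B t ω - B 0 ω)) P := by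
  classical
  set I := insert 0 c.support with hI
  obtain ⟨a, ha⟩ : ∃ a, ∀ t ∈ I, a ≤ t := I.bddBelow
  -- Moving the base point from 0 to `a` changes only the coefficient at time 0, by the total sum of
  -- the coefficients.
  let d : ℝ → ℝ := fun t ↦ c t - if t = 0 then ∑ t ∈ c.support, c t else 0
  have h1 := ((hB.isGaussianProcess a).smul (fun t : Ici a ↦ d t)).hasGaussianLaw_fun_sum
    (I := I.subtype (· ∈ Ici a))
  refine h1.congr (ae_of_all _ fun ω ↦ ?_)
  simp only [smul_eq_mul]
  rw [Finset.sum_subtype_of_mem (f := fun t ↦ d t * (B t ω - B a ω)) (p := (· ∈ Ici a)) ha]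
  have h2 : ∑ t ∈ I, c t * (B t ω - B a ω) = ∑ t ∈ c.support, c t * (B t ω - B a ω) := by
    refine (Finset.sum_subset (Finset.subset_insert _ _) fun t _ ht ↦ ?_).symm
    rw [Finsupp.notMem_support_iff.1 ht, zero_mul]
  have h3 : ∑ t ∈ I, (if t = 0 then ∑ t ∈ c.support, c t else 0) * (B t ω - B a ω) =
      (∑ t ∈ c.support, c t) * (B 0 ω - B a ω) := by
    rw [Finset.sum_eq_single 0 (by intro t _ ht; simp [ht]) (by simp [hI])]
    simp
  simp only [d, sub_mul, Finset.sum_sub_distrib]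
  rw [h2, h3, Finset.sum_mul, ← Finset.sum_sub_distrib]
  exact Finset.sum_congr rfl fun t _ ↦ by ring

/-- The increment of `B` from `0` to `t`, as an element of `L²(P)`. -/
noncomputable def incrLp (hB : IsTwoSidedBrownian B P) (t : ℝ) : Lp ℝ 2 P :=
  (hB.hasGaussianLaw_sub 0 t).memLp_two.toLp

theorem coe_incrLp (hB : IsTwoSidedBrownian B P) (t : ℝ) :
    hB.incrLp t =ᵐ[P] fun ω ↦ B t ω - B 0 ω :=
  MemLp.coeFn_toLp (hB.hasGaussianLaw_sub 0 t).memLp_two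

theorem coe_incrLp_sub (hB : IsTwoSidedBrownian B P) (s t : ℝ) :
    (hB.incrLp t - hB.incrLp s : Lp ℝ 2 P) =ᵐ[P] fun ω ↦ B t ω - B s ω := by
  filter_upwards [hB.coe_incrLp s, hB.coe_incrLp t, Lp.coeFn_sub (hB.incrLp t) (hB.incrLp s)]
    with ω h1 h2 h3
  rw [h3, Pi.sub_apply, h1, h2]
  ring

theorem norm_incrLp_sub_sq (hB : IsTwoSidedBrownian B P) (s t : ℝ) :
    ‖hB.incrLp s - hB.incrLp t‖ ^ 2 = |s - t| := by
  rw [← hB.integral_sub_sq, norm_sub_rev, ← real_inner_self_eq_norm_sq, L2.inner_def]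
  refine integral_congr_ae ?_
  filter_upwards [hB.coe_incrLp_sub s t] with ω hω
  rw [hω]
  simp [sq]

theorem incrLp_zero (hB : IsTwoSidedBrownian B P) : hB.incrLp 0 = 0 := by
  apply Lp.ext
  filter_upwards [hB.coe_incrLp 0, Lp.coeFn_zero ℝ 2 P] with ω h1 h2
  rw [h1, h2, sub_self, Pi.zero_apply]

theorem coe_linearCombination_incrLp (hB : IsTwoSidedBrownian B P) (c : ℝ →₀ ℝ) :
    Finsupp.linearCombination ℝ hB.incrLp c =ᵐ[P]
      fun ω ↦ ∑ t ∈ c.support, c t * (B t ω - B 0 ω) := by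
  rw [Finsupp.linearCombination_apply, Finsupp.sum]
  have h1 : ∀ᵐ ω ∂P, ∀ t ∈ c.support, hB.incrLp t ω = B t ω - B 0 ω :=
    (Finset.eventually_all c.support).2 fun t _ ↦ hB.coe_incrLp t
  have h2 : ∀ᵐ ω ∂P, ∀ t ∈ c.support, (c t • hB.incrLp t : Lp ℝ 2 P) ω = c t * hB.incrLp t ω :=
    (Finset.eventually_all c.support).2 fun t _ ↦ Lp.coeFn_smul _ _
  filter_upwards [h1, h2, Lp.coeFn_finsetSum c.support fun t ↦ c t • hB.incrLp t] with ω g1 g2 g3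
  rw [g3, Finset.sum_apply]
  exact Finset.sum_congr rfl fun t ht ↦ by rw [g2 t ht, g1 t ht]

theorem exists_isIsonormal [IsProbabilityMeasure P] (hB : IsTwoSidedBrownian B P) :
    ∃ W : Lp ℝ 2 (volume : Measure ℝ) →ₗᵢ[ℝ] Lp ℝ 2 P, IsIsonormal W ∧
      ∀ l r, l ≤ r → W (iocLp l r) =ᵐ[P] fun ω ↦ B r ω - B l ω := by
  obtain ⟨W, hW⟩ := exists_linearIsometry (v := hB.incrLp) denseRange_signedLp fun s t ↦ by
    rw [inner_eq_of_norm_sub signedLp_zero, inner_eq_of_norm_sub hB.incrLp_zero]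
    simp only [norm_signedLp_sub_sq, hB.norm_incrLp_sub_sq]
  refine ⟨W, isIsonormal_of_denseRange denseRange_signedLp W hW (fun c ↦ ?_) (fun c ↦ ?_), ?_⟩
  · exact (hB.hasGaussianLaw_sum c).congr (hB.coe_linearCombination_incrLp c).symm
  · rw [integral_congr_ae (hB.coe_linearCombination_incrLp c), integral_finsetSum _ fun t _ ↦
      ((hB.hasGaussianLaw_sub 0 t).integrable).const_mul _]
    refine Finset.sum_eq_zero fun t _ ↦ ?_
    rw [integral_const_mul, hB.integral_sub_eq_zero, mul_zero]
  · intro l r hlr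
    rw [← signedLp_sub hlr, map_sub, hW, hW]
    exact hB.coe_incrLp_sub l r

end IsTwoSidedBrownian

end BaiTaqqu

namespace BaiTaqqu

/-! ### Tensor products in `L²(ℝ²)` and the double Wiener–Itô integral -/

theorem MemLp.mul_prod_two {f g : ℝ → ℝ} (hf : MemLp f 2 volume) (hg : MemLp g 2 volume) :
    MemLp (fun x : ℝ × ℝ ↦ f x.1 * g x.2) 2 (volume : Measure (ℝ × ℝ)) := by
  have hm : AEStronglyMeasurable (fun x : ℝ × ℝ ↦ f x.1 * g x.2) (volume : Measure (ℝ × ℝ)) := by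
    rw [Measure.volume_eq_prod]
    exact hf.1.comp_fst.mul hg.1.comp_snd
  rw [memLp_two_iff_integrable_sq hm]
  have := hf.integrable_sq.mul_prod hg.integrable_sq
  rw [← Measure.volume_eq_prod] at this
  simpa only [mul_pow] using this

/-- The tensor product of two elements of `L²(ℝ)`. -/
noncomputable def tensorLp (h k : Lp ℝ 2 (volume : Measure ℝ)) :
    Lp ℝ 2 (volume : Measure (ℝ × ℝ)) :=
  (MemLp.mul_prod_two (Lp.memLp h) (Lp.memLp k)).toLp

theorem coe_tensorLp (h k : Lp ℝ 2 (volume : Measure ℝ)) :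
    tensorLp h k =ᵐ[volume] fun x ↦ h x.1 * k x.2 :=
  MemLp.coeFn_toLp (MemLp.mul_prod_two (Lp.memLp h) (Lp.memLp k))

theorem ae_comp_fst_snd {f f' g g' : ℝ → ℝ} (hf : f =ᵐ[volume] f') (hg : g =ᵐ[volume] g') :
    (fun x : ℝ × ℝ ↦ f x.1 * g x.2) =ᵐ[volume] fun x ↦ f' x.1 * g' x.2 := by
  rw [Measure.volume_eq_prod]
  filter_upwards [Measure.quasiMeasurePreserving_fst.ae_eq_comp hf,
    Measure.quasiMeasurePreserving_snd.ae_eq_comp hg] with x h1 h2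
  simp only [Function.comp_apply] at h1 h2
  rw [h1, h2]

theorem inner_tensorLp_tensorLp (a b c d : Lp ℝ 2 (volume : Measure ℝ)) :
    ⟪tensorLp a b, tensorLp c d⟫ = ⟪a, c⟫ * ⟪b, d⟫ := by
  rw [L2.inner_def, L2.inner_def, L2.inner_def, ← integral_prod_mul, ← Measure.volume_eq_prod]
  refine integral_congr_ae ?_
  filter_upwards [coe_tensorLp a b, coe_tensorLp c d] with x h1 h2
  rw [h1, h2]
  simp only [RCLike.inner_apply, conj_trivial]
  ring

theorem coe_tensorLp_iocLp (l₁ r₁ l₂ r₂ : ℝ) : tensorLp (iocLp l₁ r₁) (iocLp l₂ r₂) =ᵐ[volume]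
    (Ioc l₁ r₁ ×ˢ Ioc l₂ r₂).indicator fun _ ↦ (1 : ℝ) := by
  filter_upwards [coe_tensorLp (iocLp l₁ r₁) (iocLp l₂ r₂),
    ae_comp_fst_snd (coe_iocLp l₁ r₁) (coe_iocLp l₂ r₂)] with x h1 h2
  rw [h1, h2]
  simp only [indicator, mem_prod]
  split_ifs <;> simp_all

/-- An elementary function as an element of `L²(ℝ²)`. -/
noncomputable def Elementary.toLp : Elementary →ₗ[ℝ] Lp ℝ 2 (volume : Measure (ℝ × ℝ)) :=
  Finsupp.linearCombination ℝ fun R ↦ tensorLp (iocLp R.l₁ R.r₁) (iocLp R.l₂ R.r₂)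

theorem coe_linearCombination_ae {ι α : Type*} [MeasurableSpace α] {μ : Measure α}
    {u : ι → Lp ℝ 2 μ} {v : ι → α → ℝ} (h : ∀ i, u i =ᵐ[μ] v i) (c : ι →₀ ℝ) :
    Finsupp.linearCombination ℝ u c =ᵐ[μ] fun x ↦ c.sum fun i a ↦ a * v i x := by
  rw [Finsupp.linearCombination_apply, Finsupp.sum]
  have h1 : ∀ᵐ x ∂μ, ∀ i ∈ c.support, u i x = v i x :=
    (Finset.eventually_all c.support).2 fun i _ ↦ h i
  have h2 : ∀ᵐ x ∂μ, ∀ i ∈ c.support, (c i • u i : Lp ℝ 2 μ) x = c i * u i x :=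
    (Finset.eventually_all c.support).2 fun i _ ↦ Lp.coeFn_smul _ _
  filter_upwards [h1, h2, Lp.coeFn_finsetSum c.support fun i ↦ c i • u i] with x g1 g2 g3
  rw [g3, Finset.sum_apply, Finsupp.sum]
  exact Finset.sum_congr rfl fun i hi ↦ by rw [g2 i hi, g1 i hi]

theorem Elementary.coe_toLp (g : Elementary) : Elementary.toLp g =ᵐ[volume] g.eval :=
  coe_linearCombination_ae (fun _ ↦ coe_tensorLp_iocLp _ _ _ _) g

theorem denseRange_elementary : DenseRange Elementary.toLp := by
  refine denseRange_of_inner_eq_zero _ fun x hx ↦ ?_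
  refine (Lp.eq_zero_iff_ae_eq_zero).2 (ae_eq_zero_of_forall_offDiag (Lp.memLp x) fun R ↦ ?_)
  have h1 := hx (Finsupp.single R 1)
  rw [Elementary.toLp, Finsupp.linearCombination_single, one_smul, L2.inner_def] at h1
  rw [← h1, ← integral_indicator (measurableSet_Ioc.prod measurableSet_Ioc)]
  refine integral_congr_ae ?_
  filter_upwards [coe_tensorLp_iocLp R.l₁ R.r₁ R.l₂ R.r₂] with y hy
  rw [hy]
  simp only [indicator]
  split_ifs <;> simp

theorem isTensor_tensorLp : IsTensor tensorLp := by
  refine ⟨inner_tensorLp_tensorLp, denseRange_elementary.mono ?_⟩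
  rintro _ ⟨g, rfl⟩
  induction g using Finsupp.induction_linear with
  | zero => exact ⟨0, by simp⟩
  | add f g hf hg =>
    obtain ⟨c, hc⟩ := hf
    obtain ⟨d, hd⟩ := hg
    exact ⟨c + d, by rw [map_add, map_add, hc, hd]⟩
  | single R a =>
    exact ⟨Finsupp.single (iocLp R.l₁ R.r₁, iocLp R.l₂ R.r₂) a, by simp [Elementary.toLp]⟩

theorem inner_iocLp_iocLp_of_le {a b c d : ℝ} (h : b ≤ c ∨ d ≤ a) :
    ⟪iocLp a b, iocLp c d⟫ = 0 := by
  rw [inner_iocLp, setIntegral_congr_ae measurableSet_Ioc (g := fun _ ↦ (0 : ℝ)) (by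
    filter_upwards [coe_iocLp c d] with x hx hm
    rw [hx, indicator_of_notMem]
    intro hm'
    rcases h with h | h
    · exact absurd (hm.2.trans h) (not_le.2 hm'.1)
    · exact absurd (hm'.2.trans h) (not_le.2 hm.1))]
  simp

variable {Ω : Type*} [MeasurableSpace Ω] {P : Measure Ω} {B : ℝ → Ω → ℝ}
  {W : Lp ℝ 2 (volume : Measure ℝ) →ₗᵢ[ℝ] Lp ℝ 2 P}

/-- The sides of an off-diagonal rectangle are disjoint, so the centring term vanishes and the plain
product of increments remains. -/
theorem IsIsonormal.chaos_elementary (hW : IsIsonormal W)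
    (hWB : ∀ l r, l ≤ r → W (iocLp l r) =ᵐ[P] fun ω ↦ B r ω - B l ω) (g : Elementary) :
    hW.chaos tensorLp (Elementary.toLp g) =ᵐ[P] g.integral B := by
  have e : hW.chaos tensorLp (Elementary.toLp g) = Finsupp.linearCombination ℝ
      (fun R : OffDiagRect ↦ hW.wick (iocLp R.l₁ R.r₁) (iocLp R.l₂ R.r₂)) g := by
    simp only [Elementary.toLp, Finsupp.linearCombination_apply, Finsupp.sum, map_sum, map_smul,
      hW.chaos_apply isTensor_tensorLp]
  rw [e]
  refine coe_linearCombination_ae (fun R ↦ ?_) g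
  filter_upwards [hW.coe_wick (iocLp R.l₁ R.r₁) (iocLp R.l₂ R.r₂), hWB _ _ R.le₁, hWB _ _ R.le₂]
    with ω h1 h2 h3
  rw [h1, h2, h3, inner_iocLp_iocLp_of_le R.disj, sub_zero]

theorem tendsto_toLp_iff {α : Type*} [MeasurableSpace α] {μ : Measure α} {f : α → ℝ}
    (hf : MemLp f 2 μ) {x : ℕ → Lp ℝ 2 μ} {y : ℕ → α → ℝ} (hxy : ∀ n, x n =ᵐ[μ] y n) :
    Tendsto x atTop (𝓝 hf.toLp) ↔
      Tendsto (fun n ↦ eLpNorm (fun a ↦ f a - y n a) 2 μ) atTop (𝓝 0) := by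
  rw [Lp.tendsto_Lp_iff_tendsto_eLpNorm']
  refine tendsto_congr fun n ↦ ?_
  rw [eLpNorm_sub_comm]
  refine eLpNorm_congr_ae ?_
  filter_upwards [hf.coeFn_toLp, hxy n] with a h1 h2
  rw [Pi.sub_apply, h1, h2]

theorem IsIsonormal.isDoubleWienerIto_chaos (hW : IsIsonormal W)
    (hWB : ∀ l r, l ≤ r → W (iocLp l r) =ᵐ[P] fun ω ↦ B r ω - B l ω) {f : ℝ × ℝ → ℝ}
    (hf : MemLp f 2 volume) : IsDoubleWienerIto B P f (hW.chaos tensorLp hf.toLp) := by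
  obtain ⟨x, hx, hlim⟩ := mem_closure_iff_seq_limit.1 (denseRange_elementary hf.toLp)
  choose g hg using hx
  obtain rfl : (fun n ↦ Elementary.toLp (g n)) = x := funext hg
  refine ⟨hf, Lp.memLp _, g, ?_, ?_⟩
  · exact (tendsto_toLp_iff hf fun n ↦ Elementary.coe_toLp (g n)).1 hlim
  · refine (tendsto_toLp_iff (Lp.memLp (hW.chaos tensorLp hf.toLp))
      fun n ↦ hW.chaos_elementary hWB (g n)).1 ?_
    rw [Lp.toLp_coeFn]
    exact ((hW.chaos tensorLp).continuous.tendsto _).comp hlim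

/-- By continuity of `chaos` every approximating sequence has the same limit, so the choice made in
`doubleWienerIto` is immaterial up to null sets. -/
theorem IsIsonormal.ae_eq_chaos (hW : IsIsonormal W)
    (hWB : ∀ l r, l ≤ r → W (iocLp l r) =ᵐ[P] fun ω ↦ B r ω - B l ω) {f : ℝ × ℝ → ℝ}
    (hf : MemLp f 2 volume) {Z : Ω → ℝ} (hZ : IsDoubleWienerIto B P f Z) :
    Z =ᵐ[P] hW.chaos tensorLp hf.toLp := by
  obtain ⟨-, hZ2, g, h1, h2⟩ := hZ
  have h1' := (tendsto_toLp_iff hf fun n ↦ Elementary.coe_toLp (g n)).2 h1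
  have h2' := (tendsto_toLp_iff hZ2 fun n ↦ hW.chaos_elementary hWB (g n)).2 h2
  have h3 := ((hW.chaos tensorLp).continuous.tendsto _).comp h1'
  rw [← tendsto_nhds_unique h2' h3]
  exact hZ2.coeFn_toLp.symm

theorem IsIsonormal.doubleWienerIto_ae_eq (hW : IsIsonormal W)
    (hWB : ∀ l r, l ≤ r → W (iocLp l r) =ᵐ[P] fun ω ↦ B r ω - B l ω) {f : ℝ × ℝ → ℝ}
    (hf : MemLp f 2 volume) : doubleWienerIto B P f =ᵐ[P] hW.chaos tensorLp hf.toLp := by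
  have h : ∃ Z, IsDoubleWienerIto B P f Z := ⟨_, hW.isDoubleWienerIto_chaos hWB hf⟩
  rw [doubleWienerIto, dif_pos h]
  exact hW.ae_eq_chaos hWB hf h.choose_spec

end BaiTaqqu

namespace BaiTaqqu

/-! ### Power tails -/

/-- The function `(-x)^a` on `(-∞, -1)`, extended by zero. -/
noncomputable def powTail (a x : ℝ) : ℝ := (Ioi (1 : ℝ)).indicator (fun t ↦ t ^ a) (-x)

theorem powTail_of_lt {a x : ℝ} (hx : x < -1) : powTail a x = (-x) ^ a :=
  indicator_of_mem (by simp only [mem_Ioi]; linarith) _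

theorem powTail_of_le {a x : ℝ} (hx : -1 ≤ x) : powTail a x = 0 :=
  indicator_of_notMem (by simp only [mem_Ioi]; linarith) _

theorem powTail_nonneg (a x : ℝ) : 0 ≤ powTail a x :=
  indicator_nonneg (fun t (ht : 1 < t) ↦ Real.rpow_nonneg (by linarith) _) _

theorem powTail_mul (a b x : ℝ) : powTail a x * powTail b x = powTail (a + b) x := by
  rcases lt_or_ge x (-1) with h | h
  · rw [powTail_of_lt h, powTail_of_lt h, powTail_of_lt h, Real.rpow_add (by linarith)]
  · rw [powTail_of_le h, powTail_of_le h, powTail_of_le h, zero_mul]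

theorem measurable_powTail (a : ℝ) : Measurable (powTail a) := by
  unfold powTail
  exact (((measurable_id.pow_const a).indicator measurableSet_Ioi)).comp measurable_neg

theorem integrable_powTail {a : ℝ} (ha : a < -1) : Integrable (powTail a) :=
  ((integrable_indicator_iff measurableSet_Ioi).2
    (integrableOn_Ioi_rpow_of_lt ha one_pos)).comp_neg

theorem integral_powTail {a : ℝ} (ha : a < -1) : ∫ x, powTail a x = -1 / (a + 1) := by
  unfold powTail
  rw [integral_neg_eq_self, integral_indicator measurableSet_Ioi,
    integral_Ioi_rpow_of_lt ha one_pos, Real.one_rpow]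

theorem memLp_powTail {a : ℝ} (ha : a < -1 / 2) : MemLp (powTail a) 2 volume := by
  rw [memLp_two_iff_integrable_sq (measurable_powTail a).aestronglyMeasurable]
  simp only [sq, powTail_mul]
  exact integrable_powTail (by linarith)

open Classical in
/-- The power tail of exponent `a < -1/2` as an element of `L²(ℝ)`. -/
noncomputable def tailLp (a : ℝ) : Lp ℝ 2 (volume : Measure ℝ) :=
  if ha : a < -1 / 2 then (memLp_powTail ha).toLp else 0

theorem coe_tailLp {a : ℝ} (ha : a < -1 / 2) : tailLp a =ᵐ[volume] powTail a := by
  rw [tailLp, dif_pos ha]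
  exact (memLp_powTail ha).coeFn_toLp

theorem inner_tailLp {a b : ℝ} (ha : a < -1 / 2) (hb : b < -1 / 2) :
    ⟪tailLp a, tailLp b⟫ = -1 / (a + b + 1) := by
  rw [← integral_powTail (by linarith : a + b < -1), L2.inner_def]
  refine integral_congr_ae ?_
  filter_upwards [coe_tailLp ha, coe_tailLp hb] with x h1 h2
  rw [h1, h2, ← powTail_mul]
  simp [mul_comm]

theorem norm_tailLp_sq {a : ℝ} (ha : a < -1 / 2) : ‖tailLp a‖ ^ 2 = -1 / (2 * a + 1) := by
  rw [← real_inner_self_eq_norm_sq, inner_tailLp ha ha]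
  ring_nf

/-! ### Integrals of truncated powers -/

theorem max_zero_rpow {a u : ℝ} (ha : a ≠ 0) (hu : u ≤ 0) : max u 0 ^ a = 0 := by
  rw [max_eq_right hu, Real.zero_rpow ha]

theorem max_zero_rpow_nonneg (a u : ℝ) : 0 ≤ max u 0 ^ a := Real.rpow_nonneg (le_max_right _ _) _

theorem measurable_max_zero_rpow (a : ℝ) : Measurable fun u : ℝ ↦ max u 0 ^ a := by fun_prop

theorem intervalIntegrable_max_zero_rpow {a : ℝ} (ha : -1 < a) (ha0 : a ≠ 0) (c d : ℝ) :
    IntervalIntegrable (fun u : ℝ ↦ max u 0 ^ a) volume c d := by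
  refine (intervalIntegral.intervalIntegrable_rpow' (a := c) (b := d) ha).mono_fun
    (measurable_max_zero_rpow a).aestronglyMeasurable (ae_of_all _ fun u ↦ ?_)
  simp only
  rcases le_or_gt u 0 with h | h
  · rw [max_zero_rpow ha0 h, norm_zero]
    exact norm_nonneg _
  · rw [max_eq_left h.le]

theorem intervalIntegrable_max_sub_rpow {a : ℝ} (ha : -1 < a) (ha0 : a ≠ 0) (x : ℝ) :
    IntervalIntegrable (fun s : ℝ ↦ max (s - x) 0 ^ a) volume 0 1 := by
  have := (intervalIntegrable_max_zero_rpow ha ha0 (0 - x) (1 - x)).comp_sub_right x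
  simpa using this

theorem integral_max_sub_rpow_le {a : ℝ} (ha : -1 < a) (ha0 : a < 0) {x : ℝ} (hx : x ∈ Icc (-1) 1) :
    ∫ s in (0 : ℝ)..1, max (s - x) 0 ^ a ≤ 2 / (a + 1) := by
  have hI := fun c d ↦ intervalIntegrable_max_zero_rpow ha ha0.ne c d
  rw [intervalIntegral.integral_comp_sub_right (fun u : ℝ ↦ max u 0 ^ a) x]
  calc ∫ u in (0 - x)..(1 - x), max u 0 ^ a ≤ ∫ u in (-1 : ℝ)..2, max u 0 ^ a := by
        refine intervalIntegral.integral_mono_interval (by linarith [hx.2]) (by linarith)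
          (by linarith [hx.1]) (ae_of_all _ fun u ↦ max_zero_rpow_nonneg a u) (hI _ _)
    _ = (∫ u in (-1 : ℝ)..0, max u 0 ^ a) + ∫ u in (0 : ℝ)..2, max u 0 ^ a :=
        (intervalIntegral.integral_add_adjacent_intervals (hI _ _) (hI _ _)).symm
    _ = 0 + ∫ u in (0 : ℝ)..2, u ^ a := by
        congr 1
        · refine (intervalIntegral.integral_congr (g := fun _ ↦ (0 : ℝ)) fun u hu ↦ ?_).trans (by simp)
          rw [uIcc_of_le (by norm_num)] at hu
          exact max_zero_rpow ha0.ne hu.2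
        · refine intervalIntegral.integral_congr fun u hu ↦ ?_
          rw [uIcc_of_le (by norm_num)] at hu
          simp only [max_eq_left hu.1]
    _ = 2 ^ (a + 1) / (a + 1) := by
        rw [integral_rpow (Or.inl ha), Real.zero_rpow (by linarith)]
        simp
    _ ≤ 2 / (a + 1) := by
        have : (2 : ℝ) ^ (a + 1) ≤ 2 ^ (1 : ℝ) :=
          Real.rpow_le_rpow_of_exponent_le (by norm_num) (by linarith)
        rw [Real.rpow_one] at this
        exact div_le_div_of_nonneg_right this (by linarith)

/-! ### Pointwise bounds for the kernel -/

/-- The indicator function of `[-1, 1]`. -/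
noncomputable def unitBump (x : ℝ) : ℝ := (Icc (-1 : ℝ) 1).indicator (fun _ ↦ 1) x

/-- An integrable majorant of the kernel near the diagonal. -/
noncomputable def diagBump (x : ℝ × ℝ) : ℝ :=
  unitBump x.1 * unitBump x.2 * |x.1 - x.2| ^ (-1 / 8 : ℝ)

theorem unitBump_nonneg (x : ℝ) : 0 ≤ unitBump x := indicator_nonneg (fun _ _ ↦ zero_le_one) _

theorem unitBump_of_mem {x : ℝ} (hx : x ∈ Icc (-1 : ℝ) 1) : unitBump x = 1 := indicator_of_mem hx _

theorem diagBump_nonneg (x : ℝ × ℝ) : 0 ≤ diagBump x :=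
  mul_nonneg (mul_nonneg (unitBump_nonneg _) (unitBump_nonneg _)) (Real.rpow_nonneg (abs_nonneg _) _)

theorem kernel_swap (γ₁ γ₂ x y : ℝ) : kernel γ₁ γ₂ (x, y) = kernel γ₂ γ₁ (y, x) := by
  simp only [kernel, mul_comm]

theorem kernel_eq_zero {γ₁ γ₂ x y : ℝ} (h1 : γ₁ ≠ 0) (hx : 1 ≤ x) : kernel γ₁ γ₂ (x, y) = 0 := by
  rw [kernel, intervalIntegral.integral_congr (g := fun _ ↦ (0 : ℝ)), intervalIntegral.integral_zero]
  intro s hs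
  rw [uIcc_of_le zero_le_one] at hs
  simp only
  rw [max_zero_rpow h1 (by linarith [hs.2]), zero_mul]

/-- Replacing s - x by -x costs a relative error of at most 1/(-x). The extra power keeps that
factor of the error bounded in L² as the exponents tend to -1/2. -/
theorem abs_kernel_sub_le_of_lt {γ₁ γ₂ x y : ℝ} (h1 : γ₁ ∈ Icc (-1) 0) (h2 : γ₂ ∈ Icc (-1) 0)
    (hx : x < -1) (hy : y < -1) :
    |kernel γ₁ γ₂ (x, y) - (-x) ^ γ₁ * (-y) ^ γ₂| ≤
      (-x) ^ (γ₁ - 1) * (-y) ^ γ₂ + (-x) ^ γ₁ * (-y) ^ (γ₂ - 1) := by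
  -- The lower bound comes from (1+u)^γ ≥ (1+u)⁻¹ ≥ 1 - u with u = s/(-z), where γ ≥ -1 is needed.
  have key : ∀ {γ z s : ℝ}, γ ∈ Icc (-1) 0 → z < -1 → s ∈ Icc (0 : ℝ) 1 →
      max (s - z) 0 ^ γ ≤ (-z) ^ γ ∧ (-z) ^ γ - (-z) ^ (γ - 1) ≤ max (s - z) 0 ^ γ := by
    intro γ z s hγ hz hs
    have hpos : 0 < -z := by linarith
    have hsz : 0 < s - z := by linarith [hs.1]
    rw [max_eq_left hsz.le]
    refine ⟨Real.rpow_le_rpow_of_nonpos hpos (by linarith [hs.1]) hγ.2, ?_⟩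
    have e1 : (-z) ^ γ - (-z) ^ (γ - 1) = (-z) ^ γ * (1 - (-z)⁻¹) := by
      rw [Real.rpow_sub hpos, Real.rpow_one]; ring
    have e2 : s - z = (-z) * (1 + s / (-z)) := by
      rw [mul_add, mul_one, mul_div_cancel₀ _ hpos.ne']; ring
    have hq : 0 ≤ s / (-z) := div_nonneg hs.1 hpos.le
    have hq1 : s / (-z) ≤ (-z)⁻¹ := by
      rw [div_eq_mul_inv]
      exact mul_le_of_le_one_left (by positivity) hs.2
    rw [e1, e2, Real.mul_rpow hpos.le (by linarith)]
    refine mul_le_mul_of_nonneg_left ?_ (Real.rpow_nonneg hpos.le _)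
    calc 1 - (-z)⁻¹ ≤ 1 - s / (-z) := by linarith
      _ ≤ (1 + s / (-z))⁻¹ := by
          rw [inv_eq_one_div, le_div_iff₀ (by linarith)]
          nlinarith
      _ = (1 + s / (-z)) ^ (-1 : ℝ) := (Real.rpow_neg_one _).symm
      _ ≤ _ := Real.rpow_le_rpow_of_exponent_le (by linarith) hγ.1
  have hcont : ∀ {γ z : ℝ}, z < -1 → ContinuousOn (fun s : ℝ ↦ max (s - z) 0 ^ γ) (uIcc 0 1) := by
    intro γ z hz
    refine ContinuousOn.rpow_const (by fun_prop) fun s hs ↦ Or.inl ?_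
    rw [uIcc_of_le zero_le_one] at hs
    rw [max_eq_left (by linarith [hs.1])]
    linarith [hs.1]
  have hI : IntervalIntegrable (fun s ↦ max (s - x) 0 ^ γ₁ * max (s - y) 0 ^ γ₂) volume 0 1 :=
    ((hcont hx).mul (hcont hy)).intervalIntegrable
  have e : kernel γ₁ γ₂ (x, y) - (-x) ^ γ₁ * (-y) ^ γ₂ =
      ∫ s in (0 : ℝ)..1, (max (s - x) 0 ^ γ₁ * max (s - y) 0 ^ γ₂ - (-x) ^ γ₁ * (-y) ^ γ₂) := by
    rw [intervalIntegral.integral_sub hI (by simp)]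
    simp [kernel]
  rw [e, ← Real.norm_eq_abs]
  refine (intervalIntegral.norm_integral_le_of_norm_le_const (C := (-x) ^ (γ₁ - 1) * (-y) ^ γ₂ +
    (-x) ^ γ₁ * (-y) ^ (γ₂ - 1)) fun s hs ↦ ?_).trans (by simp)
  rw [uIoc_of_le zero_le_one] at hs
  obtain ⟨a1, a2⟩ := key h1 hx ⟨hs.1.le, hs.2⟩
  obtain ⟨b1, b2⟩ := key h2 hy ⟨hs.1.le, hs.2⟩
  have p1 := max_zero_rpow_nonneg γ₁ (s - x)
  have p2 := max_zero_rpow_nonneg γ₂ (s - y)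
  have p3 : 0 ≤ (-x) ^ (γ₁ - 1) := Real.rpow_nonneg (by linarith) _
  have p4 : 0 ≤ (-y) ^ (γ₂ - 1) := Real.rpow_nonneg (by linarith) _
  rw [Real.norm_eq_abs, abs_le]
  constructor <;> nlinarith

/-- The factor in `y` is at most its value at s = 0, and the other one integrates to at most
2/(15/32) < 5. -/
theorem abs_kernel_le_of_le_of_lt {γ₁ γ₂ x y : ℝ} (h1 : γ₁ ∈ Icc (-17 / 32) (-1 / 2))
    (h2 : γ₂ ≤ 0) (hx : -1 ≤ x) (hy : y < -1) :
    |kernel γ₁ γ₂ (x, y)| ≤ 5 * (unitBump x * (-y) ^ γ₂) := by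
  have hy0 : 0 ≤ (-y) ^ γ₂ := Real.rpow_nonneg (by linarith) _
  rcases le_or_gt 1 x with h | h
  · rw [kernel_eq_zero (by linarith [h1.2]) h, abs_zero]
    exact mul_nonneg (by norm_num) (mul_nonneg (unitBump_nonneg _) hy0)
  · have hm : x ∈ Icc (-1 : ℝ) 1 := ⟨hx, h.le⟩
    have ha : -1 < γ₁ := by linarith [h1.1]
    have ha0 : γ₁ < 0 := by linarith [h1.2]
    rw [unitBump_of_mem hm, one_mul, kernel, ← Real.norm_eq_abs]
    refine (intervalIntegral.norm_integral_le_of_norm_le (g := fun s ↦ max (s - x) 0 ^ γ₁ * (-y) ^ γ₂)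
      zero_le_one (ae_of_all _ fun s hs ↦ ?_)
      ((intervalIntegrable_max_sub_rpow ha ha0.ne x).mul_const _)).trans ?_
    · rw [Real.norm_eq_abs, abs_of_nonneg
        (mul_nonneg (max_zero_rpow_nonneg _ _) (max_zero_rpow_nonneg _ _))]
      refine mul_le_mul_of_nonneg_left ?_ (max_zero_rpow_nonneg _ _)
      simp only
      rw [max_eq_left (by linarith [hs.1])]
      exact Real.rpow_le_rpow_of_nonpos (by linarith) (by linarith [hs.1]) h2
    · rw [intervalIntegral.integral_mul_const]
      refine mul_le_mul_of_nonneg_right ((integral_max_sub_rpow_le ha ha0 hm).trans ?_) hy0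
      rw [div_le_iff₀ (by linarith)]
      linarith [h1.1]

/-- The integral over `s` may diverge as x → y, since γ₁ + γ₂ can be at most -1. Trading (s -
x)^(-1/8) for (y - x)^(-1/8) leaves a total exponent of at least -15/16, whence 32 = 2/(1/16). -/
theorem abs_kernel_le_of_lt_of_mem {γ₁ γ₂ x y : ℝ} (h1 : γ₁ ∈ Icc (-17 / 32) (-1 / 2))
    (h2 : γ₂ ∈ Icc (-17 / 32) (-1 / 2)) (hx : x ∈ Icc (-1 : ℝ) 1) (hy : y ∈ Icc (-1 : ℝ) 1)
    (hxy : x < y) : |kernel γ₁ γ₂ (x, y)| ≤ 32 * diagBump (x, y) := by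
  have ha : -1 < γ₁ + γ₂ + 1 / 8 := by linarith [h1.1, h2.1]
  have ha0 : γ₁ + γ₂ + 1 / 8 < 0 := by linarith [h1.2, h2.2]
  have hd : 0 < y - x := by linarith
  have hd0 : 0 ≤ (y - x) ^ (-1 / 8 : ℝ) := Real.rpow_nonneg hd.le _
  have hbump : diagBump (x, y) = (y - x) ^ (-1 / 8 : ℝ) := by
    rw [diagBump, unitBump_of_mem hx, unitBump_of_mem hy, abs_sub_comm, abs_of_pos hd]
    ring
  rw [hbump, kernel, ← Real.norm_eq_abs]
  refine (intervalIntegral.norm_integral_le_of_norm_le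
    (g := fun s ↦ (y - x) ^ (-1 / 8 : ℝ) * max (s - y) 0 ^ (γ₁ + γ₂ + 1 / 8))
    zero_le_one (ae_of_all _ fun s hs ↦ ?_)
    ((intervalIntegrable_max_sub_rpow ha ha0.ne y).const_mul _)).trans ?_
  · rw [Real.norm_eq_abs, abs_of_nonneg
      (mul_nonneg (max_zero_rpow_nonneg _ _) (max_zero_rpow_nonneg _ _))]
    simp only
    rcases le_or_gt s y with h | h
    · rw [max_zero_rpow (by linarith [h2.2]) (sub_nonpos.2 h), mul_zero]
      exact mul_nonneg hd0 (max_zero_rpow_nonneg _ _)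
    · have hsy : 0 < s - y := by linarith
      have hsx : 0 < s - x := by linarith
      rw [max_eq_left hsy.le, max_eq_left hsx.le]
      calc (s - x) ^ γ₁ * (s - y) ^ γ₂
          = (s - x) ^ (-1 / 8 : ℝ) * (s - x) ^ (γ₁ + 1 / 8) * (s - y) ^ γ₂ := by
            rw [← Real.rpow_add hsx]; ring_nf
        _ ≤ (y - x) ^ (-1 / 8 : ℝ) * (s - y) ^ (γ₁ + 1 / 8) * (s - y) ^ γ₂ := by
            refine mul_le_mul_of_nonneg_right (mul_le_mul ?_ ?_ (Real.rpow_nonneg hsx.le _) hd0)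
              (Real.rpow_nonneg hsy.le _)
            · exact Real.rpow_le_rpow_of_nonpos hd (by linarith) (by norm_num)
            · exact Real.rpow_le_rpow_of_nonpos hsy (by linarith) (by linarith [h1.2])
        _ = _ := by
            rw [mul_assoc, ← Real.rpow_add hsy]; ring_nf
  · rw [intervalIntegral.integral_const_mul, mul_comm]
    refine mul_le_mul_of_nonneg_right ((integral_max_sub_rpow_le ha ha0 hy).trans ?_) hd0
    rw [div_le_iff₀ (by linarith)]
    linarith [h1.1, h2.1]

/-- The majorant of the difference between the kernel and the tensor product of its tails. -/
noncomputable def kernelBound (γ₁ γ₂ : ℝ) (x : ℝ × ℝ) : ℝ :=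
  powTail (γ₁ - 1) x.1 * powTail γ₂ x.2 + powTail γ₁ x.1 * powTail (γ₂ - 1) x.2 +
    5 * (unitBump x.1 * powTail γ₂ x.2) + 5 * (powTail γ₁ x.1 * unitBump x.2) + 32 * diagBump x

theorem abs_kernel_sub_le {γ₁ γ₂ : ℝ} (h1 : γ₁ ∈ Icc (-17 / 32) (-1 / 2))
    (h2 : γ₂ ∈ Icc (-17 / 32) (-1 / 2)) {x : ℝ × ℝ} (hx : x.1 ≠ x.2) :
    |kernel γ₁ γ₂ x - powTail γ₁ x.1 * powTail γ₂ x.2| ≤ kernelBound γ₁ γ₂ x := by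
  obtain ⟨x, y⟩ := x
  simp only [kernelBound] at hx ⊢
  have q1 := unitBump_nonneg x
  have q2 := unitBump_nonneg y
  have q3 := diagBump_nonneg (x, y)
  have q4 := fun a z ↦ powTail_nonneg a z
  rcases lt_or_ge x (-1) with hx1 | hx1
  · rcases lt_or_ge y (-1) with hy1 | hy1
    · have := abs_kernel_sub_le_of_lt (γ₁ := γ₁) (γ₂ := γ₂) ⟨by linarith [h1.1], by linarith [h1.2]⟩
        ⟨by linarith [h2.1], by linarith [h2.2]⟩ hx1 hy1
      have r1 := mul_nonneg q1 (q4 γ₂ y)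
      have r2 := mul_nonneg (q4 γ₁ x) q2
      simp only [powTail_of_lt hx1, powTail_of_lt hy1] at r1 r2 ⊢
      linarith
    · have := abs_kernel_le_of_le_of_lt h2 (by linarith [h1.2] : γ₁ ≤ 0) hy1 hx1
      simp only [powTail_of_lt hx1, powTail_of_le hy1, kernel_swap γ₁]
      simp only [mul_zero, sub_zero, zero_add, mul_comm (unitBump y)] at this ⊢
      linarith
  · rcases lt_or_ge y (-1) with hy1 | hy1
    · have := abs_kernel_le_of_le_of_lt h1 (by linarith [h2.2] : γ₂ ≤ 0) hx1 hy1
      simp only [powTail_of_lt hy1, powTail_of_le hx1]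
      simp only [zero_mul, sub_zero, zero_add, mul_zero] at this ⊢
      linarith
    · simp only [powTail_of_le hx1, powTail_of_le hy1, mul_zero, zero_mul, sub_zero, zero_add]
      rcases le_or_gt 1 x with h | h
      · rw [kernel_eq_zero (by linarith [h1.2]) h, abs_zero]; positivity
      rcases le_or_gt 1 y with h' | h'
      · rw [kernel_swap, kernel_eq_zero (by linarith [h2.2]) h', abs_zero]; positivity
      rcases lt_or_gt_of_ne hx with hlt | hlt
      · exact abs_kernel_le_of_lt_of_mem h1 h2 ⟨hx1, h.le⟩ ⟨hy1, h'.le⟩ hlt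
      · rw [kernel_swap]
        have := abs_kernel_le_of_lt_of_mem h2 h1 ⟨hy1, h'.le⟩ ⟨hx1, h.le⟩ hlt
        have e : diagBump (y, x) = diagBump (x, y) := by
          simp only [diagBump]
          rw [abs_sub_comm]
          ring
        rwa [e] at this

end BaiTaqqu

namespace BaiTaqqu

/-! ### The kernel in `L²(ℝ²)` -/

theorem measurable_unitBump : Measurable unitBump :=
  measurable_const.indicator measurableSet_Icc

theorem measurable_diagBump : Measurable diagBump :=
  ((measurable_unitBump.comp measurable_fst).mul (measurable_unitBump.comp measurable_snd)).mul
    (by fun_prop)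

theorem integrable_unitBump : Integrable unitBump :=
  (integrable_indicator_iff measurableSet_Icc).2 (integrableOn_const (by simp))

theorem memLp_unitBump : MemLp unitBump 2 volume := by
  rw [memLp_two_iff_integrable_sq measurable_unitBump.aestronglyMeasurable]
  refine integrable_unitBump.congr (ae_of_all _ fun x ↦ ?_)
  simp only [unitBump, indicator]
  split_ifs <;> simp

theorem integrable_indicator_abs_rpow {a : ℝ} (ha : -1 < a) (c : ℝ) :
    Integrable ((Icc (-c) c).indicator fun u : ℝ ↦ |u| ^ a) := by
  rw [integrable_indicator_iff measurableSet_Icc]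
  rcases lt_or_ge c 0 with hc | hc
  · rw [Icc_eq_empty (by linarith)]
    exact integrableOn_empty
  have h1 : IntervalIntegrable (fun u : ℝ ↦ |u| ^ a) volume 0 c := by
    refine (intervalIntegral.intervalIntegrable_rpow' ha).congr fun u hu ↦ ?_
    rw [uIoc_of_le hc] at hu
    simp only [abs_of_pos hu.1]
  have h2 : IntervalIntegrable (fun u : ℝ ↦ |u| ^ a) volume (-c) 0 := by
    have := ((IntervalIntegrable.iff_comp_neg (by simp)).1 h1).symm
    simpa only [abs_neg, neg_zero] using this
  have h3 := h2.trans h1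
  rwa [intervalIntegrable_iff_integrableOn_Icc_of_le (by linarith)] at h3

/-- The square is at most a convolution integrand of `unitBump` with |u|^(-1/4) on [-2, 2], both of
them integrable. -/
theorem memLp_diagBump : MemLp diagBump 2 (volume : Measure (ℝ × ℝ)) := by
  rw [memLp_two_iff_integrable_sq measurable_diagBump.aestronglyMeasurable]
  have h := integrable_unitBump.convolution_integrand (μ := (volume : Measure ℝ))
    (ContinuousLinearMap.mul ℝ ℝ) (integrable_indicator_abs_rpow (a := -1 / 4) (by norm_num) 2)
  rw [← Measure.volume_eq_prod] at h
  refine h.mono' (measurable_diagBump.pow_const 2).aestronglyMeasurable (ae_of_all _ fun x ↦ ?_)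
  rw [Real.norm_eq_abs, abs_of_nonneg (sq_nonneg _)]
  simp only [ContinuousLinearMap.mul_apply', diagBump]
  by_cases h1 : x.1 ∈ Icc (-1 : ℝ) 1
  · by_cases h2 : x.2 ∈ Icc (-1 : ℝ) 1
    · rw [unitBump_of_mem h1, unitBump_of_mem h2, indicator_of_mem, one_mul, one_mul, one_mul,
        ← Real.rpow_natCast, ← Real.rpow_mul (abs_nonneg _)]
      · norm_num
      · exact ⟨by linarith [h1.1, h2.2], by linarith [h1.2, h2.1]⟩
    · simp [unitBump, h2]
  · simpa [unitBump, h1] using mul_nonneg (unitBump_nonneg x.2)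
      (indicator_nonneg (s := Icc (-2 : ℝ) 2) (f := fun u ↦ |u| ^ (-1 / 4 : ℝ))
        (fun _ _ ↦ Real.rpow_nonneg (abs_nonneg _) _) (x.1 - x.2))

theorem ae_fst_ne_snd : ∀ᵐ x : ℝ × ℝ, x.1 ≠ x.2 := by
  rw [Measure.volume_eq_prod, Measure.ae_prod_iff_ae_ae]
  · refine ae_of_all _ fun x ↦ ?_
    have : ∀ᵐ y : ℝ, y ≠ x := by simp [ae_iff]
    filter_upwards [this] with y hy using hy.symm
  · exact (measurableSet_eq_fun measurable_fst measurable_snd).compl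

theorem measurable_kernel (γ₁ γ₂ : ℝ) : Measurable (kernel γ₁ γ₂) := by
  have h : StronglyMeasurable (Function.uncurry fun (x : ℝ × ℝ) (s : ℝ) ↦
      max (s - x.1) 0 ^ γ₁ * max (s - x.2) 0 ^ γ₂) := by
    refine Measurable.stronglyMeasurable ?_
    unfold Function.uncurry
    fun_prop
  have := (h.integral_prod_right (ν := volume.restrict (Ioc (0 : ℝ) 1))).measurable
  convert this using 2 with x
  rw [kernel, intervalIntegral.integral_of_le zero_le_one]

/-- The indicator function of `[-1, 1]` as an element of `L²(ℝ)`. -/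
noncomputable def bumpLp : Lp ℝ 2 (volume : Measure ℝ) := memLp_unitBump.toLp

/-- The majorant of the kernel near the diagonal as an element of `L²(ℝ²)`. -/
noncomputable def diagLp : Lp ℝ 2 (volume : Measure (ℝ × ℝ)) := memLp_diagBump.toLp

theorem coe_bumpLp : bumpLp =ᵐ[volume] unitBump := memLp_unitBump.coeFn_toLp

theorem coe_diagLp : diagLp =ᵐ[volume] diagBump := memLp_diagBump.coeFn_toLp

/-- The majorant `kernelBound` as an element of `L²(ℝ²)`. -/
noncomputable def kernelBoundLp (γ₁ γ₂ : ℝ) : Lp ℝ 2 (volume : Measure (ℝ × ℝ)) :=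
  tensorLp (tailLp (γ₁ - 1)) (tailLp γ₂) + tensorLp (tailLp γ₁) (tailLp (γ₂ - 1)) +
    (5 : ℝ) • tensorLp bumpLp (tailLp γ₂) + (5 : ℝ) • tensorLp (tailLp γ₁) bumpLp +
      (32 : ℝ) • diagLp

theorem coe_kernelBoundLp {γ₁ γ₂ : ℝ} (h1 : γ₁ < -1 / 2) (h2 : γ₂ < -1 / 2) :
    kernelBoundLp γ₁ γ₂ =ᵐ[volume] kernelBound γ₁ γ₂ := by
  have t1 := (coe_tensorLp (tailLp (γ₁ - 1)) (tailLp γ₂)).trans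
    (ae_comp_fst_snd (coe_tailLp (by linarith)) (coe_tailLp h2))
  have t2 := (coe_tensorLp (tailLp γ₁) (tailLp (γ₂ - 1))).trans
    (ae_comp_fst_snd (coe_tailLp h1) (coe_tailLp (by linarith)))
  have t3 := (coe_tensorLp bumpLp (tailLp γ₂)).trans (ae_comp_fst_snd coe_bumpLp (coe_tailLp h2))
  have t4 := (coe_tensorLp (tailLp γ₁) bumpLp).trans (ae_comp_fst_snd (coe_tailLp h1) coe_bumpLp)
  unfold kernelBoundLp
  filter_upwards [Lp.coeFn_add (tensorLp (tailLp (γ₁ - 1)) (tailLp γ₂) +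
      tensorLp (tailLp γ₁) (tailLp (γ₂ - 1)) + (5 : ℝ) • tensorLp bumpLp (tailLp γ₂) +
      (5 : ℝ) • tensorLp (tailLp γ₁) bumpLp) ((32 : ℝ) • diagLp),
    Lp.coeFn_add (tensorLp (tailLp (γ₁ - 1)) (tailLp γ₂) +
      tensorLp (tailLp γ₁) (tailLp (γ₂ - 1)) + (5 : ℝ) • tensorLp bumpLp (tailLp γ₂))
      ((5 : ℝ) • tensorLp (tailLp γ₁) bumpLp),
    Lp.coeFn_add (tensorLp (tailLp (γ₁ - 1)) (tailLp γ₂) +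
      tensorLp (tailLp γ₁) (tailLp (γ₂ - 1))) ((5 : ℝ) • tensorLp bumpLp (tailLp γ₂)),
    Lp.coeFn_add (tensorLp (tailLp (γ₁ - 1)) (tailLp γ₂))
      (tensorLp (tailLp γ₁) (tailLp (γ₂ - 1))),
    Lp.coeFn_smul (5 : ℝ) (tensorLp bumpLp (tailLp γ₂)),
    Lp.coeFn_smul (5 : ℝ) (tensorLp (tailLp γ₁) bumpLp), Lp.coeFn_smul (32 : ℝ) diagLp,
    t1, t2, t3, t4, coe_diagLp] with x a1 a2 a3 a4 a5 a6 a7 a8 a9 a10 a11 a12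
  simp only [a1, a2, a3, a4, a5, a6, a7, a8, a9, a10, a11, a12, Pi.add_apply, Pi.smul_apply,
    smul_eq_mul, kernelBound]

theorem coe_tensorLp_tailLp {γ₁ γ₂ : ℝ} (h1 : γ₁ < -1 / 2) (h2 : γ₂ < -1 / 2) :
    tensorLp (tailLp γ₁) (tailLp γ₂) =ᵐ[volume] fun x ↦ powTail γ₁ x.1 * powTail γ₂ x.2 :=
  (coe_tensorLp _ _).trans (ae_comp_fst_snd (coe_tailLp h1) (coe_tailLp h2))

theorem memLp_kernel {γ₁ γ₂ : ℝ} (h1 : γ₁ ∈ Ico (-17 / 32) (-1 / 2))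
    (h2 : γ₂ ∈ Ico (-17 / 32) (-1 / 2)) : MemLp (kernel γ₁ γ₂) 2 volume := by
  have hsub : MemLp (fun x ↦ kernel γ₁ γ₂ x - powTail γ₁ x.1 * powTail γ₂ x.2) 2 volume := by
    refine (Lp.memLp (kernelBoundLp γ₁ γ₂)).mono ?_ ?_
    · exact ((measurable_kernel γ₁ γ₂).sub (((measurable_powTail γ₁).comp measurable_fst).mul
        ((measurable_powTail γ₂).comp measurable_snd))).aestronglyMeasurable
    · filter_upwards [coe_kernelBoundLp h1.2 h2.2, ae_fst_ne_snd] with x hx hne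
      rw [hx, Real.norm_eq_abs, Real.norm_eq_abs]
      exact (abs_kernel_sub_le ⟨h1.1, h1.2.le⟩ ⟨h2.1, h2.2.le⟩ hne).trans (le_abs_self _)
  have hadd := hsub.add (MemLp.mul_prod_two (memLp_powTail h1.2) (memLp_powTail h2.2))
  refine hadd.ae_eq (ae_of_all _ fun x ↦ ?_)
  simp

theorem abs_toLp_kernel_sub_le {γ₁ γ₂ : ℝ} (h1 : γ₁ ∈ Ico (-17 / 32) (-1 / 2))
    (h2 : γ₂ ∈ Ico (-17 / 32) (-1 / 2)) : ∀ᵐ x,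
      |((memLp_kernel h1 h2).toLp - tensorLp (tailLp γ₁) (tailLp γ₂) :
        Lp ℝ 2 (volume : Measure (ℝ × ℝ))) x| ≤ kernelBoundLp γ₁ γ₂ x := by
  filter_upwards [Lp.coeFn_sub (memLp_kernel h1 h2).toLp (tensorLp (tailLp γ₁) (tailLp γ₂)),
    (memLp_kernel h1 h2).coeFn_toLp, coe_tensorLp_tailLp h1.2 h2.2,
    coe_kernelBoundLp h1.2 h2.2, ae_fst_ne_snd] with x a1 a2 a3 a4 hne
  rw [a1, Pi.sub_apply, a2, a3, a4]
  exact abs_kernel_sub_le ⟨h1.1, h1.2.le⟩ ⟨h2.1, h2.2.le⟩ hne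

theorem norm_tensorLp (h k : Lp ℝ 2 (volume : Measure ℝ)) : ‖tensorLp h k‖ = ‖h‖ * ‖k‖ := by
  refine (sq_eq_sq₀ (norm_nonneg _) (by positivity)).1 ?_
  rw [← real_inner_self_eq_norm_sq, inner_tensorLp_tensorLp, real_inner_self_eq_norm_sq,
    real_inner_self_eq_norm_sq, mul_pow]

theorem norm_tailLp_sub_one_le {a : ℝ} (ha : a < -1 / 2) : ‖tailLp (a - 1)‖ ≤ 1 := by
  refine (sq_le_one_iff₀ (norm_nonneg _)).1 ?_
  rw [norm_tailLp_sq (by linarith), div_le_one_of_neg (by linarith)]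
  linarith

/-- No product in the majorant has two singular tails, so tail norms enter linearly. This is the
source of the rate √δ. -/
theorem norm_kernelBoundLp_le {γ₁ γ₂ : ℝ} (h1 : γ₁ < -1 / 2) (h2 : γ₂ < -1 / 2) :
    ‖kernelBoundLp γ₁ γ₂‖ ≤
      (1 + 5 * ‖bumpLp‖) * (‖tailLp γ₁‖ + ‖tailLp γ₂‖) + 32 * ‖diagLp‖ := by
  have e5 : ‖(5 : ℝ)‖ = 5 := by norm_num
  have e32 : ‖(32 : ℝ)‖ = 32 := by norm_num
  have n1 := norm_tailLp_sub_one_le h1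
  have n2 := norm_tailLp_sub_one_le h2
  unfold kernelBoundLp
  refine (norm_add_le _ _).trans ?_
  refine (add_le_add_left (norm_add_le _ _) _).trans ?_
  refine (add_le_add_left (add_le_add_left (norm_add_le _ _) _) _).trans ?_
  refine (add_le_add_left (add_le_add_left (add_le_add_left (norm_add_le _ _) _) _) _).trans ?_
  simp only [norm_smul, norm_tensorLp, e5, e32]
  nlinarith [norm_nonneg (tailLp γ₁), norm_nonneg (tailLp γ₂)]

theorem norm_toLp_kernel_sub_le {γ₁ γ₂ : ℝ} (h1 : γ₁ ∈ Ico (-17 / 32) (-1 / 2))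
    (h2 : γ₂ ∈ Ico (-17 / 32) (-1 / 2)) :
    ‖(memLp_kernel h1 h2).toLp - tensorLp (tailLp γ₁) (tailLp γ₂)‖ ≤
      (1 + 5 * ‖bumpLp‖) * (‖tailLp γ₁‖ + ‖tailLp γ₂‖) + 32 * ‖diagLp‖ := by
  refine le_trans (Lp.norm_le_norm_of_ae_le ?_) (norm_kernelBoundLp_le h1.2 h2.2)
  filter_upwards [abs_toLp_kernel_sub_le h1 h2] with x hx
  exact hx.trans (le_abs_self _)

theorem abs_inner_le_inner {α : Type*} [MeasurableSpace α] {μ : Measure α} {t x y : Lp ℝ 2 μ}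
    (ht : ∀ᵐ a ∂μ, 0 ≤ t a) (hxy : ∀ᵐ a ∂μ, |x a| ≤ y a) : |⟪t, x⟫| ≤ ⟪t, y⟫ := by
  rw [L2.inner_def, L2.inner_def, ← Real.norm_eq_abs]
  refine norm_integral_le_of_norm_le (L2.integrable_inner t y) ?_
  filter_upwards [ht, hxy] with a h1 h2
  simp only [RCLike.inner_apply, conj_trivial, norm_mul, Real.norm_eq_abs, abs_of_nonneg h1]
  exact mul_le_mul_of_nonneg_right h2 h1

theorem inner_tailLp_bumpLp {a : ℝ} (ha : a < -1 / 2) : ⟪tailLp a, bumpLp⟫ = 0 := by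
  rw [L2.inner_def]
  refine integral_eq_zero_of_ae ?_
  filter_upwards [coe_tailLp ha, coe_bumpLp] with x h1 h2
  rw [h1, h2]
  simp only [RCLike.inner_apply, conj_trivial, Pi.zero_apply]
  rcases lt_or_ge x (-1) with h | h
  · rw [unitBump, indicator_of_notMem (fun hx ↦ by linarith [hx.1]), zero_mul]
  · rw [powTail_of_le h, mul_zero]

theorem inner_tensorLp_diagLp {a : ℝ} (ha : a < -1 / 2) (k : Lp ℝ 2 (volume : Measure ℝ)) :
    ⟪tensorLp (tailLp a) k, diagLp⟫ = 0 := by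
  rw [L2.inner_def]
  refine integral_eq_zero_of_ae ?_
  filter_upwards [(coe_tensorLp (tailLp a) k).trans (ae_comp_fst_snd (coe_tailLp ha) (ae_eq_refl k)),
    coe_diagLp] with x h1 h2
  rw [h1, h2]
  simp only [RCLike.inner_apply, conj_trivial, Pi.zero_apply, diagBump]
  rcases lt_or_ge x.1 (-1) with h | h
  · rw [unitBump, indicator_of_notMem (fun hx ↦ by linarith [hx.1])]; ring
  · rw [powTail_of_le h]; ring

/-- The remainder of the kernel is almost orthogonal to the tensor products of the tails. -/
theorem abs_inner_toLp_kernel_sub_le {a b γ₁ γ₂ : ℝ} (ha : a < -1 / 2) (hb : b < -1 / 2)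
    (h1 : γ₁ ∈ Ico (-17 / 32) (-1 / 2)) (h2 : γ₂ ∈ Ico (-17 / 32) (-1 / 2)) :
    |⟪tensorLp (tailLp a) (tailLp b),
      (memLp_kernel h1 h2).toLp - tensorLp (tailLp γ₁) (tailLp γ₂)⟫| ≤
        -1 / (b + γ₂ + 1) + -1 / (a + γ₁ + 1) := by
  have ht : ∀ᵐ x, 0 ≤ tensorLp (tailLp a) (tailLp b) x := by
    filter_upwards [coe_tensorLp_tailLp ha hb] with x hx
    rw [hx]
    exact mul_nonneg (powTail_nonneg _ _) (powTail_nonneg _ _)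
  refine (abs_inner_le_inner ht (abs_toLp_kernel_sub_le h1 h2)).trans ?_
  have key : ∀ {u v : ℝ}, u < -1 / 2 → v < -1 / 2 → -1 / (u + (v - 1) + 1) ≤ 1 := by
    intro u v hu hv
    rw [div_le_one_of_neg (by linarith)]
    linarith
  -- Bumps live on [-1, 1] and tails on (-∞, -1), so only the two terms with an improved exponent
  -- survive, each with one factor at most 1.
  simp only [kernelBoundLp, inner_add_right, inner_smul_right, inner_tensorLp_tensorLp,
    inner_tensorLp_diagLp ha, inner_tailLp_bumpLp ha, inner_tailLp_bumpLp hb]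
  rw [inner_tailLp ha (by linarith [h1.2]), inner_tailLp hb h2.2, inner_tailLp ha h1.2,
    inner_tailLp hb (by linarith [h2.2])]
  have k1 := key ha h1.2
  have k2 := key hb h2.2
  have p1 : 0 ≤ -1 / (b + γ₂ + 1) := div_nonneg_of_nonpos (by norm_num) (by linarith [h2.2])
  have p2 : 0 ≤ -1 / (a + γ₁ + 1) := div_nonneg_of_nonpos (by norm_num) (by linarith [h1.2])
  nlinarith

end BaiTaqqu

namespace BaiTaqqu

/-! ### Asymptotics of the normalizing constant -/

/-- The regularized Beta function `b ↦ b B(a, b)`, along a line through `(1/2, 0)`. -/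
noncomputable def regBeta (p q δ : ℝ) : ℝ :=
  Real.Gamma (1 / 2 - p * δ) * Real.Gamma (q * δ + 1) / Real.Gamma (1 / 2 - p * δ + q * δ)

theorem regBeta_zero (p q : ℝ) : regBeta p q 0 = 1 := by
  simp only [regBeta, mul_zero, sub_zero, zero_add, add_zero, Real.Gamma_one, mul_one]
  exact div_self (Real.Gamma_pos_of_pos (by norm_num)).ne'

theorem differentiableAt_Gamma_of_pos {s : ℝ} (hs : 0 < s) : DifferentiableAt ℝ Real.Gamma s :=
  Real.differentiableAt_Gamma fun m ↦ by
    have : (0 : ℝ) ≤ m := m.cast_nonneg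
    linarith

theorem differentiableAt_regBeta (p q : ℝ) : DifferentiableAt ℝ (regBeta p q) 0 := by
  unfold regBeta
  refine DifferentiableAt.div (DifferentiableAt.mul ?_ ?_) ?_ ?_
  · exact (differentiableAt_Gamma_of_pos (by norm_num)).comp (0 : ℝ)
      (f := fun δ : ℝ ↦ 1 / 2 - p * δ) (by fun_prop)
  · exact (differentiableAt_Gamma_of_pos (by norm_num)).comp (0 : ℝ)
      (f := fun δ : ℝ ↦ q * δ + 1) (by fun_prop)
  · exact (differentiableAt_Gamma_of_pos (by norm_num)).comp (0 : ℝ)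
      (f := fun δ : ℝ ↦ 1 / 2 - p * δ + q * δ) (by fun_prop)
  · simp only [mul_zero, sub_zero, add_zero]
    exact (Real.Gamma_pos_of_pos (by norm_num)).ne'

theorem beta_eq_regBeta_div {p q δ : ℝ} (h : q * δ ≠ 0) :
    beta (1 / 2 - p * δ) (q * δ) = regBeta p q δ / (q * δ) := by
  rw [beta, regBeta, Real.Gamma_add_one h, eq_div_iff h]
  ring

/-- Each Beta factor has a simple pole in δ. Once the poles are removed, the product is
differentiable at δ = 0 with value 1, so it is 1 + O(δ). -/
theorem exists_abs_normConst_mul_sub_one_le {ρ : ℝ} (hρ : 0 < ρ) : ∃ K : ℝ, 0 < K ∧ ∀ᶠ δ in 𝓝[>] (0 : ℝ),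
    |normConst (-1 / 2 - δ) (-1 / 2 - δ / ρ) * (ρ / δ * √(((ρ + 1) ^ 2)⁻¹ + (4 * ρ)⁻¹)) - 1| ≤
      K * δ := by
  set S : ℝ := ((ρ + 1) ^ 2)⁻¹ + (4 * ρ)⁻¹ with hS
  have hS0 : 0 < S := by positivity
  set q : ℝ := 1 + 1 / ρ with hq
  have hq0 : 0 < q := by positivity
  set G : ℝ → ℝ := fun δ ↦ regBeta 1 q δ * regBeta (1 / ρ) q δ * ((ρ + 1) ^ 2)⁻¹ +
    regBeta 1 2 δ * regBeta (1 / ρ) (2 / ρ) δ * (4 * ρ)⁻¹ with hG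
  set N : ℝ → ℝ := fun δ ↦ (1 - q * δ) * (1 - 2 * q * δ) with hN
  set Φ : ℝ → ℝ := fun δ ↦ √(N δ) / √(G δ) * √S with hΦ
  have hG0 : G 0 = S := by simp only [hG, regBeta_zero, hS]; ring
  have hN0 : N 0 = 1 := by simp [hN]
  have hΦ0 : Φ 0 = 1 := by
    simp only [hΦ, hG0, hN0, Real.sqrt_one]
    exact div_mul_cancel₀ 1 (Real.sqrt_pos.2 hS0).ne'
  have dG : DifferentiableAt ℝ G 0 :=
    (((differentiableAt_regBeta _ _).mul (differentiableAt_regBeta _ _)).mul_const _).add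
      (((differentiableAt_regBeta _ _).mul (differentiableAt_regBeta _ _)).mul_const _)
  have dN : DifferentiableAt ℝ N 0 := by simp only [hN]; fun_prop
  have dΦ : DifferentiableAt ℝ Φ 0 := by
    refine ((dN.sqrt (by rw [hN0]; norm_num)).div (dG.sqrt (by rw [hG0]; exact hS0.ne')) ?_).mul_const _
    rw [hG0]
    exact (Real.sqrt_pos.2 hS0).ne'
  obtain ⟨K, hK, hb⟩ := dΦ.isBigO_sub.exists_pos
  refine ⟨K, hK, ?_⟩
  filter_upwards [nhdsWithin_le_nhds hb.bound, self_mem_nhdsWithin] with δ h1 h2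
  rw [mem_Ioi] at h2
  rw [hΦ0, sub_zero, Real.norm_eq_abs, Real.norm_eq_abs, abs_of_pos h2] at h1
  convert h1 using 3
  have e1 : beta (-1 / 2 - δ + 1) (-(-1 / 2 - δ) - (-1 / 2 - δ / ρ) - 1) =
      regBeta 1 q δ / (q * δ) := by
    rw [← beta_eq_regBeta_div (by positivity)]
    congr 1 <;> ring
  have e2 : beta (-1 / 2 - δ / ρ + 1) (-(-1 / 2 - δ) - (-1 / 2 - δ / ρ) - 1) =
      regBeta (1 / ρ) q δ / (q * δ) := by
    rw [← beta_eq_regBeta_div (by positivity)]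
    congr 1 <;> ring
  have e3 : beta (-1 / 2 - δ + 1) (-2 * (-1 / 2 - δ) - 1) = regBeta 1 2 δ / (2 * δ) := by
    rw [← beta_eq_regBeta_div (by positivity)]
    congr 1 <;> ring
  have e4 : beta (-1 / 2 - δ / ρ + 1) (-2 * (-1 / 2 - δ / ρ) - 1) =
      regBeta (1 / ρ) (2 / ρ) δ / (2 / ρ * δ) := by
    rw [← beta_eq_regBeta_div (by positivity)]
    congr 1 <;> ring
  have e5 : (-1 / 2 - δ + (-1 / 2 - δ / ρ) + 2) * (2 * (-1 / 2 - δ + (-1 / 2 - δ / ρ)) + 3) = N δ := by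
    simp only [hN, hq]; ring
  -- The poles combine as 1/(qδ)² = (ρ/δ)²/(ρ+1)² and 1/(2δ · 2δ/ρ) = (ρ/δ)²/(4ρ).
  have e6 : regBeta 1 q δ / (q * δ) * (regBeta (1 / ρ) q δ / (q * δ)) +
      regBeta 1 2 δ / (2 * δ) * (regBeta (1 / ρ) (2 / ρ) δ / (2 / ρ * δ)) = (ρ / δ) ^ 2 * G δ := by
    simp only [hG, hq]
    field_simp
    ring
  rw [normConst, e1, e2, e3, e4, e5, e6, Real.sqrt_mul (sq_nonneg _), Real.sqrt_sq (by positivity)]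
  simp only [hΦ]
  have h0 : ρ / δ ≠ 0 := by positivity
  calc √(N δ) / (ρ / δ * √(G δ)) * (ρ / δ * √S)
      = √(N δ) / √(G δ) * √S * (ρ / δ * (ρ / δ)⁻¹) := by
        simp only [div_eq_mul_inv, mul_inv]; ring
    _ = √(N δ) / √(G δ) * √S := by rw [mul_inv_cancel₀ h0, mul_one]

/-! ### Diagonalization of `wick u v` -/

/-- Bilinearity is forced by the inner products: the difference of the two sides has norm 0. -/
theorem IsTensor.add_left {H H₂ : Type*} [NormedAddCommGroup H] [InnerProductSpace ℝ H]
    [NormedAddCommGroup H₂] [InnerProductSpace ℝ H₂] {T : H → H → H₂} (hT : IsTensor T) (a b c : H) :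
    T (a + b) c = T a c + T b c := by
  rw [← sub_eq_zero, ← inner_self_eq_zero (𝕜 := ℝ)]
  simp only [inner_sub_left, inner_sub_right, inner_add_left, inner_add_right, hT.inner_eq]
  ring

theorem IsTensor.add_right {H H₂ : Type*} [NormedAddCommGroup H] [InnerProductSpace ℝ H]
    [NormedAddCommGroup H₂] [InnerProductSpace ℝ H₂] {T : H → H → H₂} (hT : IsTensor T) (a b c : H) :
    T a (b + c) = T a b + T a c := by
  rw [← sub_eq_zero, ← inner_self_eq_zero (𝕜 := ℝ)]
  simp only [inner_sub_left, inner_sub_right, inner_add_left, inner_add_right, hT.inner_eq]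
  ring

theorem IsTensor.smul_smul {H H₂ : Type*} [NormedAddCommGroup H] [InnerProductSpace ℝ H]
    [NormedAddCommGroup H₂] [InnerProductSpace ℝ H₂] {T : H → H → H₂} (hT : IsTensor T)
    (s t : ℝ) (a b : H) : T (s • a) (t • b) = (s * t) • T a b := by
  rw [← sub_eq_zero, ← inner_self_eq_zero (𝕜 := ℝ)]
  simp only [inner_sub_left, inner_sub_right, inner_smul_left, inner_smul_right, hT.inner_eq,
    conj_trivial]
  ring

/-- The orthonormal pair obtained by rotating a pair of unit vectors with inner product `r`. -/
noncomputable def rotate {H : Type*} [NormedAddCommGroup H] [InnerProductSpace ℝ H] (r : ℝ)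
    (u v : H) : Fin 2 → H :=
  ![(√(2 * (1 + r)))⁻¹ • (u + v), (√(2 * (1 - r)))⁻¹ • (u + (-1 : ℝ) • v)]

section

variable {H : Type*} [NormedAddCommGroup H] [InnerProductSpace ℝ H] {r : ℝ} {u v : H}

theorem orthonormal_rotate (hu : ⟪u, u⟫ = 1) (hv : ⟪v, v⟫ = 1) (huv : ⟪u, v⟫ = r)
    (hr : |r| < 1) : Orthonormal ℝ (rotate r u v) := by
  obtain ⟨h1, h2⟩ := abs_lt.1 hr
  have hvu : ⟪v, u⟫ = r := by rw [real_inner_comm, huv]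
  have p1 : (√(2 * (1 + r)))⁻¹ ^ 2 * (2 * (1 + r)) = 1 := by
    rw [inv_pow, Real.sq_sqrt (by linarith), inv_mul_cancel₀ (by linarith)]
  have p2 : (√(2 * (1 - r)))⁻¹ ^ 2 * (2 * (1 - r)) = 1 := by
    rw [inv_pow, Real.sq_sqrt (by linarith), inv_mul_cancel₀ (by linarith)]
  rw [orthonormal_iff_ite]
  intro i j
  fin_cases i <;> fin_cases j <;>
    simp only [rotate, Fin.zero_eta, Fin.mk_one, Matrix.cons_val_zero, Matrix.cons_val_one,
      Fin.isValue, inner_smul_left, inner_smul_right, inner_add_left, inner_add_right, hu, hv, huv,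
      hvu, conj_trivial, if_true, zero_ne_one, one_ne_zero, if_false]
  · linear_combination p1
  · ring
  · ring
  · linear_combination p2

theorem inner_tensor_rotate_le {H₂ : Type*} [NormedAddCommGroup H₂] [InnerProductSpace ℝ H₂]
    {T : H → H → H₂} (hT : IsTensor T) {x : H₂} {ε κ : ℝ} (hκ1 : (√(2 * (1 + r)))⁻¹ ≤ κ)
    (hκ2 : (√(2 * (1 - r)))⁻¹ ≤ κ) (huu : |⟪T u u, x⟫| ≤ ε) (huv : |⟪T u v, x⟫| ≤ ε)
    (hvu : |⟪T v u, x⟫| ≤ ε) (hvv : |⟪T v v, x⟫| ≤ ε) (i j : Fin 2) :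
    |⟪T (rotate r u v i) (rotate r u v j), x⟫| ≤ κ ^ 2 * (4 * ε) := by
  have key : ∀ {s t σ τ : ℝ}, 0 ≤ s → 0 ≤ t → s ≤ κ → t ≤ κ → |σ| = 1 → |τ| = 1 →
      |⟪T (s • (u + σ • v)) (t • (u + τ • v)), x⟫| ≤ κ ^ 2 * (4 * ε) := by
    intro s t σ τ hs ht hsκ htκ hσ hτ
    have e : T (u + σ • v) (u + τ • v) = T u u + τ • T u v + σ • T v u + (σ * τ) • T v v := by
      have e1 := hT.smul_smul 1 τ u v
      have e2 := hT.smul_smul σ 1 v u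
      rw [one_smul, one_mul] at e1
      rw [one_smul, mul_one] at e2
      rw [hT.add_left, hT.add_right, hT.add_right, e1, e2, hT.smul_smul, ← add_assoc]
    rw [hT.smul_smul, e]
    simp only [inner_smul_left, inner_add_left, conj_trivial]
    rw [abs_mul, abs_of_nonneg (mul_nonneg hs ht), sq]
    refine mul_le_mul (mul_le_mul hsκ htκ ht (hs.trans hsκ)) ?_ (abs_nonneg _)
      (mul_nonneg (hs.trans hsκ) (hs.trans hsκ))
    refine (abs_add_le _ _).trans ?_
    refine (add_le_add_left ((abs_add_le _ _).trans (add_le_add_left (abs_add_le _ _) _)) _).trans ?_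
    simp only [abs_mul, hσ, hτ, one_mul]
    linarith
  have one : u + v = u + (1 : ℝ) • v := by rw [one_smul]
  have p1 : 0 ≤ (√(2 * (1 + r)))⁻¹ := by positivity
  have p2 : 0 ≤ (√(2 * (1 - r)))⁻¹ := by positivity
  have n1 : |(-1 : ℝ)| = 1 := by norm_num
  fin_cases i <;> fin_cases j <;>
    simp only [rotate, Fin.zero_eta, Fin.mk_one, Matrix.cons_val_zero, Matrix.cons_val_one,
      Fin.isValue, one]
  · exact key p1 p1 hκ1 hκ1 abs_one abs_one
  · exact key p1 p2 hκ1 hκ2 abs_one n1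
  · exact key p2 p1 hκ2 hκ1 n1 abs_one
  · exact key p2 p2 hκ2 hκ2 n1 n1

/-- Polarization, 4uv = (u+v)² - (u-v)². For unit vectors with inner product `r` the coefficients (r
± 1)/2 are the eigenvalues of the symmetrization of u ⊗ v. -/
theorem IsIsonormal.wick_eq_rotate {Ω : Type*} [MeasurableSpace Ω] {P : Measure Ω}
    {W : H →ₗᵢ[ℝ] Lp ℝ 2 P} (hW : IsIsonormal W) (hr : |r| < 1) :
    hW.wick u v = ((1 + r) / 2) • hW.wick (rotate r u v 0) (rotate r u v 0) +
      (-(1 - r) / 2) • hW.wick (rotate r u v 1) (rotate r u v 1) := by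
  obtain ⟨h1, h2⟩ := abs_lt.1 hr
  have p1 : (1 + r) / 2 * ((√(2 * (1 + r)))⁻¹ * (√(2 * (1 + r)))⁻¹) = 1 / 4 := by
    rw [← mul_inv, Real.mul_self_sqrt (by linarith)]
    have : 1 + r ≠ 0 := by linarith
    field_simp
    norm_num
  have p2 : -(1 - r) / 2 * ((√(2 * (1 - r)))⁻¹ * (√(2 * (1 - r)))⁻¹) = -1 / 4 := by
    rw [← mul_inv, Real.mul_self_sqrt (by linarith)]
    have : 1 - r ≠ 0 := by linarith
    field_simp
    norm_num
  have key : ∀ (c α : ℝ) (a b : H),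
      c • hW.wickₗ (α • a) (α • b) = (c * (α * α)) • hW.wickₗ a b := by
    intro c α a b
    simp only [map_smul, LinearMap.smul_apply, smul_smul]
  simp only [rotate, Matrix.cons_val_zero, Matrix.cons_val_one, ← hW.wickₗ_apply]
  rw [key, key, p1, p2]
  simp only [map_smul, map_add, LinearMap.smul_apply, LinearMap.add_apply]
  simp only [hW.wickₗ_apply, hW.wick_comm v u]
  module

end

end BaiTaqqu

namespace BaiTaqqu

/-! ### The limiting coefficients -/

theorem sqrt_two_mul_add_inv {ρ : ℝ} : √(2 * ((ρ + 1) ^ 2)⁻¹ + (2 * ρ)⁻¹) =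
    √2 * √(((ρ + 1) ^ 2)⁻¹ + (4 * ρ)⁻¹) := by
  rw [← Real.sqrt_mul (by norm_num)]
  congr 1
  rw [mul_inv, mul_inv]
  ring

theorem inv_sq_add_inv_pos {ρ : ℝ} (hρ : 0 < ρ) : 0 < √(((ρ + 1) ^ 2)⁻¹ + (4 * ρ)⁻¹) := by
  positivity

theorem sqrt_mul_aCoef {ρ : ℝ} (hρ : 0 < ρ) :
    √(((ρ + 1) ^ 2)⁻¹ + (4 * ρ)⁻¹) * (aCoef ρ / √2) = ((ρ + 1)⁻¹ + (2 * √ρ)⁻¹) / 2 := by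
  rw [aCoef, sqrt_two_mul_add_inv]
  have h1 := (inv_sq_add_inv_pos hρ).ne'
  generalize √(((ρ + 1) ^ 2)⁻¹ + (4 * ρ)⁻¹) = s at *
  rw [div_div, mul_right_comm, Real.mul_self_sqrt zero_le_two]
  field_simp

theorem sqrt_mul_bCoef {ρ : ℝ} (hρ : 0 < ρ) :
    √(((ρ + 1) ^ 2)⁻¹ + (4 * ρ)⁻¹) * (bCoef ρ / √2) = ((ρ + 1)⁻¹ - (2 * √ρ)⁻¹) / 2 := by
  rw [bCoef, sqrt_two_mul_add_inv]
  have h1 := (inv_sq_add_inv_pos hρ).ne'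
  generalize √(((ρ + 1) ^ 2)⁻¹ + (4 * ρ)⁻¹) = s at *
  rw [div_div, mul_right_comm, Real.mul_self_sqrt zero_le_two]
  field_simp

theorem aCoef_sq_add_bCoef_sq {ρ : ℝ} (hρ : 0 < ρ) : aCoef ρ ^ 2 + bCoef ρ ^ 2 = 1 := by
  have h0 : 0 < 2 * ((ρ + 1) ^ 2)⁻¹ + (2 * ρ)⁻¹ := by positivity
  rw [aCoef, bCoef, div_pow, div_pow, Real.sq_sqrt h0.le, ← add_div, div_eq_one_iff_eq h0.ne']
  have h1 : (2 * √ρ)⁻¹ ^ 2 = (4 * ρ)⁻¹ := by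
    rw [inv_pow, mul_pow, Real.sq_sqrt hρ.le]; norm_num
  have h2 : (2 * ρ)⁻¹ = 2 * (4 * ρ)⁻¹ := by rw [mul_inv, mul_inv]; ring
  rw [h2, ← h1, ← inv_pow]
  ring

/-- The inner product of the two normalized tails. -/
noncomputable def tailCorr (ρ : ℝ) : ℝ := 2 * √ρ / (1 + ρ)

/-- This is (1 - √ρ)² > 0. Strictness keeps the two tails linearly independent, so that `rotate`
gives an orthonormal pair. -/
theorem abs_tailCorr_lt_one {ρ : ℝ} (hρ : ρ ∈ Ioo (0 : ℝ) 1) : |tailCorr ρ| < 1 := by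
  have h0 : 0 < √ρ := Real.sqrt_pos.2 hρ.1
  have h1 := Real.sq_sqrt hρ.1.le
  have h2 : √ρ < 1 := by rw [Real.sqrt_lt' one_pos]; simpa using hρ.2
  rw [tailCorr, abs_of_nonneg (by have := hρ.1; positivity), div_lt_one (by linarith [hρ.1])]
  nlinarith

/-- The parameters of the two tails: `δ` is small enough for the kernel bounds to apply. -/
structure IsSmall (ρ δ : ℝ) : Prop where
  rho_mem : ρ ∈ Ioo (0 : ℝ) 1
  pos : 0 < δ
  le : δ ≤ ρ / 32

/-! ### Normalized tails and the size of the remainder. -/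

namespace IsSmall

variable {ρ δ : ℝ}

theorem le_one (h : IsSmall ρ δ) : δ ≤ 1 := by linarith [h.le, h.rho_mem.2]

theorem le_div (h : IsSmall ρ δ) : δ ≤ δ / ρ := by
  rw [le_div_iff₀ h.rho_mem.1]
  nlinarith [h.pos, h.rho_mem.2]

theorem fst_mem (h : IsSmall ρ δ) : -1 / 2 - δ ∈ Ico (-17 / 32 : ℝ) (-1 / 2) :=
  ⟨by linarith [h.le, h.rho_mem.2], by linarith [h.pos]⟩

theorem snd_mem (h : IsSmall ρ δ) : -1 / 2 - δ / ρ ∈ Ico (-17 / 32 : ℝ) (-1 / 2) := by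
  have h1 : δ / ρ ≤ 1 / 32 := by
    rw [div_le_iff₀ h.rho_mem.1]
    linarith [h.le]
  exact ⟨by linarith, by linarith [h.pos, h.le_div]⟩

theorem sqrt_mul_sqrt (h : IsSmall ρ δ) : √(2 * δ) * √(2 * (δ / ρ)) = 2 * δ / √ρ := by
  have := h.pos
  rw [← Real.sqrt_mul (by positivity), show 2 * δ * (2 * (δ / ρ)) = (2 * δ) ^ 2 / ρ by ring,
    Real.sqrt_div (sq_nonneg _), Real.sqrt_sq (by positivity)]

theorem inner_fst_fst (h : IsSmall ρ δ) :
    ⟪√(2 * δ) • tailLp (-1 / 2 - δ), √(2 * δ) • tailLp (-1 / 2 - δ)⟫ = 1 := by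
  have h0 := h.pos
  rw [inner_smul_left, inner_smul_right, inner_tailLp h.fst_mem.2 h.fst_mem.2, conj_trivial,
    ← mul_assoc, Real.mul_self_sqrt (by positivity),
    show -1 / 2 - δ + (-1 / 2 - δ) + 1 = -(2 * δ) by ring, neg_div_neg_eq]
  field_simp

theorem inner_snd_snd (h : IsSmall ρ δ) :
    ⟪√(2 * (δ / ρ)) • tailLp (-1 / 2 - δ / ρ), √(2 * (δ / ρ)) • tailLp (-1 / 2 - δ / ρ)⟫ = 1 := by
  have h0 : 0 < δ / ρ := div_pos h.pos h.rho_mem.1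
  rw [inner_smul_left, inner_smul_right, inner_tailLp h.snd_mem.2 h.snd_mem.2, conj_trivial,
    ← mul_assoc, Real.mul_self_sqrt (by positivity),
    show -1 / 2 - δ / ρ + (-1 / 2 - δ / ρ) + 1 = -(2 * (δ / ρ)) by ring, neg_div_neg_eq,
    mul_one_div, div_self (by positivity)]

theorem inner_fst_snd (h : IsSmall ρ δ) :
    ⟪√(2 * δ) • tailLp (-1 / 2 - δ), √(2 * (δ / ρ)) • tailLp (-1 / 2 - δ / ρ)⟫ = tailCorr ρ := by
  have h0 := h.pos
  have h1 := h.rho_mem.1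
  have h2 : 0 < √ρ := Real.sqrt_pos.2 h1
  have h3 := Real.sq_sqrt h1.le
  rw [inner_smul_left, inner_smul_right, inner_tailLp h.fst_mem.2 h.snd_mem.2, conj_trivial,
    ← mul_assoc, h.sqrt_mul_sqrt, tailCorr,
    show -1 / 2 - δ + (-1 / 2 - δ / ρ) + 1 = -(δ * (1 + ρ) / ρ) by field_simp; ring,
    neg_div_neg_eq]
  field_simp
  linarith

/-- The difference between the kernel and the tensor product of its tails, in `L²(ℝ²)`. -/
noncomputable def remainder (h : IsSmall ρ δ) : Lp ℝ 2 (volume : Measure (ℝ × ℝ)) :=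
  (memLp_kernel h.fst_mem h.snd_mem).toLp -
    tensorLp (tailLp (-1 / 2 - δ)) (tailLp (-1 / 2 - δ / ρ))

theorem norm_tailLp_le {a : ℝ} (hδ : 0 < δ) (ha : a ≤ -1 / 2 - δ) : ‖tailLp a‖ ≤ (√δ)⁻¹ := by
  refine (sq_le_sq₀ (norm_nonneg _) (by positivity)).1 ?_
  rw [norm_tailLp_sq (by linarith), inv_pow, Real.sq_sqrt hδ.le, inv_eq_one_div,
    show -1 / (2 * a + 1) = 1 / (-(2 * a + 1)) by rw [div_neg, neg_div]]
  exact one_div_le_one_div_of_le hδ (by linarith)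

theorem norm_remainder_le (h : IsSmall ρ δ) :
    ‖h.remainder‖ ≤ (2 * (1 + 5 * ‖bumpLp‖) + 32 * ‖diagLp‖) * (√δ)⁻¹ := by
  have h1 := norm_tailLp_le h.pos (le_refl (-1 / 2 - δ))
  have h2 := norm_tailLp_le h.pos (show -1 / 2 - δ / ρ ≤ -1 / 2 - δ by linarith [h.le_div])
  have h3 : 1 ≤ (√δ)⁻¹ := by
    rw [one_le_inv₀ (Real.sqrt_pos.2 h.pos)]
    exact Real.sqrt_le_one.2 h.le_one
  refine (norm_toLp_kernel_sub_le h.fst_mem h.snd_mem).trans ?_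
  nlinarith [norm_nonneg bumpLp, norm_nonneg diagLp]

/-- Normalization contributes O(δ) and the raw inner product O(1/δ). Letting η and ζ range over [δ,
δ/ρ] covers all four pairs of tails. -/
theorem abs_inner_smul_remainder_le (h : IsSmall ρ δ) {η ζ : ℝ} (hη : δ ≤ η) (hη' : η ≤ δ / ρ)
    (hζ : δ ≤ ζ) (hζ' : ζ ≤ δ / ρ) :
    |⟪tensorLp (√(2 * η) • tailLp (-1 / 2 - η)) (√(2 * ζ) • tailLp (-1 / 2 - ζ)), h.remainder⟫| ≤
      4 / ρ := by
  have h0 := h.pos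
  have h1 := h.rho_mem.1
  have h2 := h.le_div
  have hs : √(2 * η) * √(2 * ζ) ≤ 2 * (δ / ρ) := by
    rw [← Real.mul_self_sqrt (by positivity : 0 ≤ 2 * (δ / ρ))]
    exact mul_le_mul (Real.sqrt_le_sqrt (by linarith)) (Real.sqrt_le_sqrt (by linarith))
      (Real.sqrt_nonneg _) (Real.sqrt_nonneg _)
  have hi := abs_inner_toLp_kernel_sub_le (by linarith : -1 / 2 - η < -1 / 2)
    (by linarith : -1 / 2 - ζ < -1 / 2) h.fst_mem h.snd_mem
  have key : ∀ {u v : ℝ}, δ ≤ u → δ ≤ v → -1 / (-1 / 2 - u + (-1 / 2 - v) + 1) ≤ 1 / δ := by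
    intro u v hu hv
    rw [show -1 / 2 - u + (-1 / 2 - v) + 1 = -(u + v) by ring, neg_div_neg_eq]
    exact one_div_le_one_div_of_le h0 (by linarith)
  have k1 := key hζ h2
  have k2 := key hη le_rfl
  rw [isTensor_tensorLp.smul_smul, inner_smul_left, conj_trivial, abs_mul,
    abs_of_nonneg (by positivity)]
  calc _ ≤ 2 * (δ / ρ) * (1 / δ + 1 / δ) :=
        mul_le_mul hs (hi.trans (add_le_add k1 k2)) (abs_nonneg _) (by positivity)
    _ = 4 / ρ := by field_simp; norm_num

end IsSmall

end BaiTaqqu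

namespace BaiTaqqu

/-! ### Decomposition of `Z` into `Y` and a small remainder -/

namespace IsIsonormal

variable {Ω : Type*} [MeasurableSpace Ω] {P : Measure Ω}
variable {H : Type*} [NormedAddCommGroup H] [InnerProductSpace ℝ H] {W : H →ₗᵢ[ℝ] Lp ℝ 2 P}

theorem add_smul_mem_closure (hW : IsIsonormal W) {X Y : Lp ℝ 2 P} (a b : ℝ)
    (hX : X ∈ closure (range hW.wickSum)) (hY : Y ∈ closure (range hW.wickSum)) :
    a • X + b • Y ∈ closure (range hW.wickSum) :=
  let S := (LinearMap.range hW.wickSum).topologicalClosure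
  S.add_mem (S.smul_mem a hX) (S.smul_mem b hY)

theorem wick_mem_closure (hW : IsIsonormal W) (h k : H) :
    hW.wick h k ∈ closure (range hW.wickSum) :=
  subset_closure ⟨_, hW.wickSum_single h k⟩

/-- The limit `Y_ρ` realized on an orthonormal pair. -/
noncomputable def limit (hW : IsIsonormal W) (ρ : ℝ) (e : Fin 2 → H) : Lp ℝ 2 P :=
  (aCoef ρ / √2) • hW.wick (e 0) (e 0) + (bCoef ρ / √2) • hW.wick (e 1) (e 1)

theorem limit_mem_closure (hW : IsIsonormal W) (ρ : ℝ) (e : Fin 2 → H) :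
    hW.limit ρ e ∈ closure (range hW.wickSum) :=
  hW.add_smul_mem_closure _ _ (hW.wick_mem_closure _ _) (hW.wick_mem_closure _ _)

theorem norm_limit (hW : IsIsonormal W) {ρ : ℝ} (hρ : 0 < ρ) {e : Fin 2 → H}
    (he : Orthonormal ℝ e) : ‖hW.limit ρ e‖ = 1 := by
  have h00 : ⟪e 0, e 0⟫ = 1 := by rw [real_inner_self_eq_norm_sq, he.1, one_pow]
  have h11 : ⟪e 1, e 1⟫ = 1 := by rw [real_inner_self_eq_norm_sq, he.1, one_pow]
  have h01 : ⟪e 0, e 1⟫ = 0 := he.2 (by simp)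
  have h10 : ⟪e 1, e 0⟫ = 0 := he.2 (by simp)
  rw [← sq_eq_sq₀ (norm_nonneg _) zero_le_one, ← real_inner_self_eq_norm_sq, limit]
  simp only [inner_add_left, inner_add_right, inner_smul_left, inner_smul_right, conj_trivial,
    hW.inner_wick_wick, h00, h11, h01, h10]
  have := aCoef_sq_add_bCoef_sq hρ
  have h2 : (√2) ^ 2 = 2 := Real.sq_sqrt zero_le_two
  field_simp
  rw [h2]
  linear_combination 2 * this

theorem coe_limit (hW : IsIsonormal W) (ρ : ℝ) {e : Fin 2 → H} (he : Orthonormal ℝ e) :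
    hW.limit ρ e =ᵐ[P] fun ω ↦ Yvar ρ (W (e 0) ω, W (e 1) ω) := by
  have h00 : ⟪e 0, e 0⟫ = 1 := by rw [real_inner_self_eq_norm_sq, he.1, one_pow]
  have h11 : ⟪e 1, e 1⟫ = 1 := by rw [real_inner_self_eq_norm_sq, he.1, one_pow]
  filter_upwards [hW.coe_wick (e 0) (e 0), hW.coe_wick (e 1) (e 1),
    Lp.coeFn_add ((aCoef ρ / √2) • hW.wick (e 0) (e 0)) ((bCoef ρ / √2) • hW.wick (e 1) (e 1)),
    Lp.coeFn_smul (aCoef ρ / √2) (hW.wick (e 0) (e 0)),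
    Lp.coeFn_smul (bCoef ρ / √2) (hW.wick (e 1) (e 1))] with ω h1 h2 h3 h4 h5
  rw [limit, h3, Pi.add_apply, h4, h5, Pi.smul_apply, Pi.smul_apply, h1, h2, h00, h11, Yvar,
    smul_eq_mul, smul_eq_mul, sq, sq]

theorem map_pair (hW : IsIsonormal W) {e : Fin 2 → H} (he : Orthonormal ℝ e) :
    P.map (fun ω ↦ (W (e 0) ω, W (e 1) ω)) = gaussPair := by
  have := (hW.hasGaussianLaw (e 0)).isProbabilityMeasure
  have h := (indepFun_iff_map_prod_eq_prod_map_map (aemeasurable W _) (aemeasurable W _)).1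
    ((hW.iIndepFun_of_orthonormal he).indepFun (show (0 : Fin 2) ≠ 1 by simp))
  have e0 : ‖e 0‖₊ = 1 := by ext; simp [he.1]
  have e1 : ‖e 1‖₊ = 1 := by ext; simp [he.1]
  rw [h, hW.map_eq, hW.map_eq, e0, e1, one_pow]

end IsIsonormal

/-- The orthonormal pair spanned by the two tails. -/
noncomputable def tailPair (ρ δ : ℝ) : Fin 2 → Lp ℝ 2 (volume : Measure ℝ) :=
  rotate (tailCorr ρ) (√(2 * δ) • tailLp (-1 / 2 - δ))
    (√(2 * (δ / ρ)) • tailLp (-1 / 2 - δ / ρ))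

namespace IsSmall

variable {ρ δ : ℝ}

theorem orthonormal_tailPair (h : IsSmall ρ δ) : Orthonormal ℝ (tailPair ρ δ) :=
  orthonormal_rotate h.inner_fst_fst h.inner_snd_snd h.inner_fst_snd (abs_tailCorr_lt_one h.rho_mem)

variable {Ω : Type*} [MeasurableSpace Ω] {P : Measure Ω}
  {W : Lp ℝ 2 (volume : Measure ℝ) →ₗᵢ[ℝ] Lp ℝ 2 P}

/-- The ratio between the leading part of `Z` and `Y`. -/
noncomputable def ratio (ρ δ : ℝ) : ℝ :=
  normConst (-1 / 2 - δ) (-1 / 2 - δ / ρ) * (ρ / δ * √(((ρ + 1) ^ 2)⁻¹ + (4 * ρ)⁻¹))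

/-- The eigenvalues (r ± 1)/2, with r = `tailCorr ρ`, are proportional to the coefficients of Y_ρ;
`ratio` is the scalar left over. -/
theorem normConst_smul_wick (h : IsSmall ρ δ) (hW : IsIsonormal W) :
    normConst (-1 / 2 - δ) (-1 / 2 - δ / ρ) •
      hW.wick (tailLp (-1 / 2 - δ)) (tailLp (-1 / 2 - δ / ρ)) =
        ratio ρ δ • hW.limit ρ (tailPair ρ δ) := by
  have h0 := h.pos
  have h1 := h.rho_mem.1
  have hs : 0 < √ρ := Real.sqrt_pos.2 h1
  have hq : √ρ ^ 2 = ρ := Real.sq_sqrt h1.le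
  have e1 : hW.wick (tailLp (-1 / 2 - δ)) (tailLp (-1 / 2 - δ / ρ)) =
      (√ρ / (2 * δ)) • hW.wick (√(2 * δ) • tailLp (-1 / 2 - δ))
        (√(2 * (δ / ρ)) • tailLp (-1 / 2 - δ / ρ)) := by
    rw [hW.wick_smul_left, hW.wick_comm _ (√(2 * (δ / ρ)) • _), hW.wick_smul_left,
      hW.wick_comm (tailLp (-1 / 2 - δ / ρ)), smul_smul, smul_smul, mul_assoc, h.sqrt_mul_sqrt,
      div_mul_div_cancel₀' (by positivity), div_self (by positivity), one_smul]
  rw [e1, hW.wick_eq_rotate (r := tailCorr ρ) (abs_tailCorr_lt_one h.rho_mem), ratio,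
    IsIsonormal.limit]
  simp only [smul_add, smul_smul]
  have ha := sqrt_mul_aCoef h1
  have hb := sqrt_mul_bCoef h1
  have c1 : √ρ / (2 * δ) * ((1 + tailCorr ρ) / 2) =
      ρ / δ * (((ρ + 1)⁻¹ + (2 * √ρ)⁻¹) / 2) := by
    rw [tailCorr]
    field_simp
    rw [hq]
    ring
  have c2 : √ρ / (2 * δ) * (-(1 - tailCorr ρ) / 2) =
      ρ / δ * (((ρ + 1)⁻¹ - (2 * √ρ)⁻¹) / 2) := by
    rw [tailCorr]
    field_simp
    rw [hq]
    ring
  unfold tailPair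
  congr 2
  · rw [mul_assoc, c1, ← ha]; ring
  · rw [mul_assoc, c2, ← hb]; ring

/-- The difference between `Z` and `Y`. -/
noncomputable def diff (h : IsSmall ρ δ) (hW : IsIsonormal W) : Lp ℝ 2 P :=
  (ratio ρ δ - 1) • hW.limit ρ (tailPair ρ δ) +
    normConst (-1 / 2 - δ) (-1 / 2 - δ / ρ) • hW.chaos tensorLp h.remainder

theorem diff_mem_closure (h : IsSmall ρ δ) (hW : IsIsonormal W) :
    h.diff hW ∈ closure (range hW.wickSum) :=
  hW.add_smul_mem_closure _ _ (hW.limit_mem_closure _ _)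
    (hW.chaos_mem_closure isTensor_tensorLp _)

theorem Zvar_ae_eq [IsProbabilityMeasure P] (h : IsSmall ρ δ) (hW : IsIsonormal W) {B : ℝ → Ω → ℝ}
    (hWB : ∀ l r, l ≤ r → W (iocLp l r) =ᵐ[P] fun ω ↦ B r ω - B l ω) :
    Zvar B P (-1 / 2 - δ) (-1 / 2 - δ / ρ) =ᵐ[P]
      (hW.limit ρ (tailPair ρ δ) + h.diff hW : Lp ℝ 2 P) := by
  have e : hW.limit ρ (tailPair ρ δ) + h.diff hW = normConst (-1 / 2 - δ) (-1 / 2 - δ / ρ) •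
      hW.chaos tensorLp (memLp_kernel h.fst_mem h.snd_mem).toLp := by
    rw [diff, remainder, map_sub, hW.chaos_apply isTensor_tensorLp, smul_sub,
      h.normConst_smul_wick hW]
    module
  rw [e]
  filter_upwards [Lp.coeFn_smul (normConst (-1 / 2 - δ) (-1 / 2 - δ / ρ))
    (hW.chaos tensorLp (memLp_kernel h.fst_mem h.snd_mem).toLp),
    hW.doubleWienerIto_ae_eq hWB (memLp_kernel h.fst_mem h.snd_mem)] with ω h1 h2
  rw [h1, Pi.smul_apply, Zvar, h2, smul_eq_mul]

/-- The norm is only O(√δ), but against functions of the two limiting coordinates the difference is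
O(δ). The first bound serves the Wasserstein distance; the cumulants need both. -/
theorem exists_norm_diff_le (hρ : ρ ∈ Ioo (0 : ℝ) 1) : ∃ K : ℝ, 0 < K ∧ ∀ᶠ δ in 𝓝[>] (0 : ℝ),
    ∃ h : IsSmall ρ δ, ∀ {Ω : Type*} [MeasurableSpace Ω] {P : Measure Ω} [IsProbabilityMeasure P]
      {W : Lp ℝ 2 (volume : Measure ℝ) →ₗᵢ[ℝ] Lp ℝ 2 P} (hW : IsIsonormal W),
      ‖h.diff hW‖ ≤ K * √δ ∧ ∀ {v : (Fin 2 → ℝ) → ℝ}, Measurable v → ∀ {V : Lp ℝ 2 P},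
        V =ᵐ[P] (fun ω ↦ v fun i ↦ W (tailPair ρ δ i) ω) → |⟪V, h.diff hW⟫| ≤ K * ‖V‖ * δ := by
  obtain ⟨K₀, hK₀, hc⟩ := exists_abs_normConst_mul_sub_one_le hρ.1
  set s := √(((ρ + 1) ^ 2)⁻¹ + (4 * ρ)⁻¹) with hs
  have hs0 : 0 < s := inv_sq_add_inv_pos hρ.1
  set A : ℝ := (1 + K₀) / (ρ * s) with hA
  have hρ0 := hρ.1
  have hA0 : 0 < A := by positivity
  set M : ℝ := 2 * (1 + 5 * ‖bumpLp‖) + 32 * ‖diagLp‖ with hM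
  have hM0 : 0 < M := by positivity
  set κ : ℝ := max (√(2 * (1 + tailCorr ρ)))⁻¹ (√(2 * (1 - tailCorr ρ)))⁻¹ with hκ
  set E : ℝ := κ ^ 2 * (4 * (4 / ρ)) with hE
  have hE0 : 0 ≤ E := by positivity
  refine ⟨K₀ + 2 * A * M + 8 * A * E, by positivity, ?_⟩
  have hsmall : ∀ᶠ δ in 𝓝[>] (0 : ℝ), δ ∈ Ioc 0 (ρ / 32) :=
    Ioc_mem_nhdsGT (by positivity)
  filter_upwards [hc, hsmall] with δ hδc hδ
  have h : IsSmall ρ δ := ⟨hρ, hδ.1, hδ.2⟩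
  refine ⟨h, fun {Ω} _ {P} _ {W} hW ↦ ?_⟩
  have h0 := h.pos
  have hr : |ratio ρ δ - 1| ≤ K₀ * δ := hδc
  have hn : |normConst (-1 / 2 - δ) (-1 / 2 - δ / ρ)| ≤ A * δ := by
    have e : normConst (-1 / 2 - δ) (-1 / 2 - δ / ρ) = ratio ρ δ * (δ / (ρ * s)) := by
      rw [ratio, ← hs]
      field_simp
    have hr1 : |ratio ρ δ| ≤ 1 + K₀ := by
      have := abs_sub_abs_le_abs_sub (ratio ρ δ) 1
      rw [abs_one] at this
      nlinarith [h.le_one]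
    rw [e, abs_mul, abs_of_nonneg (by positivity : 0 ≤ δ / (ρ * s)), hA, div_mul_eq_mul_div,
      ← mul_div_assoc]
    gcongr
  have hlim := hW.norm_limit hρ0 h.orthonormal_tailPair
  have hsq : √δ * √δ = δ := Real.mul_self_sqrt h0.le
  have hsp : 0 < √δ := Real.sqrt_pos.2 h0
  have hs1 : √δ ≤ 1 := Real.sqrt_le_one.2 h.le_one
  refine ⟨?_, fun {v} hv {V} hV ↦ ?_⟩
  · calc ‖h.diff hW‖ ≤ |ratio ρ δ - 1| * ‖hW.limit ρ (tailPair ρ δ)‖ +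
          |normConst (-1 / 2 - δ) (-1 / 2 - δ / ρ)| * ‖hW.chaos tensorLp h.remainder‖ := by
          refine (norm_add_le _ _).trans ?_
          rw [norm_smul, norm_smul, Real.norm_eq_abs, Real.norm_eq_abs]
      _ ≤ K₀ * δ * 1 + A * δ * (2 * (M * (√δ)⁻¹)) := by
          rw [hlim]
          gcongr
          exact (hW.norm_chaos_le isTensor_tensorLp _).trans (by gcongr; exact h.norm_remainder_le)
      _ = (K₀ * √δ + 2 * A * M) * √δ := by
          have : δ * (√δ)⁻¹ = √δ := by rw [← div_eq_mul_inv, Real.div_sqrt]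
          linear_combination (2 * A * M) * this - K₀ * hsq
      _ ≤ (K₀ + 2 * A * M + 8 * A * E) * √δ := by
          refine mul_le_mul_of_nonneg_right ?_ hsp.le
          have : 0 ≤ 8 * A * E := by positivity
          nlinarith
  · have hin : |⟪V, hW.chaos tensorLp h.remainder⟫| ≤ 8 * ‖V‖ * E := by
      refine (hW.abs_inner_chaos_le isTensor_tensorLp h.orthonormal_tailPair hv hV (ε := E)
        fun i j ↦ ?_).trans (le_of_eq ?_)
      · exact inner_tensor_rotate_le isTensor_tensorLp (le_max_left _ _) (le_max_right _ _)
          (h.abs_inner_smul_remainder_le le_rfl h.le_div le_rfl h.le_div)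
          (h.abs_inner_smul_remainder_le le_rfl h.le_div h.le_div le_rfl)
          (h.abs_inner_smul_remainder_le h.le_div le_rfl le_rfl h.le_div)
          (h.abs_inner_smul_remainder_le h.le_div le_rfl h.le_div le_rfl) i j
      · simp only [Fintype.card_fin]
        norm_num
    have hin' : |⟪V, hW.limit ρ (tailPair ρ δ)⟫| ≤ ‖V‖ := by
      simpa [hlim] using abs_real_inner_le_norm V (hW.limit ρ (tailPair ρ δ))
    calc |⟪V, h.diff hW⟫| ≤ |ratio ρ δ - 1| * |⟪V, hW.limit ρ (tailPair ρ δ)⟫| +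
          |normConst (-1 / 2 - δ) (-1 / 2 - δ / ρ)| * |⟪V, hW.chaos tensorLp h.remainder⟫| := by
          rw [diff, inner_add_right, inner_smul_right, inner_smul_right, ← abs_mul, ← abs_mul]
          exact abs_add_le _ _
      _ ≤ K₀ * δ * ‖V‖ + A * δ * (8 * ‖V‖ * E) := by gcongr
      _ = (K₀ + 8 * A * E) * (‖V‖ * δ) := by ring
      _ ≤ (K₀ + 2 * A * M + 8 * A * E) * (‖V‖ * δ) := by
          refine mul_le_mul_of_nonneg_right ?_ (by positivity)
          have : 0 ≤ 2 * A * M := by positivity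
          linarith
      _ = _ := by ring

end IsSmall

end BaiTaqqu

namespace BaiTaqqu

/-! ### Wasserstein distances and cumulants of close random variables -/

/-- The joint law of (X, Y) is a coupling. -/
theorem wasserstein_two_map_le {Ω : Type*} [MeasurableSpace Ω] {P : Measure Ω} {X Y : Ω → ℝ}
    (hX : AEMeasurable X P) (hY : AEMeasurable Y P) :
    wasserstein 2 (P.map X) (P.map Y) ≤ eLpNorm (fun ω ↦ X ω - Y ω) 2 P := by
  have hXY := hX.prodMk hY
  refine iInf₂_le_of_le (P.map fun ω ↦ (X ω, Y ω)) ?_ (iInf_le_of_le ?_ (le_of_eq ?_))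
  · exact AEMeasurable.map_map_of_aemeasurable measurable_fst.aemeasurable hXY
  · exact AEMeasurable.map_map_of_aemeasurable measurable_snd.aemeasurable hXY
  · rw [eLpNorm_eq_lintegral_rpow_enorm_toReal two_ne_zero ENNReal.ofNat_ne_top,
      ENNReal.toReal_ofNat, lintegral_map' (by fun_prop) hXY]

theorem cumulant_congr_of_identDistrib {Ω Ω' : Type*} [MeasurableSpace Ω] [MeasurableSpace Ω']
    {P : Measure Ω} {P' : Measure Ω'} {X : Ω → ℝ} {Y : Ω' → ℝ} (h : IdentDistrib X Y P P') (m : ℕ) :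
    cumulant m X P = cumulant m Y P' := by
  have : cgf X P = cgf Y P' := by
    unfold cgf
    rw [mgf_congr_identDistrib h]
  rw [cumulant, cumulant, this]

theorem measurable_Yvar (ρ : ℝ) : Measurable (Yvar ρ) := by
  unfold Yvar
  fun_prop

namespace IsIsonormal

variable {Ω : Type*} [MeasurableSpace Ω] {P : Measure Ω}
variable {H : Type*} [NormedAddCommGroup H] [InnerProductSpace ℝ H] {W : H →ₗᵢ[ℝ] Lp ℝ 2 P}

theorem identDistrib_limit (hW : IsIsonormal W) (ρ : ℝ) {e : Fin 2 → H} (he : Orthonormal ℝ e) :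
    IdentDistrib (hW.limit ρ e) (Yvar ρ) P gaussPair := by
  have hN : AEMeasurable (fun ω ↦ (W (e 0) ω, W (e 1) ω)) P :=
    (aemeasurable W _).prodMk (aemeasurable W _)
  refine ⟨(Lp.aestronglyMeasurable _).aemeasurable, (measurable_Yvar ρ).aemeasurable, ?_⟩
  rw [Measure.map_congr (hW.coe_limit ρ he), ← hW.map_pair he,
    AEMeasurable.map_map_of_aemeasurable (measurable_Yvar ρ).aemeasurable hN]
  rfl

theorem memLp_pow (hW : IsIsonormal W) {X : Lp ℝ 2 P} (hX : X ∈ closure (range hW.wickSum))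
    (j : ℕ) : MemLp (fun ω ↦ X ω ^ j) 2 P := by
  have hm : AEStronglyMeasurable (fun ω ↦ X ω ^ j) P := (Lp.aestronglyMeasurable X).pow j
  rw [memLp_two_iff_integrable_sq hm]
  refine (hW.integrable_abs_pow hX (j * 2)).congr (ae_of_all _ fun ω ↦ ?_)
  simp only
  rw [pow_mul, ← abs_pow, sq_abs]

theorem abs_integral_pow_le (hW : IsIsonormal W) {X : Lp ℝ 2 P}
    (hX : X ∈ closure (range hW.wickSum)) {s : ℝ} (hs : ‖X‖ ≤ s) (n : ℕ) :
    |∫ ω, X ω ^ n ∂P| ≤ 4 * n.factorial * (8 * s) ^ n := by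
  refine (abs_integral_le_integral_abs).trans ?_
  simp only [abs_pow]
  exact hW.integral_abs_pow_le hX hs n

/-- If `R` is almost orthogonal to all functions of an orthonormal pair, then it is almost orthogonal
to the powers of `Y_ρ`. -/
theorem abs_integral_limit_pow_mul_le (hW : IsIsonormal W) {ρ : ℝ} (hρ : 0 < ρ) {e : Fin 2 → H}
    (he : Orthonormal ℝ e) {R : Lp ℝ 2 P} {K δ : ℝ}
    (hR : ∀ {v : (Fin 2 → ℝ) → ℝ}, Measurable v → ∀ {V : Lp ℝ 2 P},
      V =ᵐ[P] (fun ω ↦ v fun i ↦ W (e i) ω) → |⟪V, R⟫| ≤ K * ‖V‖ * δ) (hK : 0 ≤ K)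
    (hδ : 0 ≤ δ) (j : ℕ) :
    |∫ ω, hW.limit ρ e ω ^ j * R ω ∂P| ≤ K * √(4 * (j * 2).factorial * 8 ^ (j * 2)) * δ := by
  have hY := hW.limit_mem_closure ρ e
  set V : Lp ℝ 2 P := (hW.memLp_pow hY j).toLp with hV
  have hVc : V =ᵐ[P] fun ω ↦ hW.limit ρ e ω ^ j := (hW.memLp_pow hY j).coeFn_toLp
  have e1 : ∫ ω, hW.limit ρ e ω ^ j * R ω ∂P = ⟪V, R⟫ := by
    rw [L2.inner_def]
    refine integral_congr_ae ?_
    filter_upwards [hVc] with ω h1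
    rw [h1]
    simp [mul_comm]
  have e2 : ‖V‖ ^ 2 ≤ 4 * (j * 2).factorial * 8 ^ (j * 2) := by
    rw [← real_inner_self_eq_norm_sq, L2.inner_def]
    have := hW.integral_abs_pow_le hY (hW.norm_limit hρ he).le (j * 2)
    rw [mul_one] at this
    refine (le_of_eq (integral_congr_ae ?_)).trans this
    filter_upwards [hVc] with ω h1
    rw [h1]
    simp only [RCLike.inner_apply, conj_trivial]
    rw [pow_mul, ← abs_pow, sq_abs, sq]
  rw [e1]
  refine (hR (v := fun x ↦ Yvar ρ (x 0, x 1) ^ j) ?_ (V := V) ?_).trans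
    (by gcongr; exact Real.le_sqrt_of_sq_le e2)
  · exact ((measurable_Yvar ρ).comp (by fun_prop)).pow_const j
  · filter_upwards [hVc, hW.coe_limit ρ he] with ω h1 h2
    rw [h1, h2]

end IsIsonormal

theorem eventually_of_neg_sub {p : ℝ → Prop} (h : ∀ᶠ δ in 𝓝[>] (0 : ℝ), p δ) :
    ∀ᶠ γ in 𝓝[<] (-1 / 2 : ℝ), p (-γ - 1 / 2) := by
  refine Tendsto.eventually ?_ h
  refine tendsto_nhdsWithin_iff.2 ⟨?_, ?_⟩
  · have : Tendsto (fun γ : ℝ ↦ -γ - 1 / 2) (𝓝 (-1 / 2)) (𝓝 (-(-1 / 2) - 1 / 2)) :=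
      (by fun_prop : Continuous fun γ : ℝ ↦ -γ - 1 / 2).tendsto _
    refine (this.mono_left nhdsWithin_le_nhds).trans (le_of_eq ?_)
    norm_num
  · filter_upwards [self_mem_nhdsWithin] with γ hγ
    rw [mem_Iio] at hγ
    rw [mem_Ioi]
    linarith

/-- The moments of `Y + R` and `Y`, where `R` is small and almost orthogonal to the powers of `Y`,
differ by the order of the square of the norm of `R`. -/
theorem exists_abs_integral_pow_sub_le_of_norm_le {K ρ : ℝ} (hK : 0 < K) (hρ : 0 < ρ) (k : ℕ) :
    ∃ C : ℝ, 0 ≤ C ∧ ∀ {Ω : Type*} [MeasurableSpace Ω] {P : Measure Ω} [IsProbabilityMeasure P]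
      {W : Lp ℝ 2 (volume : Measure ℝ) →ₗᵢ[ℝ] Lp ℝ 2 P} (hW : IsIsonormal W)
      {e : Fin 2 → Lp ℝ 2 (volume : Measure ℝ)} (_ : Orthonormal ℝ e) {R : Lp ℝ 2 P} {δ : ℝ},
      0 < δ → R ∈ closure (range hW.wickSum) → ‖R‖ ≤ 1 → ‖R‖ ≤ K * √δ →
      (∀ {v : (Fin 2 → ℝ) → ℝ}, Measurable v → ∀ {V : Lp ℝ 2 P},
        V =ᵐ[P] (fun ω ↦ v fun i ↦ W (e i) ω) → |⟪V, R⟫| ≤ K * ‖V‖ * δ) →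
      |∫ ω, (hW.limit ρ e + R : Lp ℝ 2 P) ω ^ k ∂P - ∫ ω, hW.limit ρ e ω ^ k ∂P| ≤ C * δ := by
  match k with
  | 0 => exact ⟨0, le_rfl, fun _ _ _ _ _ _ _ _ ↦ by simp⟩
  | 1 =>
    refine ⟨K * √(4 * (0 * 2).factorial * 8 ^ (0 * 2)), by positivity, ?_⟩
    intro Ω _ P _ W hW e he R δ hδ hRc _ _ hR
    have h1 := hW.abs_integral_limit_pow_mul_le hρ he hR hK.le hδ.le 0
    have hY : Integrable (hW.limit ρ e) P := (Lp.memLp _).integrable one_le_two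
    have hRi : Integrable R P := (Lp.memLp R).integrable one_le_two
    have h2 : ∫ ω, (hW.limit ρ e + R : Lp ℝ 2 P) ω ∂P = ∫ ω, hW.limit ρ e ω ∂P + ∫ ω, R ω ∂P := by
      rw [← integral_add hY hRi]
      exact integral_congr_ae (Lp.coeFn_add _ _)
    simp only [pow_one]
    rw [h2, add_sub_cancel_left]
    simp only [pow_zero, one_mul] at h1
    exact h1
  | k + 2 =>
    obtain ⟨C, hC, hb⟩ := IsIsonormal.exists_abs_integral_pow_sub_le
      (H := Lp ℝ 2 (volume : Measure ℝ)) 1 k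
    -- Chosen so that D δ dominates both ‖R‖² and the linear term.
    set D : ℝ := K ^ 2 + K * √(4 * ((k + 1) * 2).factorial * 8 ^ ((k + 1) * 2)) with hD
    have hD0 : 0 < D := by positivity
    refine ⟨C * D, by positivity, ?_⟩
    intro Ω _ P _ W hW e he R δ hδ hRc hR1 hRn hR
    rw [mul_assoc]
    refine hb hW (by positivity) rfl (hW.limit_mem_closure ρ e) hRc (hW.norm_limit hρ he).le hR1 ?_ ?_
    · have h1 : ‖R‖ ^ 2 ≤ (K * √δ) ^ 2 := pow_le_pow_left₀ (norm_nonneg _) hRn 2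
      rw [mul_pow, Real.sq_sqrt hδ.le] at h1
      refine h1.trans (mul_le_mul_of_nonneg_right ?_ hδ.le)
      rw [hD]
      exact le_add_of_nonneg_right (by positivity)
    · refine (hW.abs_integral_limit_pow_mul_le hρ he hR hK.le hδ.le (k + 1)).trans
        (mul_le_mul_of_nonneg_right ?_ hδ.le)
      rw [hD]
      exact le_add_of_nonneg_left (sq_nonneg K)

/-! ### The two estimates in terms of δ, and the theorem. -/

theorem exists_abs_cumulant_Zvar_sub_le {ρ : ℝ} (hρ : ρ ∈ Ioo (0 : ℝ) 1) (m : ℕ) :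
    ∃ C : ℝ, 0 < C ∧ ∀ᶠ δ in 𝓝[>] (0 : ℝ), ∀ (Ω : Type*) [MeasurableSpace Ω] (P : Measure Ω)
      [IsProbabilityMeasure P] (B : ℝ → Ω → ℝ), IsTwoSidedBrownian B P →
      |cumulant (m + 1) (Zvar B P (-1 / 2 - δ) (-1 / 2 - δ / ρ)) P -
        cumulant (m + 1) (Yvar ρ) gaussPair| ≤ C * δ := by
  obtain ⟨K, hK, hev⟩ := IsSmall.exists_norm_diff_le hρ
  choose c hc0 hc using exists_abs_integral_pow_sub_le_of_norm_le hK hρ.1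
  -- The inner 2 bounds the norms of Y and of Y + R once K√δ ≤ 1; the sum bounds all moments up to
  -- order m + 1 at once.
  set M : ℝ := ∑ k ∈ Finset.range (m + 2), 4 * (k.factorial : ℝ) * (8 * 2) ^ k with hM
  have hMk : ∀ k ≤ m + 1, 4 * (k.factorial : ℝ) * (8 * 2) ^ k ≤ M := fun k hk ↦
    Finset.single_le_sum (f := fun k : ℕ ↦ 4 * (k.factorial : ℝ) * (8 * 2) ^ k)
      (fun _ _ ↦ by positivity) (Finset.mem_range.2 (by omega))
  set D : ℝ := ∑ k ∈ Finset.range (m + 2), c k with hD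
  have hDk : ∀ k ≤ m + 1, c k ≤ D := fun k hk ↦
    Finset.single_le_sum (f := c) (fun _ _ ↦ hc0 _) (Finset.mem_range.2 (by omega))
  have hD0 : 0 ≤ D := Finset.sum_nonneg fun k _ ↦ hc0 k
  obtain ⟨C, hC, hcum⟩ := exists_abs_cumulant_sub_le M m
  refine ⟨C * D + 1, by positivity, ?_⟩
  have hone : ∀ᶠ δ in 𝓝[>] (0 : ℝ), K * √δ ≤ 1 := by
    have : Tendsto (fun δ ↦ K * √δ) (𝓝 0) (𝓝 (K * √0)) :=
      (by fun_prop : Continuous fun δ ↦ K * √δ).tendsto _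
    rw [Real.sqrt_zero, mul_zero] at this
    exact (this.mono_left nhdsWithin_le_nhds).eventually_le_const one_pos
  filter_upwards [hev, hone] with δ ⟨h, hδ⟩ h1 Ω _ P _ B hB
  obtain ⟨W, hW, hWB⟩ := hB.exists_isIsonormal
  obtain ⟨hn, hi⟩ := hδ hW
  have h0 := h.pos
  have he := h.orthonormal_tailPair
  have hYc := hW.limit_mem_closure ρ (tailPair ρ δ)
  have hRc := h.diff_mem_closure hW
  have hXc : hW.limit ρ (tailPair ρ δ) + h.diff hW ∈ closure (range hW.wickSum) := by
    simpa using hW.add_smul_mem_closure 1 1 hYc hRc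
  have hYn := hW.norm_limit hρ.1 he
  have hXn : ‖hW.limit ρ (tailPair ρ δ) + h.diff hW‖ ≤ 2 := by
    refine (norm_add_le _ _).trans ?_
    linarith
  have hZ := h.Zvar_ae_eq hW hWB
  have hZm : AEMeasurable (Zvar B P (-1 / 2 - δ) (-1 / 2 - δ / ρ)) P :=
    (Lp.aestronglyMeasurable _).aemeasurable.congr hZ.symm
  rw [cumulant_congr_of_identDistrib (IdentDistrib.of_ae_eq hZm hZ),
    ← cumulant_congr_of_identDistrib (hW.identDistrib_limit ρ he)]
  refine (hcum (ε := D * δ) (by positivity) (hW.zero_mem_interior_integrableExpSet hXc)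
    (hW.zero_mem_interior_integrableExpSet hYc)
    (fun k hk ↦ (hW.abs_integral_pow_le hXc hXn k).trans (hMk k hk))
    (fun k hk ↦ (hW.abs_integral_pow_le hYc (hYn.trans_le one_le_two) k).trans (hMk k hk))
    fun k hk ↦ ?_).trans ?_
  · exact (hc k hW he h0 hRc (hn.trans h1) hn hi).trans
      (mul_le_mul_of_nonneg_right (hDk k hk) h0.le)
  · linarith

theorem exists_wasserstein_Zvar_le {ρ : ℝ} (hρ : ρ ∈ Ioo (0 : ℝ) 1) :
    ∃ C : ℝ, 0 < C ∧ ∀ᶠ δ in 𝓝[>] (0 : ℝ), ∀ (Ω : Type*) [MeasurableSpace Ω] (P : Measure Ω)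
      [IsProbabilityMeasure P] (B : ℝ → Ω → ℝ), IsTwoSidedBrownian B P →
      wasserstein 2 (P.map (Zvar B P (-1 / 2 - δ) (-1 / 2 - δ / ρ))) (gaussPair.map (Yvar ρ)) ≤
        ENNReal.ofReal (C * √δ) := by
  obtain ⟨K, hK, hev⟩ := IsSmall.exists_norm_diff_le hρ
  refine ⟨K, hK, ?_⟩
  filter_upwards [hev] with δ ⟨h, hδ⟩ Ω _ P _ B hB
  obtain ⟨W, hW, hWB⟩ := hB.exists_isIsonormal
  have hZ := h.Zvar_ae_eq hW hWB
  rw [Measure.map_congr hZ, ← (hW.identDistrib_limit ρ h.orthonormal_tailPair).map_eq]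
  refine (wasserstein_two_map_le (Lp.aestronglyMeasurable _).aemeasurable
    (Lp.aestronglyMeasurable _).aemeasurable).trans ?_
  have e : eLpNorm (fun ω ↦ (hW.limit ρ (tailPair ρ δ) + h.diff hW : Lp ℝ 2 P) ω -
      hW.limit ρ (tailPair ρ δ) ω) 2 P = ‖h.diff hW‖ₑ := by
    rw [Lp.enorm_def]
    refine eLpNorm_congr_ae ?_
    filter_upwards [Lp.coeFn_add (hW.limit ρ (tailPair ρ δ)) (h.diff hW)] with ω h1
    rw [h1, Pi.add_apply, add_sub_cancel_left]
  rw [e, ← ofReal_norm]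
  exact ENNReal.ofReal_le_ofReal (hδ hW).1

theorem gammaTwo_eq (ρ γ : ℝ) : gammaTwo ρ γ = -1 / 2 - (-γ - 1 / 2) / ρ := by
  rw [gammaTwo]
  ring

end BaiTaqqu

theorem lemma3p10 (ρ : ℝ) (hρ : ρ ∈ Set.Ioo (0 : ℝ) 1) :
    (∀ m : ℕ, 3 ≤ m → ∃ C : ℝ, 0 < C ∧ ∀ᶠ γ₁ in 𝓝[<] (-1 / 2 : ℝ),
      ∀ (Ω : Type*) [MeasurableSpace Ω] (P : Measure Ω) [IsProbabilityMeasure P] (B : ℝ → Ω → ℝ),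
        BaiTaqqu.IsTwoSidedBrownian B P →
        |BaiTaqqu.cumulant m (BaiTaqqu.Zvar B P γ₁ (BaiTaqqu.gammaTwo ρ γ₁)) P -
            BaiTaqqu.cumulant m (BaiTaqqu.Yvar ρ) BaiTaqqu.gaussPair| ≤ C * (-γ₁ - 1 / 2)) ∧
    (∃ C : ℝ, 0 < C ∧ ∀ᶠ γ₁ in 𝓝[<] (-1 / 2 : ℝ),
      ∀ (Ω : Type*) [MeasurableSpace Ω] (P : Measure Ω) [IsProbabilityMeasure P] (B : ℝ → Ω → ℝ),
        BaiTaqqu.IsTwoSidedBrownian B P →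
        BaiTaqqu.wasserstein 2 (P.map (BaiTaqqu.Zvar B P γ₁ (BaiTaqqu.gammaTwo ρ γ₁)))
            (BaiTaqqu.gaussPair.map (BaiTaqqu.Yvar ρ)) ≤
          ENNReal.ofReal (C * √(-γ₁ - 1 / 2))) := by
  have e : ∀ γ : ℝ, -1 / 2 - (-γ - 1 / 2) = γ := fun γ ↦ by ring
  constructor
  · intro m hm
    obtain ⟨C, hC, h⟩ := BaiTaqqu.exists_abs_cumulant_Zvar_sub_le hρ (m - 1)
    refine ⟨C, hC, ?_⟩
    rw [Nat.sub_add_cancel (by omega : 1 ≤ m)] at h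
    filter_upwards [BaiTaqqu.eventually_of_neg_sub h] with γ hγ
    rwa [e, ← BaiTaqqu.gammaTwo_eq] at hγ
  · obtain ⟨C, hC, h⟩ := BaiTaqqu.exists_wasserstein_Zvar_le hρ
    refine ⟨C, hC, ?_⟩
    filter_upwards [BaiTaqqu.eventually_of_neg_sub h] with γ hγ
    rwa [e, ← BaiTaqqu.gammaTwo_eq] at hγ
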